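/- Let $u=1/m_1$, $v=1/m_2$ (with $1/\infty=0$), where $2\le m_1\le m_2\le\infty$, $m_1<\infty$ and $\frac1{m_1}+\frac1{m_2}<1$, and put $a=\frac12(1-u+v)$, $b=\frac12(1-u-v)$, $c=\frac12(1+u-v)$, so that $1-a-b=\frac1{m_1}$, $1-b-c=\frac1{m_2}$, $1-a-c=0$. Consider the Halphen system for formal power series $t_1,t_2,t_3\in\mathbb C[[q]]$, with $\dot t=q\,\frac{dt}{dq}$: $$\begin{aligned}\dot t_1&=(a-1)(t_1t_2+t_1t_3-t_2t_3)+(b+c-1)t_1^2,\\ \dot t_2&=(b-1)(t_2t_1+t_2t_3-t_1t_3)+(a+c-1)t_2^2,\\ \dot t_3&=(c-1)(t_3t_1+t_3t_2-t_1t_2)+(a+b-1)t_3^2,\end{aligned}$$ with the initial condition $t_1(0)=t_3(0)=0$ and $t_2=-1-(m_1+1)q+O(q^2)$ if $m_2=\infty$; $t_2=-1+(m_1^2m_2+m_1^2-m_1m_2^2-m_2^2)q+O(q^2)$ and $t_3-t_1=2m_1^2m_2^2\,q+O(q^2)$ if $m_2<\infty$ (the last condition follows from the others when $m_1\neq m_2$).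 This initial value problem has exactly one solution. The Hauptmodul of the triangle group of type $(m_1,m_2,\infty)$ is the Laurent series $J=\frac{t_3-t_2}{t_3-t_1}$. For a prime $p$, call a Laurent series $p$-integral if some nonzero constant multiple of it has all its coefficients in $\mathbb Z_{(p)}$, the ring of rational numbers with denominator prime to $p$. **Theorem.** (i) Let $2\le m_1\le m_2$ be integers with $\frac1{m_1}+\frac1{m_2}<1$ and let $p>2m_1m_2$ be a prime. The Hauptmodul $J$ for the triangle group of type $(m_1,m_2,\infty)$ is $p$-integral if and only if for some $\epsilon,\epsilon'\in\{1,-1\}$ either $$p\equiv\epsilon \pmod{2m_1}\ \text{ and }\ p\equiv\epsilon'\epsilon\pmod{2m_2},$$ or $$p\equiv m_1+\epsilon \pmod{2m_1}\ \text{ and }\ p\equiv m_2+\epsilon'\epsilon\pmod{2m_2}.$$ (ii) Let $m\ge2$ be an integer and let $p>2m$ be a prime. The Hauptmodul $J$ for the triangle group of type $(m,\infty,\infty)$ is $p$-integral if and only if $p\equiv\pm1\pmod{2m}$. -/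

import Mathlib

noncomputable section

/-- The parameter `a` of the Halphen system of a triangle group of type `(m₁, m₂, ∞)`,
in terms of `u = 1 / m₁` and `v = 1 / m₂` (with `1 / ∞ = 0`). -/
def halphenA (u v : ℂ) : ℂ := (1 - u + v) / 2

/-- The parameter `b` of the Halphen system. -/
def halphenB (u v : ℂ) : ℂ := (1 - u - v) / 2

/-- The parameter `c` of the Halphen system. -/
def halphenC (u v : ℂ) : ℂ := (1 + u - v) / 2

/-- The three numbers above are the unique solution of the linear equations
`1 - a - b = 1 / m₁`, `1 - b - c = 1 / m₂`, `1 - a - c = 0`. -/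
theorem halphen_params_iff (u v a b c : ℂ) :
    (1 - a - b = u ∧ 1 - b - c = v ∧ 1 - a - c = 0) ↔
      (a = halphenA u v ∧ b = halphenB u v ∧ c = halphenC u v) := by
  unfold halphenA halphenB halphenC
  constructor
  · rintro ⟨h1, h2, h3⟩
    refine ⟨?_, ?_, ?_⟩
    · linear_combination (-h1 + h2 - h3) / 2
    · linear_combination (-h1 - h2 + h3) / 2
    · linear_combination (h1 - h2 - h3) / 2
  · rintro ⟨rfl, rfl, rfl⟩
    refine ⟨?_, ?_, ?_⟩ <;> ring

/-- A triple `t₁, t₂, t₃` of formal power series in `q` with complex coefficients. -/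
@[ext]
structure SeriesTriple where
  t₁ : PowerSeries ℂ
  t₂ : PowerSeries ℂ
  t₃ : PowerSeries ℂ

/-- The derivation `q d/dq` of formal power series in `q`. -/
def qDeriv (f : PowerSeries ℂ) : PowerSeries ℂ :=
  PowerSeries.X * PowerSeries.derivative ℂ f

/-- `t` solves the Halphen system with parameters `a, b, c`. -/
def SolvesHalphen (a b c : ℂ) (t : SeriesTriple) : Prop :=
  qDeriv t.t₁ =
      (a - 1) • (t.t₁ * t.t₂ + t.t₁ * t.t₃ - t.t₂ * t.t₃) + (b + c - 1) • t.t₁ ^ 2 ∧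
  qDeriv t.t₂ =
      (b - 1) • (t.t₂ * t.t₁ + t.t₂ * t.t₃ - t.t₁ * t.t₃) + (a + c - 1) • t.t₂ ^ 2 ∧
  qDeriv t.t₃ =
      (c - 1) • (t.t₃ * t.t₁ + t.t₃ * t.t₂ - t.t₁ * t.t₂) + (a + b - 1) • t.t₃ ^ 2

/-- `t` is the solution of the Halphen system for the type `(m₁, m₂, ∞)` with `m₁, m₂` finite:
`t₁(0) = t₃(0) = 0` and
`t₂ = -1 + (m₁² m₂ + m₁² - m₁ m₂² - m₂²) q + O(q²)`.
The last clause fixes the scale of `q`: it follows from the others if `m₁ ≠ m₂`; if `m₁ = m₂`, the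
prescribed linear coefficient of `t₂` is zero and leaves the scale of `q` open. -/
structure IsHalphenSolution (m₁ m₂ : ℕ) (t : SeriesTriple) : Prop where
  solves : SolvesHalphen (halphenA (1 / m₁) (1 / m₂)) (halphenB (1 / m₁) (1 / m₂))
    (halphenC (1 / m₁) (1 / m₂)) t
  t₁_zero : PowerSeries.coeff 0 t.t₁ = 0
  t₃_zero : PowerSeries.coeff 0 t.t₃ = 0
  t₂_zero : PowerSeries.coeff 0 t.t₂ = -1
  t₂_one : PowerSeries.coeff 1 t.t₂ =
    (m₁ : ℂ) ^ 2 * m₂ + (m₁ : ℂ) ^ 2 - (m₁ : ℂ) * (m₂ : ℂ) ^ 2 - (m₂ : ℂ) ^ 2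
  scale : PowerSeries.coeff 1 (t.t₃ - t.t₁) = 2 * (m₁ : ℂ) ^ 2 * (m₂ : ℂ) ^ 2

/-- `t` is the solution of the Halphen system for the type `(m, ∞, ∞)` with `m` finite:
`t₁(0) = t₃(0) = 0` and `t₂ = -1 - (m + 1) q + O(q²)`. -/
structure IsHalphenSolutionTop (m : ℕ) (t : SeriesTriple) : Prop where
  solves : SolvesHalphen (halphenA (1 / m) 0) (halphenB (1 / m) 0) (halphenC (1 / m) 0) t
  t₁_zero : PowerSeries.coeff 0 t.t₁ = 0
  t₃_zero : PowerSeries.coeff 0 t.t₃ = 0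
  t₂_zero : PowerSeries.coeff 0 t.t₂ = -1
  t₂_one : PowerSeries.coeff 1 t.t₂ = -((m : ℂ) + 1)

/-- `J = (t₃ - t₂) / (t₃ - t₁)`, a Laurent series in `q`. -/
def hauptmodul (t : SeriesTriple) : LaurentSeries ℂ :=
  ((t.t₃ - t.t₂ : PowerSeries ℂ) : LaurentSeries ℂ) /
    ((t.t₃ - t.t₁ : PowerSeries ℂ) : LaurentSeries ℂ)

/-- A Laurent series is `p`-integral if, after multiplication by a nonzero constant, all its
coefficients are `p`-adic integers, i.e. rational numbers whose denominator is prime to `p`. -/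
def IsPIntegral (p : ℕ) (f : LaurentSeries ℂ) : Prop :=
  ∃ k : ℂ, k ≠ 0 ∧ ∀ n : ℤ, ∃ r : ℚ, ¬ p ∣ r.den ∧ k * f.coeff n = (r : ℂ)

end

/-!
The solution of the Halphen system is explicit. Let `F = ₂F₁(a, b; 1; z)`, let `F log z + G` be the
second solution of the hypergeometric equation at `0`, and let `q = s⁻¹ z exp (G / F)` be the
canonical coordinate, with inverse series `z = h(q)`. Then `t₁, t₂, t₃` are rational expressions in
`z`, `z F' / F` and `q z'(q) / z`, composed with `h`, and `J = 1 / z(q)`. The scale `s` is fixed by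
the first coefficient of `t₃ - t₁`, and the recursion for the coefficients has no other solution
(`HalphenIVP.unique`, `halphenIVP_halphenSolution`, `coeff_hauptmodul_halphenSolution`). So `J` is
`p`-integral exactly if `V = s q J = exp (G / F)(z(q))` has bounded denominators at `p`.

The parameters are fractions `a = rₐ / D`, `b = r_b / D` with `D = 2 m₁ m₂` or `D = 2 m`. Dwork's map
sends `r / D` to the fraction `r' / D` with `0 < r' < D` and `p r' ≡ r` modulo `D`. Write
`g = G / F`, and `g'` for the same series with the parameters `a', b'`. Dwork's congruence
`p g(X) ≡ g'(Xᵖ)` modulo `p` (`isFrobeniusSequence_hypLog`) comes from a congruence between partial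
sums of convolutions over blocks of length `pˢ` (`IsDworkSystem.block_sum`,
`IsDworkSystem.log_congruence`).

If `{a', b'}` is `{a, b}` or `{1 - a, 1 - b}`, then `g' = g`, in the second case by Euler's
transformation (`hypLog_one_sub`), and the lemma of Dieudonné and Dwork shows that `exp g`, hence
`V`, is integral.

Conversely, let `V` have bounded denominators. Dwork's map is periodic on the fractions, so some
power `P` of `p` satisfies `P g(X) ≡ g(Xᴾ)` modulo `p`, and `(exp g)(X)ᴾ` and `(exp g)(Xᴾ)` agree
modulo `p`. If `V` were not integral, there would be a smallest `c > 1` with `‖Vₙ‖ ≤ cⁿ`, attained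
for some `n`; but then the same bound holds for `exp g`, the congruence makes it strict, and it
becomes strict for `V` (`IsInverseScale.isPadicIntegral_of_bounded`). So `exp g` is integral, whence
`exp (g - g') ≡ 1` modulo `p`. The first two coefficients of `g` determine `(1 - a - b)²` and
`(a - b)²`, so that these numbers agree modulo `p` with those for `a', b'`. As `p` is large, this
forces `1 - a' - b' = ± (1 - a - b)` and `a' - b' = ± (a - b)`, and these equations are the
congruences of the theorem (`congruence_iff`).
-/

noncomputable section

open Finset

/-! ### Dwork's congruences for block sums -/

section BlockSums

/-- A block `[p a, p b)` is the disjoint union of the residue classes modulo `p`. -/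
theorem sum_Ico_mul {M : Type*} [AddCommMonoid M] (p a b : ℕ) (hab : a ≤ b) (F : ℕ → M) :
    ∑ j ∈ Ico (p * a) (p * b), F j = ∑ j ∈ Ico a b, ∑ w ∈ range p, F (w + p * j) := by
  induction b, hab using Nat.le_induction with
  | base => simp
  | succ b hab ih =>
    have top : ∑ j ∈ Ico (p * b) (p * (b + 1)), F j = ∑ w ∈ range p, F (w + p * b) := by
      rw [Finset.sum_Ico_eq_sum_range, show p * (b + 1) - p * b = p by rw [mul_add]; simp]
      exact Finset.sum_congr rfl fun w _ => by rw [add_comm]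
    rw [← Finset.sum_Ico_consecutive F (Nat.mul_le_mul_left p hab)
      (Nat.mul_le_mul_left p (Nat.le_succ b)), ih, Finset.sum_Ico_succ_top hab, top]

/-- The sum over `j ≤ K`, regrouped by the value of `j / N`. -/
theorem sum_range_blocks {M : Type*} [AddCommMonoid M] (N K : ℕ) (hN : 0 < N) (F : ℕ → M) :
    ∑ j ∈ range (K + 1), F j =
      ∑ m ∈ range (K + 1), ∑ j ∈ Ico (N * m) (N * (m + 1)), if j ≤ K then F j else 0 := by
  rw [← Finset.sum_fiberwise_of_maps_to (s := range (K + 1)) (t := range (K + 1))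
    (g := fun j => j / N)]
  · refine Finset.sum_congr rfl fun m _ => ?_
    rw [← Finset.sum_filter]
    refine Finset.sum_congr ?_ fun _ _ => rfl
    ext j
    simp only [mem_filter, mem_range, mem_Ico, Nat.div_eq_iff hN, Nat.lt_succ_iff]
    constructor
    · rintro ⟨h1, h2, h3⟩
      refine ⟨⟨by linarith [mul_comm m N], ?_⟩, h1⟩
      have : N * (m + 1) = m * N + N := by ring
      omega
    · rintro ⟨⟨h1, h2⟩, h3⟩
      refine ⟨h3, by linarith [mul_comm m N], ?_⟩
      have : N * (m + 1) = m * N + N := by ring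
      omega
  · intro j hj
    simp only [mem_range] at hj ⊢
    exact lt_of_le_of_lt (Nat.div_le_self _ _) hj

variable {p : ℕ} [hp : Fact p.Prime]

theorem padic_norm_sum_le {ι : Type*} {s : Finset ι} {f : ι → ℚ_[p]} {C : ℝ} (hC : 0 ≤ C)
    (h : ∀ i ∈ s, ‖f i‖ ≤ C) : ‖∑ i ∈ s, f i‖ ≤ C :=
  IsUltrametricDist.norm_sum_le_of_forall_le_of_nonneg hC h

theorem padic_norm_add_le {x y : ℚ_[p]} {C : ℝ} (hx : ‖x‖ ≤ C) (hy : ‖y‖ ≤ C) : ‖x + y‖ ≤ C :=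
  (Padic.nonarchimedean x y).trans (max_le hx hy)

theorem padic_norm_sub_le {x y : ℚ_[p]} {C : ℝ} (hx : ‖x‖ ≤ C) (hy : ‖y‖ ≤ C) : ‖x - y‖ ≤ C := by
  rw [sub_eq_add_neg]; exact padic_norm_add_le hx (by rwa [norm_neg])

theorem inv_prime_pos : (0 : ℝ) < (p : ℝ)⁻¹ := inv_pos.2 (by exact_mod_cast hp.out.pos)

theorem inv_prime_le_one : (p : ℝ)⁻¹ ≤ 1 :=
  inv_le_one_of_one_le₀ (by exact_mod_cast hp.out.one_lt.le)

/-- A family of sequences `A i` of `p`-adic integers that reproduces itself under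
`n ↦ v + p n`: the quotient `A i (v + p n) / A (i + 1) n` is a function `f i v n` of `n` that
contracts `p`-adic distances by the factor `1 / p`. -/
structure IsDworkSystem (A : ℕ → ℕ → ℚ_[p]) (f : ℕ → ℕ → ℕ → ℚ_[p]) : Prop where
  step : ∀ i v n, v < p → A i (v + p * n) = f i v n * A (i + 1) n
  norm_le : ∀ i n, ‖A i n‖ ≤ 1
  factor_norm_le : ∀ i v n, v < p → ‖f i v n‖ ≤ 1
  factor_lip : ∀ i v s m n, v < p → m ≡ n [MOD p ^ s] →
    ‖f i v m - f i v n‖ ≤ (p : ℝ)⁻¹ ^ (s + 1)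

/-- `h` multiplies `p`-adic distances on `{0, …, K}` by at most `p⁻ʳ`. -/
def PadicLip (K r : ℕ) (h : ℕ → ℚ_[p]) : Prop :=
  ∀ t x y, x ≤ K → y ≤ K → x ≡ y [MOD p ^ t] → ‖h x - h y‖ ≤ (p : ℝ)⁻¹ ^ (t + r)

theorem PadicLip.mul {K r : ℕ} {h k : ℕ → ℚ_[p]} (hh : PadicLip K r h) (hk : PadicLip K r k)
    (h1 : ∀ x ≤ K, ‖h x‖ ≤ 1) (k1 : ∀ x ≤ K, ‖k x‖ ≤ 1) :
    PadicLip K r fun x => h x * k x := by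
  intro t x y hx hy hxy
  have e : h x * k x - h y * k y = h x * (k x - k y) + (h x - h y) * k y := by ring
  have hpos : (0 : ℝ) ≤ (p : ℝ)⁻¹ ^ (t + r) := pow_nonneg inv_prime_pos.le _
  rw [e]
  refine padic_norm_add_le ?_ ?_ <;> rw [norm_mul]
  · calc _ ≤ 1 * (p : ℝ)⁻¹ ^ (t + r) :=
        mul_le_mul (h1 x hx) (hk t x y hx hy hxy) (norm_nonneg _) zero_le_one
      _ = _ := one_mul _
  · calc _ ≤ (p : ℝ)⁻¹ ^ (t + r) * 1 :=
        mul_le_mul (hh t x y hx hy hxy) (k1 y hy) (norm_nonneg _) hpos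
      _ = _ := mul_one _

theorem PadicLip.sum {ι : Type*} {K r : ℕ} {s : Finset ι} {h : ι → ℕ → ℚ_[p]}
    (hh : ∀ i ∈ s, PadicLip K r (h i)) : PadicLip K r fun x => ∑ i ∈ s, h i x := by
  intro t x y hx hy hxy
  rw [← Finset.sum_sub_distrib]
  exact padic_norm_sum_le (pow_nonneg inv_prime_pos.le _) fun i hi => hh i hi t x y hx hy hxy

theorem modEq_add_mul_left {p t x y : ℕ} (w : ℕ) (h : x ≡ y [MOD p ^ t]) :
    w + p * x ≡ w + p * y [MOD p ^ (t + 1)] := by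
  refine Nat.ModEq.add_left w ?_
  rw [pow_succ, mul_comm]
  exact Nat.ModEq.mul_left' p h

/-- The part of the induction step of `IsDworkSystem.block_sum` that belongs to the pairs of
residues `w, κ - w`. The terms for `w` and for `κ - w` recombine to a sum of the same shape for the
next sequence, with a function `D` that gains one factor `p`. -/
theorem IsDworkSystem.block_sum_part {A : ℕ → ℕ → ℚ_[p]} {f : ℕ → ℕ → ℕ → ℚ_[p]}
    (H : IsDworkSystem A f) (s r i m κ L : ℕ)
    (ih : ∀ D : ℕ → ℚ_[p], PadicLip L (r + 1) D →
      ‖∑ j ∈ Ico (p ^ s * m) (p ^ s * (m + 1)), (if j ≤ L then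
        A (i + 1) j * A (i + 1) (L - j) * (D j - D (L - j)) else 0)‖ ≤
        (p : ℝ)⁻¹ ^ (s + (r + 1)) * ‖A (i + 1 + s) m‖)
    (h : ℕ → ℚ_[p]) (hh : PadicLip (κ + p * L) r h) :
    ‖∑ j ∈ Ico (p ^ s * m) (p ^ s * (m + 1)), ∑ w ∈ (range p).filter (fun w => w ≤ κ ∧ κ - w < p),
      (if j ≤ L then A i (w + p * j) * A i (κ + p * L - (w + p * j)) *
        (h (w + p * j) - h (κ + p * L - (w + p * j))) else 0)‖ ≤
      (p : ℝ)⁻¹ ^ (s + 1 + r) * ‖A (i + (s + 1)) m‖ := by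
  set W := (range p).filter (fun w => w ≤ κ ∧ κ - w < p) with hW
  have hWmem : ∀ w ∈ W, w < p ∧ w ≤ κ ∧ κ - w < p := fun w hw => by
    simpa [hW, mem_filter] using hw
  set k : ℕ → ℚ_[p] := fun x => h x - h 0 with hk
  have hk_le : ∀ x ≤ κ + p * L, ‖k x‖ ≤ (p : ℝ)⁻¹ ^ r := fun x hx => by
    simpa using hh 0 x 0 hx (Nat.zero_le _) (by simp [Nat.ModEq, Nat.mod_one])
  let D : ℕ → ℚ_[p] := fun x =>
    ∑ w ∈ W, f i w x * k (w + p * x) * f i (κ - w) (L - x)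
  have hD : PadicLip L (r + 1) D := by
    refine PadicLip.sum fun w hw => ?_
    obtain ⟨h1, h2, h3⟩ := hWmem w hw
    have hwx : ∀ x ≤ L, w + p * x ≤ κ + p * L := fun x hx =>
      add_le_add h2 (Nat.mul_le_mul_left p hx)
    intro t x y hx hy hxy
    have hxy' : L - x ≡ L - y [MOD p ^ t] := by
      refine Nat.ModEq.add_right_cancel (c := x) (d := y) hxy ?_
      rw [Nat.sub_add_cancel hx, Nat.sub_add_cancel hy]
    have b1 := H.factor_lip i w t x y h1 hxy
    have b2 := H.factor_lip i (κ - w) t _ _ h3 hxy'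
    have b3 : ‖k (w + p * x) - k (w + p * y)‖ ≤ (p : ℝ)⁻¹ ^ (t + 1 + r) := by
      simp only [hk, sub_sub_sub_cancel_right]
      exact hh (t + 1) _ _ (hwx x hx) (hwx y hy) (modEq_add_mul_left w hxy)
    have c1 := H.factor_norm_le i w x h1
    have c2 := H.factor_norm_le i (κ - w) (L - x) h3
    have c2' := H.factor_norm_le i w y h1
    have c3 := hk_le _ (hwx x hx)
    have c4 := hk_le _ (hwx y hy)
    have c5 := H.factor_norm_le i (κ - w) (L - y) h3
    have e : f i w x * k (w + p * x) * f i (κ - w) (L - x) -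
        f i w y * k (w + p * y) * f i (κ - w) (L - y) =
        (f i w x - f i w y) * k (w + p * x) * f i (κ - w) (L - x) +
        f i w y * (k (w + p * x) - k (w + p * y)) * f i (κ - w) (L - x) +
        f i w y * k (w + p * y) * (f i (κ - w) (L - x) - f i (κ - w) (L - y)) := by ring
    have hP := (inv_prime_pos (p := p)).le
    rw [e]
    refine padic_norm_add_le (padic_norm_add_le ?_ ?_) ?_ <;> rw [norm_mul, norm_mul]
    · calc _ ≤ (p : ℝ)⁻¹ ^ (t + 1) * (p : ℝ)⁻¹ ^ r * 1 := by gcongr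
        _ = _ := by rw [mul_one, ← pow_add]; congr 1; ring
    · calc _ ≤ 1 * (p : ℝ)⁻¹ ^ (t + 1 + r) * 1 := by gcongr
        _ = _ := by rw [mul_one, one_mul]; congr 1; ring
    · calc _ ≤ 1 * (p : ℝ)⁻¹ ^ r * (p : ℝ)⁻¹ ^ (t + 1) := by gcongr
        _ = _ := by rw [one_mul, ← pow_add]; congr 1; ring
  have key := ih D hD
  have e : s + 1 + r = s + (r + 1) := by ring
  have e' : i + (s + 1) = i + 1 + s := by ring
  rw [e, e']
  convert key using 2
  refine Finset.sum_congr rfl fun j _ => ?_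
  split_ifs with hj
  swap
  · simp
  -- the reflection `w ↦ κ - w` of the set of residues
  have hrefl : D (L - j) = ∑ w ∈ W, f i (κ - w) (L - j) * k ((κ - w) + p * (L - j)) * f i w j := by
    refine Finset.sum_bij' (fun w _ => κ - w) (fun w _ => κ - w) ?_ ?_ ?_ ?_ ?_
    · intro w hw
      obtain ⟨h1, h2, h3⟩ := hWmem w hw
      simp only [hW, mem_filter, mem_range]; omega
    · intro w hw
      obtain ⟨h1, h2, h3⟩ := hWmem w hw
      simp only [hW, mem_filter, mem_range]; omega
    · intro w hw
      have := (hWmem w hw).2.1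
      omega
    · intro w hw
      have := (hWmem w hw).2.1
      omega
    · intro w hw
      have h2 := (hWmem w hw).2.1
      rw [Nat.sub_sub_self h2, Nat.sub_sub_self hj]
  rw [hrefl, ← Finset.sum_sub_distrib, Finset.mul_sum]
  refine Finset.sum_congr rfl fun w hw => ?_
  obtain ⟨h1, h2, h3⟩ := hWmem w hw
  have e1 : κ + p * L - (w + p * j) = (κ - w) + p * (L - j) := by
    have := Nat.mul_le_mul_left p hj
    rw [Nat.mul_sub]; omega
  rw [e1, H.step i w j h1, H.step i (κ - w) (L - j) h3]
  simp only [hk]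
  ring

/-- **Dwork's congruence for block sums.** Over a block of length `pˢ`, the antisymmetrised
convolution gains the factor `pˢ` and the value `A (i + s) m` that governs the block. -/
theorem IsDworkSystem.block_sum {A : ℕ → ℕ → ℚ_[p]} {f : ℕ → ℕ → ℕ → ℚ_[p]}
    (H : IsDworkSystem A f) (s : ℕ) : ∀ (r i m K : ℕ) (h : ℕ → ℚ_[p]), PadicLip K r h →
    ‖∑ j ∈ Ico (p ^ s * m) (p ^ s * (m + 1)), (if j ≤ K then
      A i j * A i (K - j) * (h j - h (K - j)) else 0)‖ ≤
      (p : ℝ)⁻¹ ^ (s + r) * ‖A (i + s) m‖ := by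
  induction s with
  | zero =>
    intro r i m K h hh
    have hpos : (0 : ℝ) ≤ (p : ℝ)⁻¹ ^ r := pow_nonneg inv_prime_pos.le _
    simp only [pow_zero, one_mul, Nat.Ico_succ_singleton, sum_singleton, zero_add, add_zero]
    split_ifs with hm
    · rw [norm_mul, norm_mul]
      have h1 := hh 0 m (K - m) hm (Nat.sub_le _ _) (by simp [Nat.ModEq, Nat.mod_one])
      rw [zero_add] at h1
      have h2 := H.norm_le i (K - m)
      calc _ ≤ ‖A i m‖ * 1 * (p : ℝ)⁻¹ ^ r := by gcongr
        _ = _ := by ring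
    · rw [norm_zero]; positivity
  | succ s ih =>
    intro r i m K h hh
    have hp0 := hp.out.pos
    have hblock : ∀ F : ℕ → ℚ_[p], ∑ j ∈ Ico (p ^ (s + 1) * m) (p ^ (s + 1) * (m + 1)), F j =
        ∑ j ∈ Ico (p ^ s * m) (p ^ s * (m + 1)), ∑ w ∈ range p, F (w + p * j) := fun F => by
      rw [pow_succ, mul_comm (p ^ s) p, mul_assoc, mul_assoc]
      exact sum_Ico_mul p _ _ (Nat.mul_le_mul_left _ (Nat.le_succ m)) F
    set K₀ := K % p
    set K₁ := K / p
    have hK : K₀ + p * K₁ = K := Nat.mod_add_div K p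
    have hK₀ : K₀ < p := Nat.mod_lt _ hp0
    have part1 := H.block_sum_part s r i m K₀ K₁ (fun D hD => ih (r + 1) (i + 1) m K₁ D hD) h
      (by rwa [hK])
    rw [hK] at part1
    have f1 : (range p).filter (fun w => w ≤ K₀ ∧ K₀ - w < p) =
        (range p).filter (fun w => w ≤ K₀) := by
      ext w; simp only [mem_filter, mem_range]; omega
    rw [f1] at part1
    rw [hblock]
    have split : ∀ F : ℕ → ℕ → ℚ_[p],
        ∑ j ∈ Ico (p ^ s * m) (p ^ s * (m + 1)), ∑ w ∈ range p, F j w =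
        ∑ j ∈ Ico (p ^ s * m) (p ^ s * (m + 1)), ∑ w ∈ (range p).filter (fun w => w ≤ K₀), F j w +
        ∑ j ∈ Ico (p ^ s * m) (p ^ s * (m + 1)),
          ∑ w ∈ (range p).filter (fun w => ¬ w ≤ K₀), F j w := fun F => by
      rw [← Finset.sum_add_distrib]
      exact Finset.sum_congr rfl fun j _ => (Finset.sum_filter_add_sum_filter_not _ _ _).symm
    rw [split]
    refine padic_norm_add_le ?_ ?_
    · refine le_of_eq_of_le ?_ part1
      congr 1
      refine Finset.sum_congr rfl fun j _ => Finset.sum_congr rfl fun w hw => ?_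
      simp only [mem_filter, mem_range] at hw
      have : w + p * j ≤ K ↔ j ≤ K₁ := by
        constructor
        · intro h1
          by_contra h2
          have : p * (K₁ + 1) ≤ p * j := Nat.mul_le_mul_left p (by omega)
          rw [mul_add] at this; omega
        · intro h1
          have := Nat.mul_le_mul_left p h1
          omega
      simp only [this]
    · rcases Nat.eq_zero_or_pos K₁ with h0 | h0
      · refine le_of_eq_of_le ?_ (show (0 : ℝ) ≤ _ by positivity)
        rw [norm_eq_zero]
        refine Finset.sum_eq_zero fun j _ => Finset.sum_eq_zero fun w hw => ?_
        simp only [mem_filter, mem_range] at hw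
        rw [if_neg]
        have : p * K₁ = 0 := by rw [h0, mul_zero]
        omega
      · have hK' : K₀ + p + p * (K₁ - 1) = K := by
          obtain ⟨c, hc⟩ : ∃ c, K₁ = c + 1 := ⟨K₁ - 1, by omega⟩
          rw [← hK, hc]; simp; ring
        have part2 := H.block_sum_part s r i m (K₀ + p) (K₁ - 1)
          (fun D hD => ih (r + 1) (i + 1) m (K₁ - 1) D hD) h (by rwa [hK'])
        rw [hK'] at part2
        have f2 : (range p).filter (fun w => w ≤ K₀ + p ∧ K₀ + p - w < p) =
            (range p).filter (fun w => ¬ w ≤ K₀) := by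
          ext w; simp only [mem_filter, mem_range]; omega
        rw [f2] at part2
        refine le_of_eq_of_le ?_ part2
        congr 1
        refine Finset.sum_congr rfl fun j _ => Finset.sum_congr rfl fun w hw => ?_
        simp only [mem_filter, mem_range] at hw
        have : w + p * j ≤ K ↔ j ≤ K₁ - 1 := by
          constructor
          · intro h1
            by_contra h2
            have : p * K₁ ≤ p * j := Nat.mul_le_mul_left p (by omega)
            omega
          · intro h1
            have := Nat.mul_le_mul_left p h1
            omega
        simp only [this]

/-- A harmonic-type companion `H i` of a Dwork system: it scales under `n ↦ p n`, and its growth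
inside a block of length `p` is compensated by the zeros of `A i`. -/
structure IsDworkLog (A : ℕ → ℕ → ℚ_[p]) (H : ℕ → ℕ → ℚ_[p]) : Prop where
  zero : ∀ i, H i 0 = 0
  local_bound : ∀ i v n, v < p → ‖A i (v + p * n) * (H i (v + p * n) - H i (p * n))‖ ≤ 1
  scale : ∀ i n, ‖(p : ℚ_[p]) * H i (p * n) - H (i + 1) n‖ ≤ (p : ℝ)⁻¹

theorem IsDworkLog.scale_pow {A H : ℕ → ℕ → ℚ_[p]} (hH : IsDworkLog A H) (s i n : ℕ) :
    ‖(p : ℚ_[p]) ^ s * H i (p ^ s * n) - H (i + s) n‖ ≤ (p : ℝ)⁻¹ := by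
  induction s generalizing i with
  | zero => simp [inv_prime_pos.le]
  | succ s ih =>
    have e : (p : ℚ_[p]) ^ (s + 1) * H i (p ^ (s + 1) * n) - H (i + (s + 1)) n =
        (p : ℚ_[p]) ^ s * (p * H i (p * (p ^ s * n)) - H (i + 1) (p ^ s * n)) +
        ((p : ℚ_[p]) ^ s * H (i + 1) (p ^ s * n) - H (i + 1 + s) n) := by
      rw [show p ^ (s + 1) * n = p * (p ^ s * n) by ring, show i + (s + 1) = i + 1 + s by ring]
      ring
    rw [e]
    refine padic_norm_add_le ?_ (ih (i + 1))
    rw [norm_mul, norm_pow, Padic.norm_p]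
    calc _ ≤ 1 * (p : ℝ)⁻¹ := by
          gcongr
          · exact pow_le_one₀ inv_prime_pos.le inv_prime_le_one
          · exact hH.scale i _
      _ = _ := one_mul _

theorem norm_p_mul (x : ℚ_[p]) : ‖(p : ℚ_[p]) * x‖ = (p : ℝ)⁻¹ * ‖x‖ := by
  rw [norm_mul, Padic.norm_p]

/-- For the generating series `F = ∑ Aₙ Xⁿ`, `G = ∑ Aₙ Hₙ Xⁿ` of index `i`, and `F'`, `G'` of index
`i + 1`, the coefficient of `X ^ (v + p K)` in `p G(X) F'(Xᵖ) - F(X) G'(Xᵖ)` is divisible by `p`. -/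
theorem IsDworkSystem.log_congruence {A H : ℕ → ℕ → ℚ_[p]} {f : ℕ → ℕ → ℕ → ℚ_[p]}
    (hA : IsDworkSystem A f) (hH : IsDworkLog A H) (i v K : ℕ) (hv : v < p) :
    ‖∑ j ∈ range (K + 1), A i (v + p * j) * A (i + 1) (K - j) *
      (p * H i (v + p * j) - H (i + 1) (K - j))‖ ≤ (p : ℝ)⁻¹ := by
  have hP := (inv_prime_pos (p := p)).le
  have hp0 := hp.out.pos
  have step1 : ∀ j, ‖A i (v + p * j) * (p * H i (v + p * j) - H (i + 1) j)‖ ≤ (p : ℝ)⁻¹ := by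
    intro j
    have e : A i (v + p * j) * (p * H i (v + p * j) - H (i + 1) j) =
        p * (A i (v + p * j) * (H i (v + p * j) - H i (p * j))) +
        A i (v + p * j) * (p * H i (p * j) - H (i + 1) j) := by ring
    rw [e]
    refine padic_norm_add_le ?_ ?_
    · rw [norm_p_mul]
      exact mul_le_of_le_one_right hP (hH.local_bound i v j hv)
    · rw [norm_mul]
      calc _ ≤ 1 * (p : ℝ)⁻¹ := by
            gcongr
            · exact hA.norm_le _ _
            · exact hH.scale i j
        _ = _ := one_mul _
  set A' := A (i + 1) with hA'
  set H' := H (i + 1) with hH'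
  set φ := f i v with hφ
  have hφ_lip : PadicLip K 1 φ := fun t x y _ _ hxy => hA.factor_lip i v t x y hv hxy
  let B : ℕ → ℚ_[p] := fun j => A' j * A' (K - j) * (φ j - φ (K - j))
  have e1 : ∑ j ∈ range (K + 1), A i (v + p * j) * A' (K - j) *
        (p * H i (v + p * j) - H' (K - j)) =
      ∑ j ∈ range (K + 1), A' (K - j) *
        (A i (v + p * j) * (p * H i (v + p * j) - H' j)) +
      ∑ j ∈ range (K + 1), B j * H' j := by
    have e2 : ∑ j ∈ range (K + 1), B j * H' j =
        ∑ j ∈ range (K + 1), φ j * A' j * A' (K - j) * (H' j - H' (K - j)) := by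
      have : ∑ j ∈ range (K + 1), φ j * A' j * A' (K - j) * H' (K - j) =
          ∑ j ∈ range (K + 1), φ (K - j) * A' j * A' (K - j) * H' j := by
        rw [← Finset.sum_range_reflect]
        refine Finset.sum_congr rfl fun j hj => ?_
        have hj' : j ≤ K := Nat.lt_succ_iff.1 (mem_range.1 hj)
        rw [show K + 1 - 1 - j = K - j by omega, Nat.sub_sub_self hj']
        ring
      simp only [mul_sub, Finset.sum_sub_distrib]
      rw [this, ← Finset.sum_sub_distrib]
      exact Finset.sum_congr rfl fun j _ => by simp only [B]; ring
    rw [e2, ← Finset.sum_add_distrib]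
    refine Finset.sum_congr rfl fun j _ => ?_
    rw [hA.step i v j hv]
    ring
  rw [e1]
  refine padic_norm_add_le (padic_norm_sum_le hP fun j _ => ?_) ?_
  · rw [norm_mul]
    calc _ ≤ 1 * (p : ℝ)⁻¹ := by
          gcongr
          · exact hA.norm_le _ _
          · exact step1 j
      _ = _ := one_mul _
  -- telescoping of `H'` along the block decompositions of lengths `1, p, p², …`
  obtain ⟨S, hS⟩ : ∃ S, K < p ^ S := ⟨K, Nat.lt_pow_self hp.out.one_lt⟩
  let d : ℕ → ℕ → ℚ_[p] := fun s m => H' (p ^ s * m) - H' (p ^ (s + 1) * (m / p))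
  have tele : ∀ j ≤ K, H' j = ∑ s ∈ range S, d s (j / p ^ s) := by
    intro j hj
    have : ∀ s, d s (j / p ^ s) =
        H' (p ^ s * (j / p ^ s)) - H' (p ^ (s + 1) * (j / p ^ (s + 1))) := fun s => by
      simp only [d]
      rw [Nat.div_div_eq_div_mul, pow_succ]
    simp only [this]
    rw [Finset.sum_range_sub' (fun s => H' (p ^ s * (j / p ^ s)))]
    rw [Nat.div_eq_of_lt (lt_of_le_of_lt hj hS)]
    simp [hH', hH.zero]
  have e3 : ∑ j ∈ range (K + 1), B j * H' j =
      ∑ s ∈ range S, ∑ m ∈ range (K + 1), d s m *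
        ∑ j ∈ Ico (p ^ s * m) (p ^ s * (m + 1)), (if j ≤ K then B j else 0) := by
    have : ∑ j ∈ range (K + 1), B j * H' j =
        ∑ j ∈ range (K + 1), ∑ s ∈ range S, B j * d s (j / p ^ s) :=
      Finset.sum_congr rfl fun j hj => by
        rw [tele j (Nat.lt_succ_iff.1 (mem_range.1 hj)), Finset.mul_sum]
    rw [this, Finset.sum_comm]
    refine Finset.sum_congr rfl fun s _ => ?_
    have hps : 0 < p ^ s := pow_pos hp0 s
    rw [sum_range_blocks (p ^ s) K hps]
    refine Finset.sum_congr rfl fun m _ => ?_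
    rw [Finset.mul_sum]
    refine Finset.sum_congr rfl fun j hj => ?_
    rw [mem_Ico] at hj
    have : j / p ^ s = m := by
      rw [Nat.div_eq_iff hps]
      have h1 : p ^ s * (m + 1) = m * p ^ s + p ^ s := by ring
      have h2 : p ^ s * m = m * p ^ s := by ring
      omega
    rw [this]
    split_ifs <;> ring
  rw [e3]
  refine padic_norm_sum_le hP fun s _ => padic_norm_sum_le hP fun m _ => ?_
  have hb := hA.block_sum s 1 (i + 1) m K φ hφ_lip
  have hd : ‖A (i + 1 + s) m * ((p : ℚ_[p]) ^ s * d s m)‖ ≤ 1 := by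
    have h1 := hH.scale_pow s (i + 1) m
    have h2 := hH.scale_pow s (i + 1) (p * (m / p))
    have h3 := hH.local_bound (i + 1 + s) (m % p) (m / p) (Nat.mod_lt _ hp0)
    rw [Nat.mod_add_div] at h3
    have e : A (i + 1 + s) m * ((p : ℚ_[p]) ^ s * d s m) =
        A (i + 1 + s) m * (H (i + 1 + s) m - H (i + 1 + s) (p * (m / p))) +
        A (i + 1 + s) m * (((p : ℚ_[p]) ^ s * H' (p ^ s * m) - H (i + 1 + s) m) -
          ((p : ℚ_[p]) ^ s * H' (p ^ s * (p * (m / p))) - H (i + 1 + s) (p * (m / p)))) := by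
      simp only [d]
      rw [show p ^ (s + 1) * (m / p) = p ^ s * (p * (m / p)) by ring]
      ring
    rw [e]
    refine padic_norm_add_le h3 ?_
    rw [norm_mul]
    exact mul_le_one₀ (hA.norm_le _ _) (norm_nonneg _)
      ((padic_norm_sub_le h1 h2).trans inv_prime_le_one)
  rw [norm_mul]
  rw [norm_mul, norm_mul, norm_pow, Padic.norm_p] at hd
  calc ‖d s m‖ * _ ≤ ‖d s m‖ * ((p : ℝ)⁻¹ ^ (s + 1) * ‖A (i + 1 + s) m‖) := by gcongr
    _ = (p : ℝ)⁻¹ * (‖A (i + 1 + s) m‖ * ((p : ℝ)⁻¹ ^ s * ‖d s m‖)) := by ring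
    _ ≤ (p : ℝ)⁻¹ * 1 := by gcongr
    _ = _ := mul_one _

end BlockSums

/-! ### Quotients of Pochhammer symbols -/

section Pochhammer

theorem prod_range_add_mul {M : Type*} [CommMonoid M] (g : ℕ → M) (p v n : ℕ) :
    ∏ i ∈ range (v + p * n), g i = (∏ i ∈ range (p * n), g i) * ∏ w ∈ range v, g (w + p * n) := by
  rw [add_comm v, Finset.prod_range_add]
  simp only [add_comm]

theorem sum_range_add_mul {M : Type*} [AddCommMonoid M] (g : ℕ → M) (p v n : ℕ) :
    ∑ i ∈ range (v + p * n), g i = (∑ i ∈ range (p * n), g i) + ∑ w ∈ range v, g (w + p * n) := by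
  rw [add_comm v, Finset.sum_range_add]
  simp only [add_comm]

variable {p : ℕ} [hp : Fact p.Prime]

/-- The quotient `(x)ₙ / n!` of a Pochhammer symbol by a factorial. -/
def pochRatio {K : Type*} [Field K] (x : K) (n : ℕ) : K := ∏ i ∈ range n, (x + i) / (1 + i)

/-- The logarithmic derivative of `(x)ₙ` with respect to `x`, minus its value at `x = 1`. -/
def pochLog {K : Type*} [Field K] (x : K) (n : ℕ) : K :=
  ∑ i ∈ range n, ((x + i)⁻¹ - (1 + (i : K))⁻¹)

/-- `y` with the multiples of `p` replaced by `1`. -/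
def primeToP (y : ℤ_[p]) : ℤ_[p] := open Classical in if (p : ℤ_[p]) ∣ y then 1 else y

theorem norm_primeToP (y : ℤ_[p]) : ‖primeToP y‖ = 1 := by
  unfold primeToP
  split_ifs with h
  · simp
  · rw [← PadicInt.norm_lt_one_iff_dvd] at h
    exact le_antisymm (PadicInt.norm_le_one _) (not_lt.1 h)

/-- The product of the terms prime to `p` among `x, x + 1, …, x + N - 1`. -/
def primePoch (x : ℤ_[p]) (N : ℕ) : ℤ_[p] := ∏ i ∈ range N, primeToP (x + i)

theorem norm_primePoch (x : ℤ_[p]) (N : ℕ) : ‖primePoch x N‖ = 1 := by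
  unfold primePoch
  rw [norm_prod]
  exact Finset.prod_eq_one fun i _ => norm_primeToP _

theorem prod_range_zmod {M : Type*} [CommMonoid M] (N : ℕ) [NeZero N] (g : ZMod N → M)
    (c : ZMod N) : ∏ i ∈ range N, g (c + i) = ∏ y : ZMod N, g y := by
  rw [← Equiv.prod_comp (Equiv.addLeft c)]
  refine Finset.prod_bij' (fun i _ => (i : ZMod N)) (fun y _ => y.val) ?_ ?_ ?_ ?_ ?_
  · intros; exact mem_univ _
  · intro y _; exact mem_range.2 (ZMod.val_lt y)
  · intro i hi; exact ZMod.val_cast_of_lt (mem_range.1 hi)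
  · intro y _; exact ZMod.natCast_zmod_val y
  · intros; rfl

theorem p_dvd_iff_toZModPow (s : ℕ) (y : ℤ_[p]) :
    (p : ℤ_[p]) ∣ y ↔ (p : ZMod (p ^ (s + 1))) ∣ PadicInt.toZModPow (s + 1) y := by
  constructor
  · rintro ⟨z, rfl⟩
    exact ⟨PadicInt.toZModPow (s + 1) z, by simp⟩
  · rintro ⟨z, hz⟩
    obtain ⟨z', rfl⟩ := ZMod.ringHom_surjective (PadicInt.toZModPow (p := p) (s + 1)) z
    have : y - p * z' ∈ RingHom.ker (PadicInt.toZModPow (p := p) (s + 1)) := by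
      rw [RingHom.mem_ker, map_sub, hz]; simp
    rw [PadicInt.ker_toZModPow, Ideal.mem_span_singleton] at this
    have h2 : (p : ℤ_[p]) ∣ y - p * z' := (dvd_pow_self _ (Nat.succ_ne_zero s)).trans this
    simpa using dvd_add h2 (Dvd.intro z' rfl : (p : ℤ_[p]) ∣ p * z')

/-- Modulo `pˢ⁺¹`, the product over a full period of length `pˢ⁺¹` does not depend on `x`. -/
theorem toZModPow_primePoch_add (s : ℕ) (x : ℤ_[p]) (N t : ℕ) :
    PadicInt.toZModPow (s + 1) (primePoch x (N + p ^ (s + 1) * t)) =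
      PadicInt.toZModPow (s + 1) (primePoch x N) *
        (∏ y : ZMod (p ^ (s + 1)), open Classical in
          if (p : ZMod (p ^ (s + 1))) ∣ y then 1 else y) ^ t := by
  classical
  have : NeZero (p ^ (s + 1)) := ⟨pow_ne_zero _ hp.out.ne_zero⟩
  induction t with
  | zero => simp
  | succ t ih =>
    have e : primePoch x (N + p ^ (s + 1) * (t + 1)) = primePoch x (N + p ^ (s + 1) * t) *
        ∏ i ∈ range (p ^ (s + 1)),
          primeToP (x + ((N + p ^ (s + 1) * t : ℕ) : ℤ_[p]) + (i : ℤ_[p])) := by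
      unfold primePoch
      rw [show N + p ^ (s + 1) * (t + 1) = N + p ^ (s + 1) * t + p ^ (s + 1) by ring,
        Finset.prod_range_add]
      congr 1
      exact Finset.prod_congr rfl fun i _ => by push_cast; ring_nf
    rw [e, map_mul, ih, pow_succ _ t, mul_assoc]
    congr 2
    rw [map_prod, ← prod_range_zmod (p ^ (s + 1)) _
      (PadicInt.toZModPow (s + 1) (x + ((N + p ^ (s + 1) * t : ℕ) : ℤ_[p])))]
    refine Finset.prod_congr rfl fun i _ => ?_
    unfold primeToP
    have h := p_dvd_iff_toZModPow s (x + ((N + p ^ (s + 1) * t : ℕ) : ℤ_[p]) + (i : ℤ_[p]))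
    have e2 : PadicInt.toZModPow (s + 1) (x + ((N + p ^ (s + 1) * t : ℕ) : ℤ_[p]) + (i : ℤ_[p])) =
        PadicInt.toZModPow (s + 1) (x + ((N + p ^ (s + 1) * t : ℕ) : ℤ_[p])) +
          (i : ZMod (p ^ (s + 1))) := by
      rw [map_add _ _ (i : ℤ_[p]), map_natCast]
    rw [e2] at h
    by_cases hd : (p : ℤ_[p]) ∣ (x + ((N + p ^ (s + 1) * t : ℕ) : ℤ_[p]) + (i : ℤ_[p]))
    · rw [if_pos hd, if_pos (h.1 hd), map_one]
    · rw [if_neg hd, if_neg (fun h' => hd (h.2 h')), e2]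

theorem primePoch_ratio_lip (s : ℕ) (x : ℤ_[p]) (v m n : ℕ) (hmn : m ≡ n [MOD p ^ s]) :
    ‖(((primePoch x (v + p * m) : ℤ_[p]) : ℚ_[p]) / ((primePoch 1 (v + p * m) : ℤ_[p]) : ℚ_[p])) -
      ((primePoch x (v + p * n) : ℤ_[p]) : ℚ_[p]) / ((primePoch 1 (v + p * n) : ℤ_[p]) : ℚ_[p])‖ ≤
         (p : ℝ)⁻¹ ^ (s + 1) := by
  wlog h : n ≤ m generalizing m n
  · rw [norm_sub_rev]; exact this n m hmn.symm (by omega)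
  obtain ⟨t, ht⟩ : ∃ t, m = n + p ^ s * t := by
    obtain ⟨t, ht⟩ := (Nat.modEq_iff_dvd' h).1 hmn.symm
    exact ⟨t, by omega⟩
  have e : v + p * m = v + p * n + p ^ (s + 1) * t := by rw [ht]; ring
  have n1 : ∀ N, ‖(primePoch (1 : ℤ_[p]) N : ℚ_[p])‖ = 1 := fun N => norm_primePoch 1 N
  have z1 : ∀ N, (primePoch (1 : ℤ_[p]) N : ℚ_[p]) ≠ 0 := fun N h0 => by
    have := n1 N; rw [h0, norm_zero] at this; exact zero_ne_one this
  rw [div_sub_div _ _ (z1 _) (z1 _), norm_div, norm_mul, n1, n1, mul_one, div_one]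
  have key : primePoch x (v + p * m) * primePoch 1 (v + p * n) -
      primePoch 1 (v + p * m) * primePoch x (v + p * n) ∈
      RingHom.ker (PadicInt.toZModPow (p := p) (s + 1)) := by
    rw [RingHom.mem_ker, map_sub, map_mul, map_mul, e, toZModPow_primePoch_add,
      toZModPow_primePoch_add]
    ring
  rw [PadicInt.ker_toZModPow, ← PadicInt.norm_le_pow_iff_mem_span_pow] at key
  rw [PadicInt.norm_def] at key
  push_cast at key
  refine key.trans (le_of_eq ?_)
  rw [zpow_neg, inv_pow]
  norm_cast

/-- The data of Dwork's map `x ↦ x'`, where `p x' = x + k` with `0 ≤ k < p`. -/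
structure IsDworkPrime (x x' : ℤ_[p]) (k : ℕ) : Prop where
  lt : k < p
  eq : (p : ℤ_[p]) * x' = x + k

theorem IsDworkPrime.one : IsDworkPrime (1 : ℤ_[p]) 1 (p - 1) where
  lt := Nat.sub_lt hp.out.pos one_pos
  eq := by rw [Nat.cast_sub hp.out.one_lt.le]; simp

theorem IsDworkPrime.primeToP_add {x x' : ℤ_[p]} {k : ℕ} (h : IsDworkPrime x x' k) {w : ℕ}
    (hw : w < p) (n : ℕ) :
    x + ((w + p * n : ℕ) : ℤ_[p]) = primeToP (x + ((w + p * n : ℕ) : ℤ_[p])) * if w = k then p * (x' + n) else 1 := by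
  unfold primeToP
  split_ifs with h1 h2 h2
  · rw [h2]; push_cast; linear_combination -h.eq
  · exfalso
    have e : x + ((w + p * n : ℕ) : ℤ_[p]) = p * (x' + n) + ((w : ℤ) - k : ℤ) := by
      push_cast; linear_combination -h.eq
    rw [e] at h1
    have h3 : (p : ℤ_[p]) ∣ (((w : ℤ) - k : ℤ) : ℤ_[p]) := (dvd_add_right (Dvd.intro _ rfl)).1 h1
    have h4 := (PadicInt.pow_p_dvd_int_iff 1 ((w : ℤ) - k)).1 (by simpa using h3)
    rw [pow_one] at h4
    have := Int.eq_zero_of_abs_lt_dvd h4 (by have := h.lt; rw [abs_lt]; omega)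
    omega
  · exfalso
    apply h1
    rw [h2]
    exact ⟨x' + n, by push_cast; linear_combination -h.eq⟩
  · rw [mul_one]

theorem IsDworkPrime.prod_block {x x' : ℤ_[p]} {k : ℕ} (h : IsDworkPrime x x' k) {v : ℕ}
    (hv : v ≤ p) (n : ℕ) :
    ∏ w ∈ range v, (x + ((w + p * n : ℕ) : ℤ_[p])) =
      (∏ w ∈ range v, primeToP (x + ((w + p * n : ℕ) : ℤ_[p]))) * if k < v then p * (x' + n) else 1 := by
  rw [Finset.prod_congr rfl fun w hw =>
    h.primeToP_add (lt_of_lt_of_le (mem_range.1 hw) hv) n, Finset.prod_mul_distrib,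
    Finset.prod_ite_eq']
  simp

/-- `(x)_{v + p n}` in terms of `(x')ₙ` and a `p`-adic unit. -/
theorem IsDworkPrime.prod_range {x x' : ℤ_[p]} {k : ℕ} (h : IsDworkPrime x x' k) {v : ℕ}
    (hv : v ≤ p) (n : ℕ) :
    ∏ i ∈ range (v + p * n), (x + i) = primePoch x (v + p * n) *
      (p ^ n * ∏ j ∈ range n, (x' + j)) * if k < v then p * (x' + n) else 1 := by
  have full : ∏ i ∈ range (p * n), (x + i) =
      primePoch x (p * n) * (p ^ n * ∏ j ∈ range n, (x' + j)) := by
    induction n with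
    | zero => simp [primePoch]
    | succ n ih =>
      have hb := h.prod_block le_rfl n
      rw [if_pos h.lt] at hb
      rw [show p * (n + 1) = p + p * n by ring, prod_range_add_mul, ih, hb, primePoch, primePoch,
        prod_range_add_mul, Finset.prod_range_succ]
      ring
  rw [prod_range_add_mul, full, h.prod_block hv, primePoch, primePoch, prod_range_add_mul]
  ring

theorem one_add_natCast_ne_zero {K : Type*} [Field K] [CharZero K] (i : ℕ) : (1 + i : K) ≠ 0 := by
  rw [add_comm]; exact Nat.cast_add_one_ne_zero i

theorem pochRatio_eq_div {K : Type*} [Field K] (x : K) (n : ℕ) :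
    pochRatio x n = (∏ i ∈ range n, (x + i)) / ∏ i ∈ range n, (1 + (i : K)) := by
  unfold pochRatio
  rw [Finset.prod_div_distrib]

/-- The quotient of `pochRatio x (v + p n)` by `pochRatio x' n`. -/
def pochFactor (x x' : ℤ_[p]) (k v n : ℕ) : ℚ_[p] :=
  ((primePoch x (v + p * n) : ℤ_[p]) : ℚ_[p]) / ((primePoch 1 (v + p * n) : ℤ_[p]) : ℚ_[p]) *
    if k < v then p * ((x' : ℚ_[p]) + n) else 1

theorem IsDworkPrime.pochRatio_eq {x x' : ℤ_[p]} {k : ℕ} (h : IsDworkPrime x x' k) {v : ℕ}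
    (hv : v < p) (n : ℕ) :
    pochRatio (x : ℚ_[p]) (v + p * n) = pochFactor x x' k v n * pochRatio (x' : ℚ_[p]) n := by
  have e1 := congrArg (fun y : ℤ_[p] => (y : ℚ_[p])) (h.prod_range hv.le n)
  have e2 := congrArg (fun y : ℤ_[p] => (y : ℚ_[p]))
    ((IsDworkPrime.one (p := p)).prod_range hv.le n)
  rw [if_neg (by omega : ¬ p - 1 < v)] at e2
  have c : ∀ (y : ℤ_[p]) (N : ℕ), ((∏ i ∈ range N, (y + i) : ℤ_[p]) : ℚ_[p]) =
      ∏ i ∈ range N, ((y : ℚ_[p]) + i) := fun y N => by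
    have := map_prod (PadicInt.Coe.ringHom (p := p)) (fun i : ℕ => y + i) (range N)
    refine this.trans (Finset.prod_congr rfl fun i _ => ?_)
    change ((y + i : ℤ_[p]) : ℚ_[p]) = _
    push_cast
    rfl
  rw [pochRatio_eq_div, pochRatio_eq_div, pochFactor]
  simp only [PadicInt.coe_mul, PadicInt.coe_pow, PadicInt.coe_natCast, c, mul_one,
    PadicInt.coe_one] at e1 e2
  rw [e1, e2]
  have z1 : ∀ N, (primePoch (1 : ℤ_[p]) N : ℚ_[p]) ≠ 0 := fun N h0 => by
    have : ‖(primePoch (1 : ℤ_[p]) N : ℚ_[p])‖ = 1 := norm_primePoch 1 N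
    rw [h0, norm_zero] at this; exact zero_ne_one this
  have z2 : (∏ i ∈ range n, (1 + (i : ℚ_[p]))) ≠ 0 :=
    Finset.prod_ne_zero_iff.2 fun i _ => one_add_natCast_ne_zero i
  have z3 : (p : ℚ_[p]) ≠ 0 := by exact_mod_cast hp.out.ne_zero
  have z4 := z1 (v + p * n)
  split_ifs
  · push_cast; field_simp
  · push_cast; field_simp

theorem norm_pochFactor_unit (x : ℤ_[p]) (N : ℕ) :
    ‖(((primePoch x N : ℤ_[p]) : ℚ_[p]) / ((primePoch 1 N : ℤ_[p]) : ℚ_[p]))‖ = 1 := by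
  rw [norm_div, ← PadicInt.norm_def, ← PadicInt.norm_def, norm_primePoch, norm_primePoch, div_one]

theorem norm_pochFactor_le (x x' : ℤ_[p]) (k v n : ℕ) : ‖pochFactor x x' k v n‖ ≤ 1 := by
  unfold pochFactor
  rw [norm_mul, norm_pochFactor_unit, one_mul]
  split_ifs
  · have : (p : ℚ_[p]) * ((x' : ℚ_[p]) + n) = ((p * (x' + n) : ℤ_[p]) : ℚ_[p]) := by push_cast; rfl
    rw [this]; exact PadicInt.norm_le_one _
  · simp

theorem pochFactor_lip (x x' : ℤ_[p]) (k v s m n : ℕ) (hmn : m ≡ n [MOD p ^ s]) :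
    ‖pochFactor x x' k v m - pochFactor x x' k v n‖ ≤ (p : ℝ)⁻¹ ^ (s + 1) := by
  have h1 := primePoch_ratio_lip s x v m n hmn
  unfold pochFactor
  split_ifs
  swap
  · simpa using h1
  have h2 : ‖(m : ℚ_[p]) - n‖ ≤ (p : ℝ)⁻¹ ^ s := by
    have : ((p ^ s : ℕ) : ℤ) ∣ ((m : ℤ) - n) := (Nat.modEq_iff_dvd.1 hmn.symm)
    have h3 := (PadicInt.norm_int_le_pow_iff_dvd (p := p) (k := (m : ℤ) - n) (n := s)).2
      (by exact_mod_cast this)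
    rw [PadicInt.norm_intCast_eq_padic_norm] at h3
    rw [zpow_neg] at h3
    push_cast at h3
    rw [inv_pow]
    exact_mod_cast h3
  have h3 := norm_pochFactor_unit x (v + p * m)
  have h4 : ‖(p : ℚ_[p]) * ((x' : ℚ_[p]) + n)‖ ≤ 1 := by
    have : (p : ℚ_[p]) * ((x' : ℚ_[p]) + n) = ((p * (x' + n) : ℤ_[p]) : ℚ_[p]) := by push_cast; rfl
    rw [this]; exact PadicInt.norm_le_one _
  generalize (((primePoch x (v + p * m) : ℤ_[p]) : ℚ_[p]) / ((primePoch 1 (v + p * m) : ℤ_[p]) : ℚ_[p])) = A at *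
  generalize (((primePoch x (v + p * n) : ℤ_[p]) : ℚ_[p]) / ((primePoch 1 (v + p * n) : ℤ_[p]) : ℚ_[p])) = B at *
  have e : A * (p * ((x' : ℚ_[p]) + m)) - B * (p * ((x' : ℚ_[p]) + n)) =
      A * (p * ((m : ℚ_[p]) - n)) + (A - B) * (p * ((x' : ℚ_[p]) + n)) := by ring
  rw [e]
  refine padic_norm_add_le ?_ ?_
  · rw [norm_mul, h3, norm_p_mul, one_mul, pow_succ']
    have := (inv_prime_pos (p := p)).le
    gcongr
  · rw [norm_mul]
    calc _ ≤ (p : ℝ)⁻¹ ^ (s + 1) * 1 := by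
          have := (inv_prime_pos (p := p)).le
          gcongr
      _ = _ := mul_one _

/-- A sequence of `p`-adic integers following Dwork's map, none of them `0, -1, -2, …`. -/
structure IsDworkOrbit (x : ℕ → ℤ_[p]) (k : ℕ → ℕ) : Prop where
  prime : ∀ i, IsDworkPrime (x i) (x (i + 1)) (k i)
  ne : ∀ i n : ℕ, (x i : ℚ_[p]) + n ≠ 0

theorem IsDworkOrbit.isDworkSystem {x : ℕ → ℤ_[p]} {k : ℕ → ℕ} (h : IsDworkOrbit x k) :
    IsDworkSystem (fun i n => pochRatio (x i : ℚ_[p]) n)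
      (fun i v n => pochFactor (x i) (x (i + 1)) (k i) v n) where
  step i v n hv := (h.prime i).pochRatio_eq hv n
  norm_le i n := by
    induction n using Nat.strong_induction_on generalizing i with
    | _ n ih =>
      rcases Nat.eq_zero_or_pos n with rfl | hn
      · simp [pochRatio]
      · rw [← Nat.mod_add_div n p, (h.prime i).pochRatio_eq (Nat.mod_lt _ hp.out.pos), norm_mul]
        exact mul_le_one₀ (norm_pochFactor_le _ _ _ _ _) (norm_nonneg _)
          (ih _ (Nat.div_lt_self hn hp.out.one_lt) (i + 1))
  factor_norm_le i v n _ := norm_pochFactor_le _ _ _ _ _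
  factor_lip i v s m n _ hmn := pochFactor_lip _ _ _ _ _ _ _ hmn

theorem IsDworkPrime.norm_inv_add_le {x x' : ℤ_[p]} {k : ℕ} (h : IsDworkPrime x x' k) {w : ℕ}
    (hw : w < p) (hk : w ≠ k) (n : ℕ) : ‖((x : ℚ_[p]) + ((w + p * n : ℕ) : ℚ_[p]))⁻¹‖ ≤ 1 := by
  have e := h.primeToP_add hw n
  rw [if_neg hk, mul_one] at e
  have : (x : ℚ_[p]) + ((w + p * n : ℕ) : ℚ_[p]) = ((x + ((w + p * n : ℕ) : ℤ_[p]) : ℤ_[p]) : ℚ_[p]) := by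
    push_cast; rfl
  rw [this, e, norm_inv, ← PadicInt.norm_def, norm_primeToP, inv_one]

/-- The reciprocals in a partial block are integral, apart from at most one. -/
theorem IsDworkPrime.sum_inv_block {x x' : ℤ_[p]} {k : ℕ} (h : IsDworkPrime x x' k) {v : ℕ}
    (hv : v ≤ p) (n : ℕ) :
    ‖∑ w ∈ range v, ((x : ℚ_[p]) + ((w + p * n : ℕ) : ℚ_[p]))⁻¹ -
      (if k < v then (p * ((x' : ℚ_[p]) + n))⁻¹ else 0)‖ ≤ 1 := by
  have : (if k < v then (p * ((x' : ℚ_[p]) + n))⁻¹ else 0) =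
      ∑ w ∈ range v, if w = k then (p * ((x' : ℚ_[p]) + n))⁻¹ else 0 := by
    rw [Finset.sum_ite_eq']; simp
  rw [this, ← Finset.sum_sub_distrib]
  refine padic_norm_sum_le zero_le_one fun w hw => ?_
  split_ifs with hk
  · have e := congrArg (fun y : ℤ_[p] => (y : ℚ_[p])) h.eq
    push_cast at e
    have e' : (x : ℚ_[p]) + ((w + p * n : ℕ) : ℚ_[p]) = p * ((x' : ℚ_[p]) + n) := by
      rw [hk]; push_cast; linear_combination -e
    rw [e']; simp
  · rw [sub_zero]
    exact h.norm_inv_add_le (lt_of_lt_of_le (mem_range.1 hw) hv) hk n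

theorem IsDworkPrime.sum_inv_scale {x x' : ℤ_[p]} {k : ℕ} (h : IsDworkPrime x x' k) (n : ℕ) :
    ‖(p : ℚ_[p]) * ∑ i ∈ range (p * n), ((x : ℚ_[p]) + i)⁻¹ -
      ∑ j ∈ range n, ((x' : ℚ_[p]) + j)⁻¹‖ ≤ (p : ℝ)⁻¹ := by
  have hp0 : (p : ℚ_[p]) ≠ 0 := by exact_mod_cast hp.out.ne_zero
  induction n with
  | zero => simp [inv_prime_pos.le]
  | succ n ih =>
    have hb := h.sum_inv_block le_rfl n
    rw [if_pos h.lt] at hb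
    rw [show p * (n + 1) = p + p * n by ring, sum_range_add_mul, Finset.sum_range_succ]
    have e : (p : ℚ_[p]) * (∑ i ∈ range (p * n), ((x : ℚ_[p]) + i)⁻¹ +
        ∑ w ∈ range p, ((x : ℚ_[p]) + ((w + p * n : ℕ) : ℚ_[p]))⁻¹) -
        (∑ j ∈ range n, ((x' : ℚ_[p]) + j)⁻¹ + ((x' : ℚ_[p]) + n)⁻¹) =
        (p * ∑ i ∈ range (p * n), ((x : ℚ_[p]) + i)⁻¹ - ∑ j ∈ range n, ((x' : ℚ_[p]) + j)⁻¹) +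
        p * (∑ w ∈ range p, ((x : ℚ_[p]) + ((w + p * n : ℕ) : ℚ_[p]))⁻¹ -
          (p * ((x' : ℚ_[p]) + n))⁻¹) := by
      rw [mul_inv, mul_sub, mul_inv_cancel_left₀ hp0]; ring
    rw [e]
    refine padic_norm_add_le ih ?_
    rw [norm_p_mul]
    exact mul_le_of_le_one_right inv_prime_pos.le hb

theorem IsDworkOrbit.isDworkLog {x : ℕ → ℤ_[p]} {k : ℕ → ℕ} (h : IsDworkOrbit x k) :
    IsDworkLog (fun i n => pochRatio (x i : ℚ_[p]) n) (fun i n => pochLog (x i : ℚ_[p]) n) where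
  zero i := by simp [pochLog]
  local_bound i v n hv := by
    have b1 := (h.prime i).sum_inv_block hv.le n
    have b2 := (IsDworkPrime.one (p := p)).sum_inv_block hv.le n
    rw [if_neg (by omega : ¬ p - 1 < v), sub_zero] at b2
    have e : pochLog (x i : ℚ_[p]) (v + p * n) - pochLog (x i : ℚ_[p]) (p * n) =
        (∑ w ∈ range v, ((x i : ℚ_[p]) + (w + p * n : ℕ))⁻¹ -
          (if k i < v then (p * ((x (i + 1) : ℚ_[p]) + n))⁻¹ else 0)) -
        ∑ w ∈ range v, (((1 : ℤ_[p]) : ℚ_[p]) + ((w + p * n : ℕ) : ℚ_[p]))⁻¹ +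
        (if k i < v then (p * ((x (i + 1) : ℚ_[p]) + n))⁻¹ else 0) := by
      unfold pochLog
      rw [sum_range_add_mul, add_sub_cancel_left, Finset.sum_sub_distrib, PadicInt.coe_one]
      push_cast
      ring
    have hA := h.isDworkSystem.norm_le i (v + p * n)
    have hA' := h.isDworkSystem.norm_le (i + 1) n
    rw [e, mul_add]
    refine padic_norm_add_le ?_ ?_
    · rw [norm_mul]
      exact mul_le_one₀ hA (norm_nonneg _) (padic_norm_sub_le b1 b2)
    · rw [(h.prime i).pochRatio_eq hv, pochFactor]
      split_ifs
      · have hp0 : (p : ℚ_[p]) ≠ 0 := by exact_mod_cast hp.out.ne_zero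
        have hne := h.ne (i + 1) n
        rw [mul_right_comm, mul_assoc _ _ (_⁻¹), mul_inv_cancel₀ (mul_ne_zero hp0 hne), mul_one,
          norm_mul, norm_pochFactor_unit, one_mul]
        exact hA'
      · simp
  scale i n := by
    have b1 := (h.prime i).sum_inv_scale n
    have b2 := (IsDworkPrime.one (p := p)).sum_inv_scale n
    have e : (p : ℚ_[p]) * pochLog (x i : ℚ_[p]) (p * n) - pochLog (x (i + 1) : ℚ_[p]) n =
        ((p : ℚ_[p]) * ∑ i' ∈ range (p * n), ((x i : ℚ_[p]) + i')⁻¹ -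
          ∑ j ∈ range n, ((x (i + 1) : ℚ_[p]) + j)⁻¹) -
        ((p : ℚ_[p]) * ∑ i' ∈ range (p * n), (((1 : ℤ_[p]) : ℚ_[p]) + i')⁻¹ -
          ∑ j ∈ range n, (((1 : ℤ_[p]) : ℚ_[p]) + j)⁻¹) := by
      unfold pochLog
      rw [Finset.sum_sub_distrib, Finset.sum_sub_distrib, PadicInt.coe_one]
      ring
    rw [e]
    exact padic_norm_sub_le b1 b2

theorem IsDworkSystem.mul {A B : ℕ → ℕ → ℚ_[p]} {f g : ℕ → ℕ → ℕ → ℚ_[p]}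
    (hA : IsDworkSystem A f) (hB : IsDworkSystem B g) :
    IsDworkSystem (fun i n => A i n * B i n) (fun i v n => f i v n * g i v n) where
  step i v n hv := by rw [hA.step i v n hv, hB.step i v n hv]; ring
  norm_le i n := by
    rw [norm_mul]; exact mul_le_one₀ (hA.norm_le i n) (norm_nonneg _) (hB.norm_le i n)
  factor_norm_le i v n hv := by
    rw [norm_mul]
    exact mul_le_one₀ (hA.factor_norm_le i v n hv) (norm_nonneg _) (hB.factor_norm_le i v n hv)
  factor_lip i v s m n hv hmn :=
    PadicLip.mul (K := max m n) (r := 1)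
      (fun t x y _ _ hxy => hA.factor_lip i v t x y hv hxy)
      (fun t x y _ _ hxy => hB.factor_lip i v t x y hv hxy)
      (fun x _ => hA.factor_norm_le i v x hv) (fun x _ => hB.factor_norm_le i v x hv)
      s m n (le_max_left _ _) (le_max_right _ _) hmn

theorem IsDworkLog.mul {A B H G : ℕ → ℕ → ℚ_[p]} (hH : IsDworkLog A H) (hG : IsDworkLog B G)
    (hA : ∀ i n, ‖A i n‖ ≤ 1) (hB : ∀ i n, ‖B i n‖ ≤ 1) :
    IsDworkLog (fun i n => A i n * B i n) (fun i n => H i n + G i n) where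
  zero i := by rw [hH.zero, hG.zero, add_zero]
  local_bound i v n hv := by
    have e : A i (v + p * n) * B i (v + p * n) *
        (H i (v + p * n) + G i (v + p * n) - (H i (p * n) + G i (p * n))) =
        B i (v + p * n) * (A i (v + p * n) * (H i (v + p * n) - H i (p * n))) +
        A i (v + p * n) * (B i (v + p * n) * (G i (v + p * n) - G i (p * n))) := by ring
    rw [e]
    refine padic_norm_add_le ?_ ?_ <;> rw [norm_mul]
    · exact mul_le_one₀ (hB _ _) (norm_nonneg _) (hH.local_bound i v n hv)
    · exact mul_le_one₀ (hA _ _) (norm_nonneg _) (hG.local_bound i v n hv)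
  scale i n := by
    have e : (p : ℚ_[p]) * (H i (p * n) + G i (p * n)) - (H (i + 1) n + G (i + 1) n) =
        (p * H i (p * n) - H (i + 1) n) + (p * G i (p * n) - G (i + 1) n) := by ring
    rw [e]
    exact padic_norm_add_le (hH.scale i n) (hG.scale i n)

end Pochhammer

/-! ### Formal power series: Euler derivation, exponentials, truncation -/

open PowerSeries in
/-- The derivation `X d/dX` of power series over any field. -/
def theta {K : Type*} [Field K] (f : PowerSeries K) : PowerSeries K := X * derivative K f

section FormalSeries

open PowerSeries

variable {K : Type*} [Field K]

theorem coeff_theta (f : K⟦X⟧) (n : ℕ) : coeff n (theta f) = n * coeff n f := by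
  unfold theta
  cases n with
  | zero => simp
  | succ n => rw [coeff_succ_X_mul, coeff_derivative]; push_cast; ring

theorem theta_add (f g : K⟦X⟧) : theta (f + g) = theta f + theta g := by
  unfold theta; rw [map_add, mul_add]

theorem theta_sub (f g : K⟦X⟧) : theta (f - g) = theta f - theta g := by
  unfold theta; rw [map_sub, mul_sub]

theorem theta_mul (f g : K⟦X⟧) : theta (f * g) = theta f * g + f * theta g := by
  unfold theta; rw [Derivation.leibniz]; simp only [smul_eq_mul]; ring

theorem theta_C (a : K) : theta (C a) = 0 := by
  unfold theta; rw [derivative_C, mul_zero]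

theorem theta_one : theta (1 : K⟦X⟧) = 0 := by simpa using theta_C (1 : K)

theorem theta_X : theta (X : K⟦X⟧) = X := by
  unfold theta; rw [derivative_X, mul_one]

theorem coeff_zero_mul' (f g : K⟦X⟧) : coeff 0 (f * g) = coeff 0 f * coeff 0 g := by
  simp

theorem theta_subst {f h : K⟦X⟧} (hh : constantCoeff h = 0) {L : K⟦X⟧}
    (hL : theta h = h * L) : theta (f.subst h) = (theta f).subst h * L := by
  have hs : HasSubst h := HasSubst.of_constantCoeff_zero' hh
  unfold theta at *
  rw [derivative_subst hs, subst_mul hs, subst_X hs]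
  linear_combination (subst h (derivative K f)) * hL

/-- A first order homogeneous linear equation has no nonzero solution with value `0` at `0`. -/
theorem eq_zero_of_theta_eq_mul [CharZero K] {Y L : K⟦X⟧} (hL : coeff 0 L = 0)
    (hY : coeff 0 Y = 0) (h : theta Y = Y * L) : Y = 0 := by
  ext n
  rw [map_zero]
  induction n using Nat.strong_induction_on with
  | _ n ih =>
    rcases Nat.eq_zero_or_pos n with rfl | hn
    · exact hY
    · have h1 := congrArg (coeff n) h
      rw [coeff_theta, coeff_mul] at h1
      have h2 : ∑ q ∈ antidiagonal n, coeff q.1 Y * coeff q.2 L = 0 := by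
        refine Finset.sum_eq_zero fun q hq => ?_
        rw [HasAntidiagonal.mem_antidiagonal] at hq
        rcases Nat.eq_zero_or_pos q.2 with h0 | h0
        · rw [h0, hL, mul_zero]
        · rw [ih q.1 (by omega), zero_mul]
      rw [h2] at h1
      exact (mul_eq_zero.1 h1).resolve_left (by exact_mod_cast hn.ne')

theorem eq_of_theta_eq_mul [CharZero K] {Y Z L : K⟦X⟧} (hL : coeff 0 L = 0)
    (h0 : coeff 0 Y = coeff 0 Z) (hY : theta Y = Y * L) (hZ : theta Z = Z * L) : Y = Z := by
  refine sub_eq_zero.1 (eq_zero_of_theta_eq_mul hL (by rw [map_sub, h0, sub_self]) ?_)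
  rw [theta_sub, hY, hZ, sub_mul]

theorem eq_of_theta_eq [CharZero K] {Y Z : K⟦X⟧} (h0 : coeff 0 Y = coeff 0 Z)
    (h : theta Y = theta Z) : Y = Z := by
  refine sub_eq_zero.1 (eq_zero_of_theta_eq_mul (L := 0) (by simp)
    (by rw [map_sub, h0, sub_self]) ?_)
  rw [theta_sub, h, sub_self, mul_zero]

/-- Two products of series that agree below `X ^ n` differ at `X ^ n` only through the
contributions of the two coefficients at `X ^ n`. -/
theorem coeff_mul_sub_of_agree {f f' g g' : K⟦X⟧} {n : ℕ} (hn : 0 < n)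
    (hf : ∀ i < n, coeff i f = coeff i f') (hg : ∀ i < n, coeff i g = coeff i g') :
    coeff n (f * g) - coeff n (f' * g') =
      coeff 0 f * (coeff n g - coeff n g') + (coeff n f - coeff n f') * coeff 0 g := by
  have e : ∀ u v : K⟦X⟧, coeff n (u * v) = coeff 0 u * coeff n v + coeff n u * coeff 0 v +
      ∑ i ∈ Ico 1 n, coeff i u * coeff (n - i) v := fun u v => by
    rw [coeff_mul, Finset.Nat.sum_antidiagonal_eq_sum_range_succ (fun i j => coeff i u * coeff j v),
      Finset.range_eq_Ico, Finset.sum_Ico_succ_top (by omega), Finset.sum_eq_sum_Ico_succ_bot hn]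
    simp only [Nat.sub_zero, Nat.sub_self, zero_add]
    ring
  have e2 : ∑ i ∈ Ico 1 n, coeff i f * coeff (n - i) g =
      ∑ i ∈ Ico 1 n, coeff i f' * coeff (n - i) g' := by
    refine Finset.sum_congr rfl fun i hi => ?_
    rw [mem_Ico] at hi
    rw [hf i hi.2, hg (n - i) (by omega)]
  rw [e, e, e2, ← hf 0 hn, ← hg 0 hn]
  ring

theorem coeff_mul_of_agree {f f' g g' : K⟦X⟧} {n : ℕ}
    (hf : ∀ i < n, coeff i f = coeff i f') (hg : ∀ i < n, coeff i g = coeff i g') :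
    ∀ i < n, coeff i (f * g) = coeff i (f' * g') := by
  intro i hi
  rw [coeff_mul, coeff_mul]
  refine Finset.sum_congr rfl fun q hq => ?_
  rw [HasAntidiagonal.mem_antidiagonal] at hq
  rw [hf q.1 (by omega), hg q.2 (by omega)]

theorem coeff_pow_of_agree {f f' : K⟦X⟧} {n : ℕ} (hf : ∀ i < n, coeff i f = coeff i f') (N : ℕ) :
    ∀ i < n, coeff i (f ^ N) = coeff i (f' ^ N) := by
  induction N with
  | zero => simp
  | succ N ih => rw [pow_succ, pow_succ]; exact coeff_mul_of_agree ih hf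

theorem coeff_pow_sub_of_agree {f f' : K⟦X⟧} {n : ℕ} (hn : 0 < n)
    (hf : ∀ i < n, coeff i f = coeff i f') (h1 : coeff 0 f = 1) (N : ℕ) :
    coeff n (f ^ N) - coeff n (f' ^ N) = N * (coeff n f - coeff n f') := by
  induction N with
  | zero => simp
  | succ N ih =>
    rw [pow_succ, pow_succ, coeff_mul_sub_of_agree hn (coeff_pow_of_agree hf N) hf, ih, h1]
    have : coeff 0 (f ^ N) = 1 := by rw [coeff_zero_eq_constantCoeff_apply, map_pow,
      ← coeff_zero_eq_constantCoeff_apply, h1, one_pow]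
    rw [this]; push_cast; ring

theorem coeff_zero_subst {f h : K⟦X⟧} (hh : constantCoeff h = 0) :
    coeff 0 (f.subst h) = coeff 0 f := by
  rw [coeff_subst' (HasSubst.of_constantCoeff_zero' hh), finsum_eq_single _ 0]
  · simp
  · intro n hn
    rw [coeff_zero_eq_constantCoeff_apply, map_pow, hh, zero_pow hn, smul_zero]

variable [CharZero K]

/-- The exponential of a power series without constant term. -/
def expOf (f : K⟦X⟧) : K⟦X⟧ := (PowerSeries.exp K).subst f

theorem coeff_zero_expOf {f : K⟦X⟧} (hf : constantCoeff f = 0) : coeff 0 (expOf f) = 1 := by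
  unfold expOf
  rw [coeff_zero_subst hf]
  simp

theorem theta_expOf {f : K⟦X⟧} (hf : constantCoeff f = 0) :
    theta (expOf f) = expOf f * theta f := by
  unfold expOf theta
  rw [derivative_subst (HasSubst.of_constantCoeff_zero' hf), derivative_exp]
  ring

theorem coeff_zero_theta (f : K⟦X⟧) : coeff 0 (theta f) = 0 := by rw [coeff_theta]; simp

theorem expOf_unique {f Y : K⟦X⟧} (hf : constantCoeff f = 0) (h0 : coeff 0 Y = 1)
    (h : theta Y = Y * theta f) : Y = expOf f :=
  eq_of_theta_eq_mul (coeff_zero_theta f) (by rw [h0, coeff_zero_expOf hf]) h (theta_expOf hf)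

theorem expOf_add {f g : K⟦X⟧} (hf : constantCoeff f = 0) (hg : constantCoeff g = 0) :
    expOf (f + g) = expOf f * expOf g := by
  refine (expOf_unique (by rw [map_add, hf, hg, add_zero]) ?_ ?_).symm
  · rw [coeff_zero_mul', coeff_zero_expOf hf, coeff_zero_expOf hg, one_mul]
  · rw [theta_mul, theta_expOf hf, theta_expOf hg, theta_add]; ring

theorem expOf_zero : expOf (0 : K⟦X⟧) = 1 :=
  (expOf_unique (by simp) (by simp) (by
    have : theta (0 : K⟦X⟧) = 0 := by simpa using theta_C (0 : K)
    rw [theta_one, this, mul_zero])).symm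

theorem expOf_natCast_mul {f : K⟦X⟧} (hf : constantCoeff f = 0) (n : ℕ) :
    expOf ((n : K⟦X⟧) * f) = expOf f ^ n := by
  induction n with
  | zero => simp [expOf_zero]
  | succ n ih =>
    have : ((n + 1 : ℕ) : K⟦X⟧) * f = n * f + f := by push_cast; ring
    rw [this, expOf_add (by rw [map_mul, hf, mul_zero]) hf, ih, pow_succ]

theorem expand_expOf {f : K⟦X⟧} (hf : constantCoeff f = 0) (q : ℕ) (hq : q ≠ 0) :
    expand q hq (expOf f) = expOf (expand q hq f) := by
  unfold expOf
  exact expand_subst q hq (HasSubst.of_constantCoeff_zero' hf) _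

theorem map_expOf {L : Type*} [Field L] [CharZero L] (φ : K →+* L) {f : K⟦X⟧}
    (hf : constantCoeff f = 0) : map φ (expOf f) = expOf (map φ f) := by
  unfold expOf
  rw [← map_exp (φ : K →+* L)]
  exact PowerSeries.map_subst (HasSubst.of_constantCoeff_zero' hf) _

end FormalSeries

/-! ### Power series over the `p`-adic numbers -/

section PadicSeries

open PowerSeries

variable {p : ℕ} [hp : Fact p.Prime]

/-- The coefficients of `f` below `X ^ N` satisfy `‖fₙ‖ ≤ cⁿ`. -/
def CoeffLe (c : ℝ) (N : ℕ) (f : ℚ_[p]⟦X⟧) : Prop := ∀ n < N, ‖coeff n f‖ ≤ c ^ n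

theorem CoeffLe.mul {c : ℝ} (hc : 0 ≤ c) {N : ℕ} {f g : ℚ_[p]⟦X⟧} (hf : CoeffLe c N f)
    (hg : CoeffLe c N g) : CoeffLe c N (f * g) := by
  intro n hn
  rw [coeff_mul]
  refine padic_norm_sum_le (pow_nonneg hc n) fun q hq => ?_
  rw [HasAntidiagonal.mem_antidiagonal] at hq
  rw [norm_mul, ← hq, pow_add]
  exact mul_le_mul (hf _ (by omega)) (hg _ (by omega)) (norm_nonneg _) (pow_nonneg hc _)

theorem CoeffLe.one {c : ℝ} (hc : 0 ≤ c) (N : ℕ) : CoeffLe c N (1 : ℚ_[p]⟦X⟧) := by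
  intro n _
  rw [coeff_one]
  split_ifs with h
  · rw [h]; simp
  · rw [norm_zero]; exact pow_nonneg hc n

theorem CoeffLe.pow {c : ℝ} (hc : 0 ≤ c) {N : ℕ} {f : ℚ_[p]⟦X⟧} (hf : CoeffLe c N f) (k : ℕ) :
    CoeffLe c N (f ^ k) := by
  induction k with
  | zero => rw [pow_zero]; exact CoeffLe.one hc N
  | succ k ih => rw [pow_succ]; exact ih.mul hc hf

theorem CoeffLe.inv {c : ℝ} (hc : 0 ≤ c) {N : ℕ} {f g : ℚ_[p]⟦X⟧} (hf : CoeffLe c N f)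
    (hf0 : coeff 0 f = 1) (hfg : f * g = 1) : CoeffLe c N g := by
  have hg0 : coeff 0 g = 1 := by
    have := congrArg (coeff 0) hfg
    rwa [coeff_zero_mul', hf0, one_mul, coeff_zero_one] at this
  intro n hn
  induction n using Nat.strong_induction_on with
  | _ n ih =>
    rcases Nat.eq_zero_or_pos n with rfl | h0
    · rw [hg0]; simp
    · have h1 := congrArg (coeff n) hfg
      rw [coeff_one, if_neg h0.ne', coeff_mul,
        Finset.Nat.sum_antidiagonal_eq_sum_range_succ (fun i j => coeff i f * coeff j g),
        Finset.sum_range_succ', hf0, one_mul, Nat.sub_zero] at h1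
      rw [eq_neg_of_add_eq_zero_right h1, norm_neg]
      refine padic_norm_sum_le (pow_nonneg hc n) fun i hi => ?_
      rw [mem_range] at hi
      have e : n = (i + 1) + (n - (i + 1)) := by omega
      rw [norm_mul]
      calc _ ≤ c ^ (i + 1) * c ^ (n - (i + 1)) :=
            mul_le_mul (hf _ (by omega)) (ih _ (by omega) (by omega)) (norm_nonneg _)
              (pow_nonneg hc _)
        _ = _ := by rw [← pow_add, ← e]

/-- The series with coefficients in `ℤ_[p]`. -/
def IsPadicIntegral (f : ℚ_[p]⟦X⟧) : Prop := ∀ n, ‖coeff n f‖ ≤ 1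

theorem isPadicIntegral_iff {f : ℚ_[p]⟦X⟧} : IsPadicIntegral f ↔ ∀ N, CoeffLe 1 N f := by
  simp only [IsPadicIntegral, CoeffLe, one_pow]
  exact ⟨fun h N n _ => h n, fun h n => h (n + 1) n (Nat.lt_succ_self n)⟩

/-- All coefficients of `f` are divisible by `p`. -/
def IsSmall (f : ℚ_[p]⟦X⟧) : Prop := ∀ n, ‖coeff n f‖ ≤ (p : ℝ)⁻¹

theorem IsSmall.isPadicIntegral {f : ℚ_[p]⟦X⟧} (hf : IsSmall f) : IsPadicIntegral f :=
  fun n => (hf n).trans inv_prime_le_one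

theorem IsSmall.add {f g : ℚ_[p]⟦X⟧} (hf : IsSmall f) (hg : IsSmall g) : IsSmall (f + g) :=
  fun n => by rw [map_add]; exact padic_norm_add_le (hf n) (hg n)

theorem IsSmall.sub {f g : ℚ_[p]⟦X⟧} (hf : IsSmall f) (hg : IsSmall g) : IsSmall (f - g) :=
  fun n => by rw [map_sub]; exact padic_norm_sub_le (hf n) (hg n)

theorem IsSmall.neg {f : ℚ_[p]⟦X⟧} (hf : IsSmall f) : IsSmall (-f) :=
  fun n => by rw [map_neg, norm_neg]; exact hf n

theorem IsSmall.mul {f g : ℚ_[p]⟦X⟧} (hf : IsSmall f) (hg : IsPadicIntegral g) : IsSmall (f * g) := by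
  intro n
  rw [coeff_mul]
  refine padic_norm_sum_le inv_prime_pos.le fun q _ => ?_
  rw [norm_mul]
  calc _ ≤ (p : ℝ)⁻¹ * 1 := mul_le_mul (hf _) (hg _) (norm_nonneg _) inv_prime_pos.le
    _ = _ := mul_one _

theorem IsPadicIntegral.mul {f g : ℚ_[p]⟦X⟧} (hf : IsPadicIntegral f) (hg : IsPadicIntegral g) :
    IsPadicIntegral (f * g) := by
  rw [isPadicIntegral_iff] at *
  exact fun N => (hf N).mul zero_le_one (hg N)

theorem IsPadicIntegral.pow {f : ℚ_[p]⟦X⟧} (hf : IsPadicIntegral f) (k : ℕ) : IsPadicIntegral (f ^ k) := by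
  rw [isPadicIntegral_iff] at *
  exact fun N => (hf N).pow zero_le_one k

theorem IsPadicIntegral.inv {f g : ℚ_[p]⟦X⟧} (hf : IsPadicIntegral f) (hf0 : coeff 0 f = 1)
    (hfg : f * g = 1) : IsPadicIntegral g := by
  rw [isPadicIntegral_iff] at *
  exact fun N => (hf N).inv zero_le_one hf0 hfg

theorem IsSmall.expand {f : ℚ_[p]⟦X⟧} (hf : IsSmall f) (q : ℕ) (hq : q ≠ 0) :
    IsSmall (expand q hq f) := by
  intro n
  rw [coeff_expand]
  split_ifs
  · exact hf _
  · rw [norm_zero]; exact inv_prime_pos.le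

theorem IsPadicIntegral.expand {f : ℚ_[p]⟦X⟧} (hf : IsPadicIntegral f) (q : ℕ) (hq : q ≠ 0) :
    IsPadicIntegral (expand q hq f) := by
  intro n
  rw [coeff_expand]
  split_ifs
  · exact hf _
  · rw [norm_zero]; exact zero_le_one

theorem natCast_mul_eq_C (k : ℕ) (f : ℚ_[p]⟦X⟧) : (k : ℚ_[p]⟦X⟧) * f = C (k : ℚ_[p]) * f := by
  rw [map_natCast]

theorem norm_inv_factorial_le (k : ℕ) (hk : k ≠ 0) :
    ‖((Nat.factorial k : ℚ_[p]))⁻¹‖ ≤ (p : ℝ) ^ (k - 1) := by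
  rw [norm_inv]
  have h1 : ‖(Nat.factorial k : ℚ_[p])‖ = (p : ℝ) ^ (-(padicValNat p k.factorial : ℤ)) := by
    have h0 : ((Nat.factorial k : ℕ) : ℚ) ≠ 0 := by exact_mod_cast Nat.factorial_ne_zero k
    have := Padic.eq_padicNorm (p := p) ((Nat.factorial k : ℕ) : ℚ)
    rw [Rat.cast_natCast] at this
    rw [this, padicNorm.eq_zpow_of_nonzero h0, padicValRat.of_nat]
    push_cast; rfl
  rw [h1, zpow_neg, inv_inv, zpow_natCast]
  have := padicValNat_factorial_lt_of_ne_zero (p := p) hk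
  exact pow_le_pow_right₀ (by exact_mod_cast hp.out.one_lt.le) (by omega)

theorem IsSmall.coeff_pow_le {η : ℚ_[p]⟦X⟧} (h : IsSmall η) (k n : ℕ) :
    ‖coeff n (η ^ (k + 1))‖ ≤ (p : ℝ)⁻¹ ^ (k + 1) := by
  induction k generalizing n with
  | zero => simpa using h n
  | succ k ih =>
    have hP := (inv_prime_pos (p := p)).le
    rw [pow_succ, coeff_mul]
    refine padic_norm_sum_le (pow_nonneg hP _) fun q _ => ?_
    rw [norm_mul, pow_succ _ (k + 1)]
    exact mul_le_mul (ih _) (h _) (norm_nonneg _) (pow_nonneg hP _)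

theorem padic_norm_finsum_le {ι : Type*} {f : ι → ℚ_[p]} {c : ℝ} (hc : 0 ≤ c)
    (h : ∀ i, ‖f i‖ ≤ c) : ‖∑ᶠ i, f i‖ ≤ c := by
  by_cases hf : (Function.support f).Finite
  · rw [finsum_eq_sum f hf]
    exact padic_norm_sum_le hc fun i _ => h i
  · rw [finsum_of_infinite_support hf, norm_zero]; exact hc

/-- The exponential of a series divisible by `p` is `1` modulo `p`. -/
theorem IsSmall.expOf {η : ℚ_[p]⟦X⟧} (h : IsSmall η) (h0 : constantCoeff η = 0) :
    IsSmall (expOf η - 1) := by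
  intro n
  rw [map_sub]
  rcases Nat.eq_zero_or_pos n with rfl | hn
  · rw [coeff_zero_expOf h0]; simp [inv_prime_pos.le]
  · rw [coeff_one, if_neg hn.ne', sub_zero]
    unfold _root_.expOf
    rw [coeff_subst' (HasSubst.of_constantCoeff_zero' h0)]
    refine padic_norm_finsum_le inv_prime_pos.le fun k => ?_
    cases k with
    | zero => rw [pow_zero, coeff_one, if_neg hn.ne', smul_zero, norm_zero]; exact inv_prime_pos.le
    | succ k =>
      have e : coeff (k + 1) (PowerSeries.exp ℚ_[p]) = ((Nat.factorial (k + 1) : ℚ_[p]))⁻¹ := by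
        rw [coeff_exp]; simp
      have hp0 : (p : ℝ) ≠ 0 := by exact_mod_cast hp.out.ne_zero
      rw [smul_eq_mul, norm_mul, e]
      calc _ ≤ (p : ℝ) ^ k * (p : ℝ)⁻¹ ^ (k + 1) :=
            mul_le_mul (norm_inv_factorial_le (k + 1) (Nat.succ_ne_zero k)) (h.coeff_pow_le k n)
              (norm_nonneg _) (by positivity)
        _ = _ := by rw [pow_succ, ← mul_assoc, ← mul_pow, mul_inv_cancel₀ hp0, one_pow, one_mul]

theorem zmod_pow_eq_expand (f : (ZMod p)⟦X⟧) : f ^ p = expand p hp.out.ne_zero f := by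
  ext n
  have h1 : coeff n (f ^ p) = ((trunc (n + 1) f) ^ p).coeff n := by
    have := congrArg (fun g => Polynomial.coeff g n) (trunc_trunc_pow f (n + 1) p)
    simp only [coeff_trunc, if_pos (Nat.lt_succ_self n)] at this
    rw [← this, ← Polynomial.coe_pow, Polynomial.coeff_coe]
  rw [h1, ← ZMod.expand_card, Polynomial.coeff_expand hp.out.pos, coeff_expand]
  split_ifs
  · rw [coeff_trunc, if_pos (Nat.lt_succ_of_le (Nat.div_le_self _ _))]
  · rfl

/-- The Frobenius congruence `f(X)ᵖ ≡ f(Xᵖ) (mod p)` for integral `f`. -/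
theorem IsPadicIntegral.pow_sub_expand {f : ℚ_[p]⟦X⟧} (hf : IsPadicIntegral f) :
    IsSmall (f ^ p - PowerSeries.expand p hp.out.ne_zero f) := by
  let c : ℕ → ℤ_[p] := fun n => ⟨coeff n f, hf n⟩
  let F : ℤ_[p]⟦X⟧ := PowerSeries.mk c
  have hF : map (PadicInt.Coe.ringHom (p := p)) F = f := by
    ext n
    rw [coeff_map]
    exact congrArg (fun x : ℤ_[p] => (x : ℚ_[p])) (coeff_mk n c)
  have h1 : map (PadicInt.toZMod (p := p)) (F ^ p - PowerSeries.expand p hp.out.ne_zero F) = 0 := by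
    rw [map_sub, map_pow, map_expand, zmod_pow_eq_expand, sub_self]
  have h2 : map (PadicInt.Coe.ringHom (p := p)) (F ^ p - PowerSeries.expand p hp.out.ne_zero F) =
      f ^ p - PowerSeries.expand p hp.out.ne_zero f := by
    rw [map_sub, map_pow, map_expand, hF]
  intro n
  rw [← h2, coeff_map]
  have h3 := congrArg (coeff n) h1
  rw [coeff_map, map_zero] at h3
  have h4 : coeff n (F ^ p - PowerSeries.expand p hp.out.ne_zero F) ∈
      RingHom.ker (PadicInt.toZMod (p := p)) := h3
  rw [PadicInt.ker_toZMod, PadicInt.maximalIdeal_eq_span_p] at h4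
  have h5 := (PadicInt.norm_le_pow_iff_mem_span_pow _ 1).2 (by simpa using h4)
  refine le_trans (le_of_eq ?_) (h5.trans (le_of_eq ?_))
  · rfl
  · simp

/-- The **Dieudonné–Dwork criterion**: `Q` is integral if `Q(Xᵖ) / Q(X)ᵖ` is `1` modulo `p`. -/
theorem isPadicIntegral_of_expand_eq {Q E : ℚ_[p]⟦X⟧} (hQ0 : coeff 0 Q = 1)
    (hE : IsSmall (E - 1)) (h : PowerSeries.expand p hp.out.ne_zero Q = Q ^ p * E) :
    IsPadicIntegral Q := by
  intro n
  induction n using Nat.strong_induction_on with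
  | _ n ih =>
    rcases Nat.eq_zero_or_pos n with rfl | hn
    · rw [hQ0]; simp
    let T : ℚ_[p]⟦X⟧ := PowerSeries.mk fun i => if i < n then coeff i Q else 0
    have hT : ∀ i < n, coeff i Q = coeff i T := fun i hi => by simp [T, hi]
    have hTn : coeff n T = 0 := by simp [T]
    have hTint : IsPadicIntegral T := fun i => by
      simp only [T, coeff_mk]
      split_ifs with hi
      · exact ih i hi
      · simp
    have h1 := coeff_pow_sub_of_agree hn hT hQ0 p
    rw [hTn, sub_zero] at h1
    have h2 : coeff n (PowerSeries.expand p hp.out.ne_zero Q) =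
        coeff n (PowerSeries.expand p hp.out.ne_zero T) := by
      rw [coeff_expand, coeff_expand]
      split_ifs
      · exact hT _ (Nat.div_lt_self hn hp.out.one_lt)
      · rfl
    have h3 : coeff n (Q ^ p * (E - 1)) = coeff n (T ^ p * (E - 1)) := by
      have hE0 : coeff 0 (E - 1) = 0 := by
        have := congrArg (coeff 0) h
        rw [coeff_expand, if_pos (dvd_zero p), Nat.zero_div, coeff_zero_mul', hQ0,
          coeff_zero_eq_constantCoeff_apply, map_pow, ← coeff_zero_eq_constantCoeff_apply, hQ0,
          one_pow, one_mul] at this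
        rw [map_sub, ← this]; simp
      have := coeff_mul_sub_of_agree (g := E - 1) (g' := E - 1) hn (coeff_pow_of_agree hT p)
        (fun _ _ => rfl)
      rw [hE0, sub_self, mul_zero, mul_zero, add_zero] at this
      exact sub_eq_zero.1 this
    have h4 : (p : ℚ_[p]) * coeff n Q =
        -coeff n (T ^ p - PowerSeries.expand p hp.out.ne_zero T) -
          coeff n (T ^ p * (E - 1)) := by
      have h5 := congrArg (coeff n) h
      rw [h2, show Q ^ p * E = Q ^ p + Q ^ p * (E - 1) by ring, map_add, h3] at h5
      rw [← h1, map_sub, h5]; ring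
    have h6 : ‖(p : ℚ_[p]) * coeff n Q‖ ≤ (p : ℝ)⁻¹ := by
      rw [h4]
      refine padic_norm_sub_le ?_ ?_
      · rw [norm_neg]; exact hTint.pow_sub_expand n
      · rw [mul_comm]; exact (hE.mul (hTint.pow p)) n
    rw [norm_p_mul] at h6
    exact le_of_mul_le_mul_left (by simpa using h6) (inv_prime_pos (p := p))

end PadicSeries

/-! ### Bounded denominators force integrality -/

section Slopes

open PowerSeries

variable {p : ℕ} [hp : Fact p.Prime]

theorem padic_norm_sum_lt {ι : Type*} {s : Finset ι} {f : ι → ℚ_[p]} {C : ℝ} (hC : 0 < C)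
    (h : ∀ i ∈ s, ‖f i‖ < C) : ‖∑ i ∈ s, f i‖ < C := by
  refine Finset.sum_induction f (fun x => ‖x‖ < C) (fun x y hx hy => ?_) (by simpa using hC) h
  exact lt_of_le_of_lt (Padic.nonarchimedean x y) (max_lt hx hy)

/-- The ring of power series with `‖fₙ‖ ≤ cⁿ` for all `n`. -/
def coeffLeSubring (p : ℕ) [Fact p.Prime] (c : ℝ) (hc : 0 ≤ c) : Subring ℚ_[p]⟦X⟧ where
  carrier := {f | ∀ N, CoeffLe c N f}
  mul_mem' hf hg N := (hf N).mul hc (hg N)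
  one_mem' := CoeffLe.one hc
  add_mem' hf hg N n hn := by rw [map_add]; exact padic_norm_add_le (hf N n hn) (hg N n hn)
  zero_mem' N n _ := by rw [map_zero, norm_zero]; exact pow_nonneg hc n
  neg_mem' hf N n hn := by rw [map_neg, norm_neg]; exact hf N n hn

theorem mem_coeffLeSubring {c : ℝ} (hc : 0 ≤ c) {f : ℚ_[p]⟦X⟧} :
    f ∈ coeffLeSubring p c hc ↔ ∀ n, ‖coeff n f‖ ≤ c ^ n :=
  ⟨fun h n => h (n + 1) n (Nat.lt_succ_self n), fun h _ n _ => h n⟩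

/-- The coefficients of `f` satisfy `‖fₙ‖ < cⁿ`; these series form an ideal of
`coeffLeSubring p c`. -/
def CoeffLt (c : ℝ) (f : ℚ_[p]⟦X⟧) : Prop := ∀ n, ‖coeff n f‖ < c ^ n

theorem CoeffLt.mul {c : ℝ} (hc : 0 < c) {f g : ℚ_[p]⟦X⟧} (hf : CoeffLt c f)
    (hg : g ∈ coeffLeSubring p c hc.le) : CoeffLt c (f * g) := by
  intro n
  rw [coeff_mul]
  refine padic_norm_sum_lt (pow_pos hc n) fun q hq => ?_
  rw [HasAntidiagonal.mem_antidiagonal] at hq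
  rw [norm_mul, ← hq, pow_add]
  exact mul_lt_mul_of_lt_of_le_of_nonneg_of_pos (hf _) ((mem_coeffLeSubring hc.le).1 hg _)
    (norm_nonneg _) (pow_pos hc _)

theorem CoeffLt.add {c : ℝ} {f g : ℚ_[p]⟦X⟧} (hf : CoeffLt c f) (hg : CoeffLt c g) :
    CoeffLt c (f + g) := fun n => by
  rw [map_add]
  exact lt_of_le_of_lt (Padic.nonarchimedean _ _) (max_lt (hf n) (hg n))

theorem CoeffLt.neg {c : ℝ} {f : ℚ_[p]⟦X⟧} (hf : CoeffLt c f) : CoeffLt c (-f) := fun n => by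
  rw [map_neg, norm_neg]; exact hf n

theorem CoeffLt.mem {c : ℝ} (hc : 0 ≤ c) {f : ℚ_[p]⟦X⟧} (hf : CoeffLt c f) :
    f ∈ coeffLeSubring p c hc := (mem_coeffLeSubring hc).2 fun n => (hf n).le

/-- The ideal `CoeffLt c` is radical: the first coefficient with `‖fₙ‖ = cⁿ` survives in powers,
as in the lemma of Gauss. -/
theorem CoeffLt.of_pow {c : ℝ} (hc : 0 < c) {f : ℚ_[p]⟦X⟧} (hf : f ∈ coeffLeSubring p c hc.le)
    (N : ℕ) (h : CoeffLt c (f ^ N)) : CoeffLt c f := by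
  intro n
  induction n using Nat.strong_induction_on with
  | _ n ih =>
    let T : ℚ_[p]⟦X⟧ := PowerSeries.mk fun i => if i < n then coeff i f else 0
    have hT : CoeffLt c T := fun i => by
      simp only [T, coeff_mk]
      split_ifs with hi
      · exact ih i hi
      · rw [norm_zero]; exact pow_pos hc i
    obtain ⟨g, hg⟩ : X ^ n ∣ f - T := by
      rw [X_pow_dvd_iff]
      intro i hi
      rw [map_sub]
      simp [T, hi]
    have hgn : coeff 0 g = coeff n f := by
      have := congrArg (coeff n) hg
      rw [map_sub, coeff_X_pow_mul'] at this
      simpa [T] using this.symm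
    have hmem : f - T ∈ coeffLeSubring p c hc.le := sub_mem hf (hT.mem hc.le)
    have hdvd := sub_dvd_pow_sub_pow (⟨f, hf⟩ : coeffLeSubring p c hc.le) ⟨f - T, hmem⟩ N
    obtain ⟨k, hk⟩ := hdvd
    have hk' : f ^ N - (f - T) ^ N = T * (k : ℚ_[p]⟦X⟧) := by
      have := congrArg (fun y : coeffLeSubring p c hc.le => (y : ℚ_[p]⟦X⟧)) hk
      simpa using this
    have h1 : CoeffLt c ((f - T) ^ N) := by
      have : (f - T) ^ N = f ^ N + -(T * (k : ℚ_[p]⟦X⟧)) := by rw [← hk']; ring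
      rw [this]
      exact h.add (hT.mul hc k.2).neg
    have h2 := h1 (n * N)
    rw [hg, mul_pow, ← pow_mul, coeff_X_pow_mul', if_pos le_rfl, Nat.sub_self,
      coeff_zero_eq_constantCoeff_apply, map_pow, ← coeff_zero_eq_constantCoeff_apply, hgn,
      norm_pow, pow_mul] at h2
    exact lt_of_pow_lt_pow_left₀ N (pow_nonneg hc.le n) h2

theorem IsSmall.coeffLt {c : ℝ} (hc : 1 ≤ c) {f : ℚ_[p]⟦X⟧} (hf : IsSmall f) : CoeffLt c f :=
  fun n => lt_of_le_of_lt (hf n) (lt_of_lt_of_le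
    (inv_lt_one_of_one_lt₀ (by exact_mod_cast hp.out.one_lt)) (one_le_pow₀ hc))

/-- If `Q(X)ᴾ` and `Q(Xᴾ)` agree modulo `p`, where `P` is a power of `p`, then a bound
`‖Qₙ‖ ≤ cⁿ` with `c > 1` is nowhere attained: the substitution `X ↦ Xᴾ` improves it. -/
theorem coeffLt_of_pow_eq_expand_mul {c : ℝ} (hc : 1 < c) {e : ℕ} (he : e ≠ 0)
    (hPe : p ^ e ≠ 0) {Q E : ℚ_[p]⟦X⟧} (hQ0 : coeff 0 Q = 1)
    (hQ : Q ∈ coeffLeSubring p c (zero_le_one.trans hc.le)) (hE : IsSmall (E - 1))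
    (h : Q ^ p ^ e = expand (p ^ e) hPe Q * E) : CoeffLt c (Q - 1) := by
  have hc0 : 0 < c := zero_lt_one.trans hc
  have hQ1 : Q - 1 ∈ coeffLeSubring p c hc0.le := sub_mem hQ (one_mem _)
  refine CoeffLt.of_pow hc0 hQ1 (p ^ e) ?_
  obtain ⟨r, hr⟩ := exists_add_pow_prime_pow_eq hp.out
    (⟨Q - 1, hQ1⟩ : coeffLeSubring p c hc0.le) 1 e
  have hr' := congrArg (fun y : coeffLeSubring p c hc0.le => (y : ℚ_[p]⟦X⟧)) hr
  simp only [Subring.coe_pow, Subring.coe_add, Subring.coe_mul, Subring.coe_one, one_pow,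
    sub_add_cancel, mul_one, Subring.coe_natCast] at hr'
  have hPc : c < c ^ p ^ e :=
    lt_self_pow₀ hc (Nat.one_lt_pow he hp.out.one_lt)
  have hX : CoeffLt c (expand (p ^ e) hPe Q - 1) := by
    intro n
    rw [map_sub, coeff_expand, coeff_one]
    split_ifs with h1 h2 h2
    · rw [h2, Nat.zero_div, hQ0]; simp
    · rw [sub_zero]
      obtain ⟨k, rfl⟩ := h1
      rw [Nat.mul_div_cancel_left _ (Nat.pos_of_ne_zero hPe), pow_mul]
      refine lt_of_le_of_lt ((mem_coeffLeSubring hc0.le).1 hQ k) ?_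
      exact pow_lt_pow_left₀ hPc hc0.le (fun h0 => h2 (by rw [h0, mul_zero]))
    · exact absurd (h2 ▸ dvd_zero _) h1
    · simp [pow_pos hc0]
  have hE1 := hE.coeffLt hc.le
  have hEm : E ∈ coeffLeSubring p c hc0.le := by
    have := add_mem (hE1.mem hc0.le) (one_mem _)
    rwa [sub_add_cancel] at this
  have hpr : CoeffLt c ((p : ℚ_[p]⟦X⟧) * ((Q - 1) * (r : ℚ_[p]⟦X⟧))) := by
    intro n
    rw [natCast_mul_eq_C, coeff_C_mul, norm_p_mul]
    calc _ ≤ (p : ℝ)⁻¹ * c ^ n :=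
          mul_le_mul_of_nonneg_left ((mem_coeffLeSubring hc0.le).1 (mul_mem hQ1 r.2) n) inv_prime_pos.le
      _ < 1 * c ^ n := mul_lt_mul_of_pos_right
          (inv_lt_one_of_one_lt₀ (by exact_mod_cast hp.out.one_lt)) (pow_pos hc0 n)
      _ = _ := one_mul _
  have e1 : (Q - 1) ^ p ^ e =
      (expand (p ^ e) hPe Q - 1) * E + (E - 1) +
        -((p : ℚ_[p]⟦X⟧) * ((Q - 1) * (r : ℚ_[p]⟦X⟧))) := by
    linear_combination h - hr'
  rw [e1]
  exact ((hX.mul hc0 hEm).add hE1).add hpr.neg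

/-- `V` is the series `Q(z)` for the series `z = s X / V` with a `p`-adic unit `s`: if `X` stands
for the coordinate `q` then `z(q)` is the compositional inverse of `s⁻¹ z Q(z)`. -/
structure IsInverseScale (Q V : ℚ_[p]⟦X⟧) : Prop where
  zero : coeff 0 Q = 1
  exists_eq : ∃ (s : ℚ_[p]) (Y : ℚ_[p]⟦X⟧), ‖s‖ = 1 ∧ V * Y = 1 ∧ V = Q.subst (C s * X * Y)

theorem coeff_subst_C_mul_X_mul (Q Y : ℚ_[p]⟦X⟧) (s : ℚ_[p]) (n : ℕ) :
    coeff n (Q.subst (C s * X * Y)) =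
      ∑ k ∈ range (n + 1), coeff k Q * (s ^ k * coeff (n - k) (Y ^ k)) := by
  have hz : constantCoeff (C s * X * Y) = 0 := by simp
  have e : ∀ k, coeff n ((C s * X * Y) ^ k) =
      if k ≤ n then s ^ k * coeff (n - k) (Y ^ k) else 0 := fun k => by
    rw [mul_pow, mul_pow, mul_assoc, ← map_pow, coeff_C_mul, coeff_X_pow_mul']
    split_ifs <;> simp
  rw [coeff_subst' (HasSubst.of_constantCoeff_zero' hz)]
  simp only [e, smul_eq_mul]
  rw [finsum_eq_sum_of_support_subset (s := range (n + 1))]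
  · refine Finset.sum_congr rfl fun k hk => ?_
    rw [if_pos (Nat.lt_succ_iff.1 (mem_range.1 hk))]
  · intro k hk
    rw [Function.mem_support] at hk
    simp only [coe_range, Set.mem_Iio]
    by_contra hlt
    exact hk (by rw [if_neg (by omega), mul_zero])

theorem IsInverseScale.coeff_zero {Q V : ℚ_[p]⟦X⟧} (h : IsInverseScale Q V) : coeff 0 V = 1 := by
  obtain ⟨s, Y, _, _, hV⟩ := h.exists_eq
  rw [hV, coeff_subst_C_mul_X_mul]
  simp [h.zero]

/-- A bound `‖Vₙ‖ ≤ cⁿ` passes from `V` to `Q`. -/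
theorem IsInverseScale.mem_of_mem {c : ℝ} (hc : 0 ≤ c) {Q V : ℚ_[p]⟦X⟧} (h : IsInverseScale Q V)
    (hV : V ∈ coeffLeSubring p c hc) : Q ∈ coeffLeSubring p c hc := by
  have hV0 := h.coeff_zero
  obtain ⟨s, Y, hs, hY, e⟩ := h.exists_eq
  have hYm : Y ∈ coeffLeSubring p c hc := fun N => (hV N).inv hc hV0 hY
  rw [mem_coeffLeSubring]
  intro n
  induction n using Nat.strong_induction_on with
  | _ n ih =>
    have h1 := coeff_subst_C_mul_X_mul Q Y s n
    have hY0 : coeff 0 (Y ^ n) = 1 := by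
      have := congrArg (coeff 0) hY
      rw [coeff_zero_mul', hV0, one_mul, coeff_zero_one] at this
      rw [coeff_zero_eq_constantCoeff_apply, map_pow, ← coeff_zero_eq_constantCoeff_apply, this,
        one_pow]
    rw [← e, Finset.sum_range_succ, Nat.sub_self, hY0, mul_one] at h1
    have h2 : ‖coeff n Q * s ^ n‖ ≤ c ^ n := by
      rw [eq_sub_of_add_eq' h1.symm]
      refine padic_norm_sub_le ((mem_coeffLeSubring hc).1 hV n)
        (padic_norm_sum_le (pow_nonneg hc n) fun k hk => ?_)
      rw [mem_range] at hk
      rw [norm_mul, norm_mul, norm_pow, hs, one_pow, one_mul]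
      calc _ ≤ c ^ k * c ^ (n - k) := mul_le_mul (ih k hk)
            ((mem_coeffLeSubring hc).1 (pow_mem hYm k) _) (norm_nonneg _) (pow_nonneg hc k)
        _ = _ := by rw [← pow_add, Nat.add_sub_cancel' hk.le]
    rwa [norm_mul, norm_pow, hs, one_pow, mul_one] at h2

/-- The recursion for the coefficients of `V` in terms of those of `Q` and the earlier ones of `V`. -/
theorem IsInverseScale.norm_coeff_le {c : ℝ} (hc : 0 ≤ c) {Q V : ℚ_[p]⟦X⟧}
    (h : IsInverseScale Q V) {n : ℕ} (hn : 0 < n) (hV : ∀ i < n, ‖coeff i V‖ ≤ c ^ i) :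
    ∃ a : ℕ → ℚ_[p], coeff n V = ∑ k ∈ range n, coeff (k + 1) Q * a k ∧
      ∀ k < n, ‖a k‖ ≤ c ^ (n - (k + 1)) := by
  have hV0 := h.coeff_zero
  obtain ⟨s, Y, hs, hY, e⟩ := h.exists_eq
  have hYm : CoeffLe c n Y := CoeffLe.inv hc hV hV0 hY
  refine ⟨fun k => s ^ (k + 1) * coeff (n - (k + 1)) (Y ^ (k + 1)), ?_, fun k hk => ?_⟩
  · have := coeff_subst_C_mul_X_mul Q Y s n
    rw [← e, Finset.sum_range_succ'] at this
    simpa [coeff_one, hn.ne'] using this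
  · rw [norm_mul, norm_pow, hs, one_pow, one_mul]
    exact hYm.pow hc (k + 1) _ (by omega)

/-- A bound `‖Qₙ‖ ≤ cⁿ` passes from `Q` to `V`. -/
theorem IsInverseScale.mem_of_mem' {c : ℝ} (hc : 0 ≤ c) {Q V : ℚ_[p]⟦X⟧} (h : IsInverseScale Q V)
    (hQ : Q ∈ coeffLeSubring p c hc) : V ∈ coeffLeSubring p c hc := by
  rw [mem_coeffLeSubring] at *
  intro n
  induction n using Nat.strong_induction_on with
  | _ n ih =>
    rcases Nat.eq_zero_or_pos n with rfl | hn
    · rw [h.coeff_zero]; simp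
    obtain ⟨a, ha, hb⟩ := h.norm_coeff_le hc hn ih
    rw [ha]
    refine padic_norm_sum_le (pow_nonneg hc n) fun k hk => ?_
    rw [mem_range] at hk
    rw [norm_mul]
    calc _ ≤ c ^ (k + 1) * c ^ (n - (k + 1)) :=
          mul_le_mul (hQ _) (hb k hk) (norm_nonneg _) (pow_nonneg hc _)
      _ = _ := by rw [← pow_add, Nat.add_sub_cancel' hk]

/-- A strict bound passes from `Q` to `V` as well. -/
theorem IsInverseScale.coeffLt {c : ℝ} (hc : 0 < c) {Q V : ℚ_[p]⟦X⟧} (h : IsInverseScale Q V)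
    (hQ : CoeffLt c (Q - 1)) {n : ℕ} (hn : 0 < n) : ‖coeff n V‖ < c ^ n := by
  have hQm : Q ∈ coeffLeSubring p c hc.le := by
    have := add_mem (hQ.mem hc.le) (one_mem _)
    rwa [sub_add_cancel] at this
  have hV := (mem_coeffLeSubring hc.le).1 (h.mem_of_mem' hc.le hQm)
  obtain ⟨a, ha, hb⟩ := h.norm_coeff_le hc.le hn fun i _ => hV i
  rw [ha]
  refine padic_norm_sum_lt (pow_pos hc n) fun k hk => ?_
  rw [mem_range] at hk
  have h1 := hQ (k + 1)
  rw [map_sub, coeff_one, if_neg (Nat.succ_ne_zero k), sub_zero] at h1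
  rw [norm_mul]
  calc _ < c ^ (k + 1) * c ^ (n - (k + 1)) :=
        mul_lt_mul_of_lt_of_le_of_nonneg_of_pos h1 (hb k hk) (norm_nonneg _) (pow_pos hc _)
    _ = _ := by rw [← pow_add, Nat.add_sub_cancel' hk]

theorem IsInverseScale.isPadicIntegral_iff {Q V : ℚ_[p]⟦X⟧} (h : IsInverseScale Q V) :
    IsPadicIntegral Q ↔ IsPadicIntegral V := by
  have e : ∀ f : ℚ_[p]⟦X⟧, IsPadicIntegral f ↔ f ∈ coeffLeSubring p 1 zero_le_one := fun f => by
    rw [mem_coeffLeSubring]; simp [IsPadicIntegral]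
  rw [e, e]
  exact ⟨h.mem_of_mem' zero_le_one, h.mem_of_mem zero_le_one⟩

/-- A bounded sequence that exceeds `1` somewhere has a smallest exponential majorant `cⁿ`, and it
is attained. -/
theorem exists_attained_slope {a : ℕ → ℝ} (ha : ∀ n, 0 ≤ a n) {B : ℝ} (hB : ∀ n, a n ≤ B)
    {m : ℕ} (hm0 : 0 < m) (hm : 1 < a m) :
    ∃ c : ℝ, 1 < c ∧ (∀ n, 0 < n → a n ≤ c ^ n) ∧ ∃ n, 0 < n ∧ a n = c ^ n := by
  let ψ : ℕ → ℝ := fun n => a n ^ ((n : ℝ)⁻¹)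
  have hψ0 : ∀ n, 0 ≤ ψ n := fun n => Real.rpow_nonneg (ha n) _
  have hψ : ∀ n, 0 < n → ψ n ^ n = a n := fun n hn =>
    Real.rpow_inv_natCast_pow (ha n) hn.ne'
  have hψm : 1 < ψ m := Real.one_lt_rpow hm (by positivity)
  obtain ⟨N, hN⟩ := pow_unbounded_of_one_lt B hψm
  obtain ⟨n₁, hn₁, hmax⟩ := Finset.exists_max_image ((range (N + m + 1)).filter (0 < ·)) ψ
    ⟨m, by simp [hm0]⟩
  rw [mem_filter] at hn₁
  have hle : ψ m ≤ ψ n₁ := hmax m (by simp [hm0])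
  have h1 : 1 < ψ n₁ := hψm.trans_le hle
  refine ⟨ψ n₁, h1, fun n hn => ?_, n₁, hn₁.2, (hψ n₁ hn₁.2).symm⟩
  by_cases hlt : n < N + m + 1
  · rw [← hψ n hn]
    exact pow_le_pow_left₀ (hψ0 n) (hmax n (by simp [hn]; omega)) n
  · calc a n ≤ B := hB n
      _ ≤ ψ m ^ N := hN.le
      _ ≤ ψ n₁ ^ N := pow_le_pow_left₀ (hψ0 m) hle N
      _ ≤ ψ n₁ ^ n := pow_le_pow_right₀ h1.le (by omega)

/-- If `V` has bounded denominators, it is integral. -/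
theorem IsInverseScale.isPadicIntegral_of_bounded {Q V E : ℚ_[p]⟦X⟧} (h : IsInverseScale Q V)
    {e : ℕ} (he : e ≠ 0) (hPe : p ^ e ≠ 0) (hE : IsSmall (E - 1))
    (hQ : Q ^ p ^ e = expand (p ^ e) hPe Q * E) {B : ℝ} (hB : ∀ n, ‖coeff n V‖ ≤ B) :
    IsPadicIntegral V := by
  by_contra hcon
  unfold IsPadicIntegral at hcon
  push Not at hcon
  obtain ⟨m, hm⟩ := hcon
  have hm0 : 0 < m := Nat.pos_of_ne_zero fun h0 => by
    rw [h0, h.coeff_zero, norm_one] at hm; exact lt_irrefl _ hm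
  obtain ⟨c, hc, hle, n, hn, hatt⟩ := exists_attained_slope (fun n => norm_nonneg (coeff n V)) hB
    hm0 hm
  have hc0 : 0 < c := zero_lt_one.trans hc
  have hV : V ∈ coeffLeSubring p c hc0.le := (mem_coeffLeSubring _).2 fun i => by
    rcases Nat.eq_zero_or_pos i with rfl | hi
    · rw [h.coeff_zero]; simp
    · exact hle i hi
  have := h.coeffLt hc0 (coeffLt_of_pow_eq_expand_mul hc he hPe h.zero (h.mem_of_mem hc0.le hV)
    hE hQ) hn
  exact absurd hatt this.ne

end Slopes

/-! ### Consequences of the Frobenius congruence -/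

section Frobenius

open PowerSeries

variable {p : ℕ} [hp : Fact p.Prime]

/-- A sequence of series without constant term with `p gᵢ(X) ≡ gᵢ₊₁(Xᵖ) (mod p)`. -/
structure IsFrobeniusSequence (g : ℕ → ℚ_[p]⟦X⟧) : Prop where
  zero : ∀ i, constantCoeff (g i) = 0
  congr : ∀ i, IsSmall ((p : ℚ_[p]⟦X⟧) * g i - expand p hp.out.ne_zero (g (i + 1)))

theorem constantCoeff_expand_eq_zero {f : ℚ_[p]⟦X⟧} (hf : constantCoeff f = 0) (q : ℕ)
    (hq : q ≠ 0) : constantCoeff (expand q hq f) = 0 := by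
  rw [constantCoeff_expand, hf]

theorem isPadicIntegral_natCast (k : ℕ) : IsPadicIntegral (k : ℚ_[p]⟦X⟧) := by
  intro n
  rw [← map_natCast (C (R := ℚ_[p])) k, coeff_C]
  split_ifs
  · exact_mod_cast PadicInt.norm_le_one (k : ℤ_[p])
  · simp

theorem IsFrobeniusSequence.pow_congr {g : ℕ → ℚ_[p]⟦X⟧} (h : IsFrobeniusSequence g) (e i : ℕ)
    (hPe : p ^ e ≠ 0) :
    IsSmall (((p ^ e : ℕ) : ℚ_[p]⟦X⟧) * g i - expand (p ^ e) hPe (g (i + e))) := by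
  induction e generalizing i with
  | zero =>
    intro n
    simp [inv_prime_pos.le]
  | succ e ih =>
    have hPe' : p ^ e ≠ 0 := pow_ne_zero _ hp.out.ne_zero
    have e1 : expand (p ^ (e + 1)) hPe (g (i + (e + 1))) =
        expand p hp.out.ne_zero (expand (p ^ e) hPe' (g (i + 1 + e))) := by
      rw [← expand_mul, show i + (e + 1) = i + 1 + e by ring]
      congr 2
      exact pow_succ' p e
    have e2 : ((p ^ (e + 1) : ℕ) : ℚ_[p]⟦X⟧) * g i - expand (p ^ (e + 1)) hPe (g (i + (e + 1))) =
        ((p : ℚ_[p]⟦X⟧) * g i - expand p hp.out.ne_zero (g (i + 1))) * ((p ^ e : ℕ) : ℚ_[p]⟦X⟧) +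
        expand p hp.out.ne_zero (((p ^ e : ℕ) : ℚ_[p]⟦X⟧) * g (i + 1) -
          expand (p ^ e) hPe' (g (i + 1 + e))) := by
      rw [e1, map_sub, map_mul, map_natCast]
      push_cast
      ring
    rw [e2]
    exact ((h.congr i).mul (isPadicIntegral_natCast _)).add
      ((ih (i + 1) hPe').expand p hp.out.ne_zero)

/-- `exp gᵢ` and `exp gᵢ₊ₑ` are related by the `e`-fold Frobenius modulo `p`. -/
theorem IsFrobeniusSequence.expOf_pow {g : ℕ → ℚ_[p]⟦X⟧} (h : IsFrobeniusSequence g) (e i : ℕ)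
    (hPe : p ^ e ≠ 0) : ∃ E : ℚ_[p]⟦X⟧, IsSmall (E - 1) ∧
      expOf (g i) ^ p ^ e = expand (p ^ e) hPe (expOf (g (i + e))) * E := by
  have h0 : constantCoeff (((p ^ e : ℕ) : ℚ_[p]⟦X⟧) * g i - expand (p ^ e) hPe (g (i + e))) = 0 := by
    rw [map_sub, map_mul, h.zero i, mul_zero, constantCoeff_expand_eq_zero (h.zero _), sub_zero]
  refine ⟨expOf (((p ^ e : ℕ) : ℚ_[p]⟦X⟧) * g i - expand (p ^ e) hPe (g (i + e))),
    (h.pow_congr e i hPe).expOf h0, ?_⟩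
  rw [expand_expOf (h.zero _), ← expOf_add (constantCoeff_expand_eq_zero (h.zero _) _ _) h0,
    add_sub_cancel, expOf_natCast_mul (h.zero i)]

/-- If the first two members agree, the congruence is that of the lemma of Dieudonné and Dwork. -/
theorem IsFrobeniusSequence.isPadicIntegral_of_eq {g : ℕ → ℚ_[p]⟦X⟧} (h : IsFrobeniusSequence g)
    (h1 : g 1 = g 0) : IsPadicIntegral (expOf (g 0)) := by
  have hd := h.congr 0
  rw [zero_add, h1] at hd
  have h0 : constantCoeff ((p : ℚ_[p]⟦X⟧) * g 0 - expand p hp.out.ne_zero (g 0)) = 0 := by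
    rw [map_sub, map_mul, h.zero, mul_zero, constantCoeff_expand_eq_zero (h.zero _), sub_zero]
  have hE := hd.neg.expOf (by rw [map_neg, h0, neg_zero])
  refine isPadicIntegral_of_expand_eq (coeff_zero_expOf (h.zero 0)) hE ?_
  rw [← expOf_natCast_mul (h.zero 0), expand_expOf (h.zero 0), ← expOf_add]
  · congr 1; ring
  · rw [map_mul, h.zero, mul_zero]
  · rw [map_neg, h0, neg_zero]

/-- For a periodic sequence, bounded denominators of the inverse series force integrality. -/
theorem IsFrobeniusSequence.isPadicIntegral_of_bounded {g : ℕ → ℚ_[p]⟦X⟧}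
    (h : IsFrobeniusSequence g) {e : ℕ} (he : e ≠ 0) (hper : g e = g 0) {V : ℚ_[p]⟦X⟧}
    (hV : IsInverseScale (expOf (g 0)) V) {B : ℝ} (hB : ∀ n, ‖coeff n V‖ ≤ B) :
    IsPadicIntegral V := by
  have hPe : p ^ e ≠ 0 := pow_ne_zero _ hp.out.ne_zero
  obtain ⟨E, hE, hQ⟩ := h.expOf_pow e 0 hPe
  rw [zero_add, hper] at hQ
  exact hV.isPadicIntegral_of_bounded he hPe hE hQ hB

/-- If `exp g₀` is integral, then `exp (g₀ - g₁)` is `1` modulo `p`. -/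
theorem IsFrobeniusSequence.isSmall_expOf_sub {g : ℕ → ℚ_[p]⟦X⟧} (h : IsFrobeniusSequence g)
    (hQ : IsPadicIntegral (expOf (g 0))) : IsSmall (expOf (g 0 - g 1) - 1) := by
  have hp0 := hp.out.ne_zero
  have hp1 : p ^ 1 ≠ 0 := by rwa [pow_one]
  obtain ⟨E, hE, hQE⟩ := h.expOf_pow 1 0 hp1
  simp only [pow_one, zero_add] at hQE
  set Q := expOf (g 0) with hQdef
  set D := expOf (g 0 - g 1) with hD
  have hQ0 : coeff 0 Q = 1 := coeff_zero_expOf (h.zero 0)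
  have hDQ : D * expOf (g 1) = Q := by
    rw [hD, ← expOf_add (by rw [map_sub, h.zero, h.zero, sub_zero]) (h.zero 1), sub_add_cancel]
  -- `Qᵖ = Q₁(Xᵖ) E` and `Q(Xᵖ) = D(Xᵖ) Q₁(Xᵖ)`, while `Qᵖ ≡ Q(Xᵖ)`
  have h1 : expand p hp0 D * Q ^ p = expand p hp0 Q * E := by
    rw [hQE, ← hDQ, map_mul]; ring
  have hfrob := hQ.pow_sub_expand
  have hEint : IsPadicIntegral E := by
    intro n
    have := padic_norm_add_le (hE.isPadicIntegral n)
      ((isPadicIntegral_natCast (p := p) 1) n)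
    rw [← map_add, Nat.cast_one, sub_add_cancel] at this
    exact this
  have h2 : IsSmall ((expand p hp0 D - 1) * Q ^ p) := by
    have : (expand p hp0 D - 1) * Q ^ p =
        (E - 1) * expand p hp0 Q - (Q ^ p - expand p hp0 Q) := by
      linear_combination h1
    rw [this]
    exact (hE.mul (hQ.expand p hp0)).sub hfrob
  have hQp0 : coeff 0 (Q ^ p) = 1 := by
    rw [coeff_zero_eq_constantCoeff_apply, map_pow, ← coeff_zero_eq_constantCoeff_apply, hQ0,
      one_pow]
  have hinv : Q ^ p * (Q ^ p)⁻¹ = 1 := PowerSeries.mul_inv_cancel _ (by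
    rw [← coeff_zero_eq_constantCoeff_apply, hQp0]; exact one_ne_zero)
  have h3 : IsSmall (expand p hp0 D - 1) := by
    have := h2.mul ((hQ.pow p).inv hQp0 hinv)
    rwa [mul_assoc, hinv, mul_one] at this
  intro n
  have h4 := h3 (p * n)
  rw [map_sub, coeff_expand_mul, coeff_one] at h4
  rw [map_sub, coeff_one]
  simpa [hp0] using h4

theorem coeff_one_expOf {K : Type*} [Field K] [CharZero K] {f : K⟦X⟧} (hf : constantCoeff f = 0) :
    coeff 1 (expOf f) = coeff 1 f := by
  have := congrArg (coeff 1) (theta_expOf hf)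
  rw [coeff_theta, coeff_mul] at this
  simpa [Finset.Nat.antidiagonal_succ, coeff_theta, coeff_zero_expOf hf, hf,
    coeff_zero_theta] using this

theorem two_mul_coeff_two_expOf {K : Type*} [Field K] [CharZero K] {f : K⟦X⟧}
    (hf : constantCoeff f = 0) :
    2 * coeff 2 (expOf f) = 2 * coeff 2 f + coeff 1 f ^ 2 := by
  have := congrArg (coeff 2) (theta_expOf hf)
  rw [coeff_theta, coeff_mul, Finset.Nat.sum_antidiagonal_eq_sum_range_succ
    (fun i j => coeff i (expOf f) * coeff j (theta f)), Finset.sum_range_succ,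
    Finset.sum_range_succ, Finset.sum_range_one] at this
  simp only [coeff_theta, coeff_zero_expOf hf, coeff_one_expOf hf] at this
  push_cast at this
  linear_combination this

theorem IsFrobeniusSequence.norm_coeff_sub_le {g : ℕ → ℚ_[p]⟦X⟧} (h : IsFrobeniusSequence g)
    (hp2 : p ≠ 2) (hQ : IsPadicIntegral (expOf (g 0))) :
    ‖coeff 1 (g 0) - coeff 1 (g 1)‖ ≤ (p : ℝ)⁻¹ ∧ ‖coeff 2 (g 0) - coeff 2 (g 1)‖ ≤ (p : ℝ)⁻¹ := by
  have hs := h.isSmall_expOf_sub hQ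
  have h0 : constantCoeff (g 0 - g 1) = 0 := by rw [map_sub, h.zero, h.zero, sub_zero]
  have h1 := hs 1
  rw [map_sub, coeff_one_expOf h0, coeff_one, if_neg one_ne_zero, sub_zero, map_sub] at h1
  have h2 := hs 2
  rw [map_sub, coeff_one, if_neg two_ne_zero, sub_zero] at h2
  refine ⟨h1, ?_⟩
  have n2 : ‖(2 : ℚ_[p])‖ = 1 := by
    have : ‖((2 : ℕ) : ℤ_[p])‖ = 1 := PadicInt.norm_natCast_eq_one_iff.2
      ((Nat.coprime_primes hp.out Nat.prime_two).2 hp2)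
    exact_mod_cast this
  have e := two_mul_coeff_two_expOf h0
  rw [map_sub, map_sub] at e
  have h3 : ‖2 * (coeff 2 (g 0) - coeff 2 (g 1))‖ ≤ (p : ℝ)⁻¹ := by
    rw [eq_sub_of_add_eq e.symm]
    refine padic_norm_sub_le ?_ ?_
    · rwa [norm_mul, n2, one_mul]
    · rw [norm_pow, sq]
      calc _ ≤ 1 * (p : ℝ)⁻¹ := mul_le_mul (h1.trans inv_prime_le_one) h1 (norm_nonneg _) zero_le_one
        _ = _ := one_mul _
  rwa [norm_mul, n2, one_mul] at h3

end Frobenius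

/-! ### The hypergeometric equation at its logarithmic singularity -/

section Hypergeometric

open PowerSeries

variable {K : Type*} [Field K]

/-- The hypergeometric series `₂F₁(a, b; 1; X)`. -/
def hypF (a b : K) : K⟦X⟧ := PowerSeries.mk fun n => pochRatio a n * pochRatio b n

/-- The series `G` for which `F log X + G`, with `F = ₂F₁(a, b; 1; X)`, is the second solution of
the hypergeometric equation, normalised by `G(0) = 0`. -/
def hypG (a b : K) : K⟦X⟧ :=
  PowerSeries.mk fun n => pochRatio a n * pochRatio b n * (pochLog a n + pochLog b n)

/-- The quotient `G / F`; the series `X exp (G / F)` is the canonical coordinate. -/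
def hypLog (a b : K) : K⟦X⟧ := hypG a b * (hypF a b)⁻¹

/-- The geometric series `1 / (1 - X)`. -/
def geomSeries (K : Type*) [Field K] : K⟦X⟧ := PowerSeries.mk 1

theorem geomSeries_mul : geomSeries K * (1 - X) = 1 := by
  exact PowerSeries.mk_one_mul_one_sub_eq_one K

theorem X_mul_geomSeries : X * geomSeries K = geomSeries K - 1 := by
  linear_combination -geomSeries_mul (K := K)

theorem coeff_zero_geomSeries : coeff 0 (geomSeries K) = 1 := by simp [geomSeries]

theorem one_sub_X_ne_zero : (1 - X : K⟦X⟧) ≠ 0 := fun h => by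
  have := geomSeries_mul (K := K)
  rw [h, mul_zero] at this
  exact zero_ne_one this

theorem theta_geomSeries : theta (geomSeries K) = geomSeries K ^ 2 - geomSeries K := by
  have h := congrArg theta (geomSeries_mul (K := K))
  rw [theta_mul, theta_sub, theta_one, theta_X] at h
  apply mul_right_cancel₀ (one_sub_X_ne_zero (K := K))
  linear_combination h - geomSeries K * geomSeries_mul (K := K)

theorem constantCoeff_geomSeries : constantCoeff (geomSeries K) = 1 := by
  rw [← coeff_zero_eq_constantCoeff_apply, coeff_zero_geomSeries]

theorem constantCoeff_theta (f : K⟦X⟧) : constantCoeff (theta f) = 0 := by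
  rw [← coeff_zero_eq_constantCoeff_apply, coeff_theta]; simp

theorem coeff_zero_hypF (a b : K) : coeff 0 (hypF a b) = 1 := by simp [hypF, pochRatio]

theorem coeff_zero_hypG (a b : K) : coeff 0 (hypG a b) = 0 := by simp [hypG, pochLog]

theorem hypF_mul_inv (a b : K) : hypF a b * (hypF a b)⁻¹ = 1 :=
  PowerSeries.mul_inv_cancel _ (by
    rw [← coeff_zero_eq_constantCoeff_apply, coeff_zero_hypF]; exact one_ne_zero)

theorem hypF_ne_zero (a b : K) : hypF a b ≠ 0 := fun h => by
  have := hypF_mul_inv a b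
  rw [h, zero_mul] at this
  exact zero_ne_one this

theorem hypLog_mul_hypF (a b : K) : hypLog a b * hypF a b = hypG a b := by
  unfold hypLog
  linear_combination hypG a b * hypF_mul_inv a b

theorem constantCoeff_hypLog (a b : K) : constantCoeff (hypLog a b) = 0 := by
  have h := congrArg (coeff 0) (hypLog_mul_hypF a b)
  rwa [coeff_zero_mul', coeff_zero_hypF, coeff_zero_hypG, mul_one,
    coeff_zero_eq_constantCoeff_apply] at h

variable [CharZero K]

theorem pochRatio_succ (a : K) (n : ℕ) :
    ((n : K) + 1) * pochRatio a (n + 1) = (a + n) * pochRatio a n := by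
  unfold pochRatio
  rw [Finset.prod_range_succ]
  have := one_add_natCast_ne_zero (K := K) n
  field_simp
  ring

omit [CharZero K] in
theorem pochLog_succ (a : K) (n : ℕ) :
    pochLog a (n + 1) = pochLog a n + ((a + n)⁻¹ - (1 + (n : K))⁻¹) := by
  unfold pochLog
  rw [Finset.sum_range_succ]

theorem theta_theta_hypF (a b : K) :
    theta (theta (hypF a b)) =
      (geomSeries K - 1) * (C (a + b) * theta (hypF a b) + C (a * b) * hypF a b) := by
  generalize hσ : a + b = σ
  have h : (1 - X) * theta (theta (hypF a b)) =
      X * (C σ * theta (hypF a b) + C (a * b) * hypF a b) := by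
    have : theta (theta (hypF a b)) = X * (theta (theta (hypF a b)) +
        C σ * theta (hypF a b) + C (a * b) * hypF a b) := by
      ext n
      cases n with
      | zero => simp [coeff_theta]
      | succ n =>
        rw [coeff_succ_X_mul]
        simp only [map_add, coeff_theta, coeff_C_mul, hypF, coeff_mk]
        have h1 := pochRatio_succ a n
        have h2 := pochRatio_succ b n
        push_cast
        rw [← hσ]
        linear_combination ((n : K) + 1) * pochRatio b (n + 1) * h1 + (a + n) * pochRatio a n * h2
    linear_combination this
  linear_combination (geomSeries K) * h - theta (theta (hypF a b)) * geomSeries_mul (K := K) +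
    (C σ * theta (hypF a b) + C (a * b) * hypF a b) * X_mul_geomSeries (K := K)

theorem theta_theta_hypG {a b : K} (ha : ∀ n : ℕ, a + n ≠ 0) (hb : ∀ n : ℕ, b + n ≠ 0) :
    theta (theta (hypG a b)) = -2 * theta (hypF a b) + (geomSeries K - 1) *
      (C (a + b) * hypF a b + C (a + b) * theta (hypG a b) + C (a * b) * hypG a b) := by
  generalize hσ : a + b = σ
  have h : (1 - X) * (theta (theta (hypG a b)) + 2 * theta (hypF a b)) =
      X * (C σ * hypF a b + C σ * theta (hypG a b) + C (a * b) * hypG a b) := by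
    have : theta (theta (hypG a b)) + C 2 * theta (hypF a b) =
        X * (C 2 * theta (hypF a b) + C σ * hypF a b + theta (theta (hypG a b)) +
        C σ * theta (hypG a b) + C (a * b) * hypG a b) := by
      ext n
      cases n with
      | zero => simp [constantCoeff_theta]
      | succ n =>
        rw [coeff_succ_X_mul]
        simp only [map_add, coeff_theta, coeff_C_mul, hypF, hypG, coeff_mk, pochLog_succ]
        have h1 := pochRatio_succ a n
        have h2 := pochRatio_succ b n
        have e : ((n : K) + 1) * ((n : K) + 1) * (pochRatio a (n + 1) * pochRatio b (n + 1)) =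
            (a + n) * (b + n) * (pochRatio a n * pochRatio b n) := by
          linear_combination ((n : K) + 1) * pochRatio b (n + 1) * h1 + (a + n) * pochRatio a n * h2
        have hn := one_add_natCast_ne_zero (K := K) n
        have hA := ha n
        have hB := hb n
        have e1 : (n : K) + 1 ≠ 0 := by rwa [add_comm]
        have e' : pochRatio a (n + 1) * pochRatio b (n + 1) =
            (a + n) * (b + n) * (pochRatio a n * pochRatio b n) / ((n + 1) * (n + 1)) := by
          rw [← e]; field_simp
        push_cast
        rw [e', ← hσ]
        field_simp
        ring
    have h2 : (C 2 : K⟦X⟧) = 2 := map_ofNat C 2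
    rw [h2] at this
    linear_combination this
  linear_combination (geomSeries K) * h -
    (theta (theta (hypG a b)) + 2 * theta (hypF a b)) * geomSeries_mul (K := K) +
    (C σ * hypF a b + C σ * theta (hypG a b) + C (a * b) * hypG a b) *
      X_mul_geomSeries (K := K)

/-- The logarithmic derivative `X F' / F` of the hypergeometric series. -/
def hypDlog (a b : K) : K⟦X⟧ := theta (hypF a b) * (hypF a b)⁻¹

omit [CharZero K] in
theorem hypDlog_mul (a b : K) : hypDlog a b * hypF a b = theta (hypF a b) := by
  unfold hypDlog
  linear_combination theta (hypF a b) * hypF_mul_inv a b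

omit [CharZero K] in
theorem coeff_zero_hypDlog (a b : K) : coeff 0 (hypDlog a b) = 0 := by
  unfold hypDlog
  rw [coeff_zero_mul', coeff_theta]; simp

/-- The Riccati equation of `X F' / F`. -/
theorem theta_hypDlog (a b : K) : theta (hypDlog a b) =
    (geomSeries K - 1) * (C (a + b) * hypDlog a b + C (a * b)) - hypDlog a b ^ 2 := by
  have h1 := congrArg theta (hypDlog_mul a b)
  rw [theta_mul, theta_theta_hypF, ← hypDlog_mul] at h1
  apply mul_right_cancel₀ (hypF_ne_zero a b)
  linear_combination h1

/-- The logarithmic derivative of the canonical coordinate. Multiplied by `F²` it is the Wronskian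
of the hypergeometric equation, whence the differential equation. -/
theorem theta_one_add_theta_hypLog {a b : K} (ha : ∀ n : ℕ, a + n ≠ 0) (hb : ∀ n : ℕ, b + n ≠ 0) :
    theta (1 + theta (hypLog a b)) = (1 + theta (hypLog a b)) *
      (C (a + b) * (geomSeries K - 1) - 2 * hypDlog a b) := by
  set F := hypF a b
  set G := hypG a b
  set g := hypLog a b
  have hG : g * F = G := hypLog_mul_hypF a b
  have hG1 : theta g * F + g * theta F = theta G := by rw [← hG, theta_mul]
  have hΦ : hypDlog a b * F = theta F := hypDlog_mul a b
  have hW : F ^ 2 * (1 + theta g) = F ^ 2 + F * theta G - G * theta F := by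
    rw [← hG1, ← hG]; ring
  have hW1 := congrArg theta hW
  have hsq : theta (F ^ 2) = 2 * (F * theta F) := by rw [sq, theta_mul]; ring
  rw [theta_mul, theta_sub, theta_add, theta_add, theta_one, theta_mul F (theta G), theta_mul G (theta F), hsq,
    theta_theta_hypF, theta_theta_hypG ha hb] at hW1
  apply mul_left_cancel₀ (pow_ne_zero 2 (hypF_ne_zero a b))
  rw [theta_add, theta_one]
  linear_combination hW1 - C (a + b) * (geomSeries K - 1) * hW +
    2 * F * (1 + theta g) * hΦ

/-- Euler's transformation `F(a, b) = (1 - X) ^ (1 - a - b) F(1 - a, 1 - b)`, in terms of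
logarithmic derivatives. -/
theorem hypDlog_one_sub (a b : K) : hypDlog (1 - a) (1 - b) =
    hypDlog a b + C (1 - a - b) * (geomSeries K - 1) := by
  set Φ := hypDlog a b with hΦ
  set Ψ := hypDlog (1 - a) (1 - b) with hΨ
  have h1 := theta_hypDlog a b
  have h2 := theta_hypDlog (1 - a) (1 - b)
  rw [← hΦ] at h1
  rw [← hΨ] at h2
  have h3 := theta_geomSeries (K := K)
  have hΦ0 : constantCoeff Φ = 0 := by
    rw [← coeff_zero_eq_constantCoeff_apply]; exact coeff_zero_hypDlog a b
  have hΨ0 : constantCoeff Ψ = 0 := by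
    rw [← coeff_zero_eq_constantCoeff_apply]; exact coeff_zero_hypDlog _ _
  refine sub_eq_zero.1 (eq_zero_of_theta_eq_mul
    (L := C (2 - a - b) * (geomSeries K - 1) -
      (Ψ + Φ + C (1 - a - b) * (geomSeries K - 1))) ?_ ?_ ?_)
  · rw [coeff_zero_eq_constantCoeff_apply]
    simp only [map_sub, map_add, map_mul, constantCoeff_geomSeries, hΦ0, hΨ0, map_one, sub_self,
      mul_zero, add_zero]
  · rw [coeff_zero_eq_constantCoeff_apply]
    simp only [map_sub, map_add, map_mul, constantCoeff_geomSeries, hΦ0, hΨ0, map_one, sub_self,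
      mul_zero, add_zero]
  · rw [theta_sub, theta_add, theta_mul, theta_sub, theta_C, theta_one, h1, h2, h3]
    simp only [map_sub, map_add, map_mul, map_one, map_ofNat]
    ring

/-- The canonical coordinate is invariant under `(a, b) ↦ (1 - a, 1 - b)`. -/
theorem hypLog_one_sub {a b : K} (ha : ∀ n : ℕ, a + n ≠ 0) (hb : ∀ n : ℕ, b + n ≠ 0)
    (ha' : ∀ n : ℕ, 1 - a + n ≠ 0) (hb' : ∀ n : ℕ, 1 - b + n ≠ 0) :
    hypLog (1 - a) (1 - b) = hypLog a b := by
  have h1 := theta_one_add_theta_hypLog ha hb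
  have h2 := theta_one_add_theta_hypLog ha' hb'
  have e : C (1 - a + (1 - b)) * (geomSeries K - 1) - 2 * hypDlog (1 - a) (1 - b) =
      C (a + b) * (geomSeries K - 1) - 2 * hypDlog a b := by
    rw [hypDlog_one_sub]
    simp only [map_sub, map_add, map_one]
    ring
  rw [e] at h2
  have h0 : coeff 0 (C (a + b) * (geomSeries K - 1) - 2 * hypDlog a b) = 0 := by
    rw [map_sub, coeff_C_mul, map_sub, coeff_zero_geomSeries, coeff_zero_mul', coeff_zero_hypDlog]
    simp
  have h3 := eq_of_theta_eq_mul h0 (by simp [constantCoeff_theta]) h2 h1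
  refine eq_of_theta_eq ?_ (add_left_cancel h3)
  rw [coeff_zero_eq_constantCoeff_apply, coeff_zero_eq_constantCoeff_apply, constantCoeff_hypLog,
    constantCoeff_hypLog]

omit [CharZero K] in
theorem hypLog_comm (a b : K) : hypLog a b = hypLog b a := by
  have h1 : hypF a b = hypF b a := by ext n; simp [hypF, mul_comm]
  have h2 : hypG a b = hypG b a := by ext n; simp [hypG, mul_comm, add_comm]
  unfold hypLog
  rw [h1, h2]

theorem coeff_one_hypLog {a b : K} (ha : ∀ n : ℕ, a + n ≠ 0) (hb : ∀ n : ℕ, b + n ≠ 0) :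
    coeff 1 (hypLog a b) = a + b - 2 * a * b := by
  have h := congrArg (coeff 1) (hypLog_mul_hypF a b)
  have h0 := constantCoeff_hypLog a b
  rw [coeff_mul, Finset.Nat.sum_antidiagonal_eq_sum_range_succ
    (fun i j => coeff i (hypLog a b) * coeff j (hypF a b)), Finset.sum_range_succ,
    Finset.sum_range_one, coeff_zero_eq_constantCoeff_apply, h0, Nat.sub_self,
    coeff_zero_hypF] at h
  have hA : a ≠ 0 := by simpa using ha 0
  have hB : b ≠ 0 := by simpa using hb 0
  rw [zero_mul, zero_add, mul_one] at h
  rw [h]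
  simp [hypG, pochRatio, pochLog]
  field_simp
  ring

theorem four_mul_coeff_two_hypLog {a b : K} (ha : ∀ n : ℕ, a + n ≠ 0) (hb : ∀ n : ℕ, b + n ≠ 0) :
    4 * coeff 2 (hypLog a b) = coeff 1 (hypLog a b) * (coeff 1 (hypLog a b) + 1) +
      a * b * (1 - coeff 1 (hypLog a b) - a * b) := by
  have h := congrArg (coeff 2) (hypLog_mul_hypF a b)
  have h0 := constantCoeff_hypLog a b
  have h1 := coeff_one_hypLog ha hb
  rw [coeff_mul, Finset.Nat.sum_antidiagonal_eq_sum_range_succ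
    (fun i j => coeff i (hypLog a b) * coeff j (hypF a b)), Finset.sum_range_succ,
    Finset.sum_range_succ, Finset.sum_range_one, coeff_zero_eq_constantCoeff_apply, h0,
    Nat.sub_self, coeff_zero_hypF, h1] at h
  have hA : a ≠ 0 := by simpa using ha 0
  have hB : b ≠ 0 := by simpa using hb 0
  have hA1 : a + 1 ≠ 0 := by simpa using ha 1
  have hB1 : b + 1 ≠ 0 := by simpa using hb 1
  rw [zero_mul, zero_add, mul_one] at h
  rw [h1, eq_sub_of_add_eq' h]
  simp [hypF, hypG, pochRatio, pochLog, Finset.prod_range_succ, Finset.sum_range_succ]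
  field_simp
  ring

/-- The first two coefficients of the canonical coordinate determine `(1 - a - b)²`. -/
theorem one_sub_sq_eq {a b : K} (ha : ∀ n : ℕ, a + n ≠ 0) (hb : ∀ n : ℕ, b + n ≠ 0) :
    (1 - a - b) ^ 2 = (1 - coeff 1 (hypLog a b)) ^ 2 - 4 * (4 * coeff 2 (hypLog a b) -
      coeff 1 (hypLog a b) * (coeff 1 (hypLog a b) + 1)) := by
  rw [four_mul_coeff_two_hypLog ha hb, coeff_one_hypLog ha hb]
  ring

/-- The first coefficient then determines `(a - b)²`. -/
theorem sub_sq_eq {a b : K} (ha : ∀ n : ℕ, a + n ≠ 0) (hb : ∀ n : ℕ, b + n ≠ 0) :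
    (a - b) ^ 2 = (1 - a - b) ^ 2 - 1 + 2 * coeff 1 (hypLog a b) := by
  rw [coeff_one_hypLog ha hb]
  ring

omit [CharZero K] in
theorem map_hypLog {L : Type*} [Field L] (φ : K →+* L) (a b : K) :
    PowerSeries.map φ (hypLog a b) = hypLog (φ a) (φ b) := by
  have h1 : PowerSeries.map φ (hypF a b) = hypF (φ a) (φ b) := by
    ext n; simp [hypF, pochRatio, coeff_map]
  have h2 : PowerSeries.map φ (hypG a b) = hypG (φ a) (φ b) := by
    ext n; simp [hypG, pochRatio, pochLog, coeff_map]
  apply mul_right_cancel₀ (hypF_ne_zero (φ a) (φ b))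
  rw [hypLog_mul_hypF, ← h1, ← map_mul, hypLog_mul_hypF, h2]

end Hypergeometric

/-! ### The inverse of the canonical coordinate -/

section Mirror

open PowerSeries

variable {K : Type*} [Field K] [CharZero K]

/-- `h` is the compositional inverse of `s⁻¹ X exp (G / F)`, that is, the expansion `z(q)` of the
hypergeometric variable in the scaled canonical coordinate `q`. -/
structure IsMirrorMap (s a b : K) (h : K⟦X⟧) : Prop where
  zero : constantCoeff h = 0
  subst_eq : (C s⁻¹ * X * expOf (hypLog a b)).subst h = X

theorem exists_isMirrorMap {s : K} (hs : s ≠ 0) (a b : K) : ∃ h, IsMirrorMap s a b h := by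
  set R : K⟦X⟧ := C s⁻¹ * X * expOf (hypLog a b) with hR
  have h0 : constantCoeff R = 0 := by simp [hR]
  have h1 : coeff 1 R = s⁻¹ := by
    rw [hR, mul_assoc, coeff_C_mul, show (1 : ℕ) = 0 + 1 from rfl, coeff_succ_X_mul,
      coeff_zero_expOf (constantCoeff_hypLog a b), mul_one]
  have hu : IsUnit (coeff 1 R) := by rw [h1]; exact (inv_ne_zero hs).isUnit
  exact ⟨R.substInvOfIsUnit hu, constantCoeff_substInvOfIsUnit R hu,
    subst_substInvOfIsUnit_right R h0 hu⟩

theorem IsMirrorMap.map {L : Type*} [Field L] [CharZero L] (φ : K →+* L) {s a b : K} {h : K⟦X⟧}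
    (hh : IsMirrorMap s a b h) : IsMirrorMap (φ s) (φ a) (φ b) (PowerSeries.map φ h) where
  zero := by
    rw [← coeff_zero_eq_constantCoeff_apply, coeff_map, coeff_zero_eq_constantCoeff_apply, hh.zero,
      map_zero]
  subst_eq := by
    have e := congrArg (PowerSeries.map φ) hh.subst_eq
    have e2 : PowerSeries.map φ (C s⁻¹ * X * expOf (hypLog a b)) =
        C (φ s)⁻¹ * X * expOf (hypLog (φ a) (φ b)) := by
      rw [map_mul, map_mul, map_C, map_X, map_expOf φ (constantCoeff_hypLog a b), map_hypLog,
        map_inv₀]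
    rw [map_X] at e
    rw [← e2]
    exact (PowerSeries.map_subst (HasSubst.of_constantCoeff_zero' hh.zero) _).symm.trans e

/-- The series `q / z(q)`, up to the scale `s`. -/
def mirrorUnit (a b : K) (h : K⟦X⟧) : K⟦X⟧ := (expOf (hypLog a b)).subst h

theorem IsMirrorMap.mul_mirrorUnit {s a b : K} (hs : s ≠ 0) {h : K⟦X⟧} (hh : IsMirrorMap s a b h) :
    h * mirrorUnit a b h = C s * X := by
  have hS := HasSubst.of_constantCoeff_zero' hh.zero
  have e := hh.subst_eq
  rw [subst_mul hS, subst_mul hS, subst_X hS] at e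
  have e2 : (C s⁻¹ : K⟦X⟧).subst h = C s⁻¹ := subst_C _
  rw [e2] at e
  have e3 : (C s * C s⁻¹ : K⟦X⟧) = 1 := by rw [← map_mul, mul_inv_cancel₀ hs, map_one]
  unfold mirrorUnit
  linear_combination C s * e - h * subst h (expOf (hypLog a b)) * e3

theorem IsMirrorMap.coeff_zero_mirrorUnit {s a b : K} {h : K⟦X⟧} (hh : IsMirrorMap s a b h) :
    coeff 0 (mirrorUnit a b h) = 1 := by
  unfold mirrorUnit
  rw [coeff_zero_subst hh.zero, coeff_zero_expOf (constantCoeff_hypLog a b)]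

theorem IsMirrorMap.coeff_one {s a b : K} (hs : s ≠ 0) {h : K⟦X⟧} (hh : IsMirrorMap s a b h) :
    coeff 1 h = s := by
  have e := congrArg (coeff 1) (hh.mul_mirrorUnit hs)
  rw [coeff_mul, Finset.Nat.sum_antidiagonal_eq_sum_range_succ
    (fun i j => coeff i h * coeff j (mirrorUnit a b h)), Finset.sum_range_succ,
    Finset.sum_range_one, Nat.sub_self, hh.coeff_zero_mirrorUnit,
    coeff_zero_eq_constantCoeff_apply, hh.zero, coeff_C_mul, coeff_one_X] at e
  simpa using e

theorem IsMirrorMap.map_mirrorUnit {L : Type*} [Field L] [CharZero L] (φ : K →+* L) {s a b : K}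
    {h : K⟦X⟧} (hh : IsMirrorMap s a b h) :
    PowerSeries.map φ (mirrorUnit a b h) = mirrorUnit (φ a) (φ b) (PowerSeries.map φ h) := by
  unfold mirrorUnit
  rw [← map_hypLog, ← map_expOf φ (constantCoeff_hypLog a b)]
  exact PowerSeries.map_subst (HasSubst.of_constantCoeff_zero' hh.zero) _

/-- The logarithmic derivative `(X d/dX z) / z` as a series in `z`. -/
def mirrorSpeed (a b : K) : K⟦X⟧ := (1 + theta (hypLog a b))⁻¹

theorem mirrorSpeed_mul (a b : K) : (1 + theta (hypLog a b)) * mirrorSpeed a b = 1 :=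
  PowerSeries.mul_inv_cancel _ (by
    rw [map_add, constantCoeff_theta]; simp)

theorem coeff_zero_mirrorSpeed (a b : K) : coeff 0 (mirrorSpeed a b) = 1 := by
  have := congrArg (coeff 0) (mirrorSpeed_mul a b)
  rw [coeff_zero_mul', map_add, coeff_zero_theta, coeff_zero_one, add_zero, one_mul] at this
  exact this

/-- The derivation `q d/dq`, applied to `z = h(q)`, in terms of `z`. -/
theorem IsMirrorMap.theta_eq {s a b : K} {h : K⟦X⟧} (hh : IsMirrorMap s a b h) :
    theta h = h * (mirrorSpeed a b).subst h := by
  have hS := HasSubst.of_constantCoeff_zero' hh.zero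
  set Q := expOf (hypLog a b) with hQ
  set R : K⟦X⟧ := C s⁻¹ * X * Q with hR
  have hθR : theta R = R * (1 + theta (hypLog a b)) := by
    rw [hR, theta_mul, theta_mul, theta_C, theta_X, hQ, theta_expOf (constantCoeff_hypLog a b)]
    ring
  have h1 := congrArg (fun f => f.subst h) hθR
  rw [subst_mul hS R, hh.subst_eq] at h1
  have h2 : (theta R).subst h = h * (derivative K R).subst h := by
    unfold theta
    rw [subst_mul hS, subst_X hS]
  have h3 := congrArg (derivative K) hh.subst_eq
  rw [derivative_subst hS, derivative_X] at h3
  have h4 := congrArg (fun f => f.subst h) (mirrorSpeed_mul a b)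
  rw [subst_mul hS] at h4
  have e1 : (1 : K⟦X⟧).subst h = 1 := by
    rw [← coe_substAlgHom hS, map_one]
  rw [e1] at h4
  set w := (1 + theta (hypLog a b)).subst h
  set ω := (mirrorSpeed a b).subst h
  rw [h2] at h1
  have hX : (X : K⟦X⟧) ≠ 0 := X_ne_zero
  apply mul_left_cancel₀ hX
  unfold theta
  linear_combination (-(X * ω) * derivative K h) * h1 + (h * ω * X) * h3 -
    X * X * derivative K h * h4

theorem theta_mirrorSpeed {a b : K} (ha : ∀ n : ℕ, a + n ≠ 0) (hb : ∀ n : ℕ, b + n ≠ 0) :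
    theta (mirrorSpeed a b) = mirrorSpeed a b *
      (2 * hypDlog a b - C (a + b) * (geomSeries K - 1)) := by
  have h1 := mirrorSpeed_mul a b
  have h2 := congrArg theta h1
  rw [theta_mul, theta_one, theta_one_add_theta_hypLog ha hb] at h2
  set w := 1 + theta (hypLog a b)
  linear_combination mirrorSpeed a b * h2 - theta (mirrorSpeed a b) * h1 -
    mirrorSpeed a b * (C (a + b) * (geomSeries K - 1) - 2 * hypDlog a b) * h1

end Mirror

/-! ### Solutions of the Halphen system -/

section Halphen

open PowerSeries

/-- The initial value problem for the Halphen system with `c = 1 - a`, where the scale of `q` is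
fixed by the first coefficient `s` of `t₃ - t₁`. -/
structure HalphenIVP (a b s : ℂ) (t : SeriesTriple) : Prop where
  solves : SolvesHalphen a b (1 - a) t
  t₁_zero : coeff 0 t.t₁ = 0
  t₂_zero : coeff 0 t.t₂ = -1
  t₃_zero : coeff 0 t.t₃ = 0
  scale : coeff 1 (t.t₃ - t.t₁) = s

theorem qDeriv_eq_theta (f : ℂ⟦X⟧) : qDeriv f = theta f := rfl

theorem coeff_one_mul' {K : Type*} [Field K] (f g : K⟦X⟧) :
    coeff 1 (f * g) = coeff 0 f * coeff 1 g + coeff 1 f * coeff 0 g := by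
  rw [coeff_mul, Finset.Nat.sum_antidiagonal_eq_sum_range_succ
    (fun i j => coeff i f * coeff j g), Finset.sum_range_succ, Finset.sum_range_one]

/-- The first coefficients of the Halphen system tie `t₂` to the scale. -/
theorem SolvesHalphen.coeff_one_t₂ {a b : ℂ} {t : SeriesTriple} (h : SolvesHalphen a b (1 - a) t)
    (h1 : coeff 0 t.t₁ = 0) (h2 : coeff 0 t.t₂ = -1) (h3 : coeff 0 t.t₃ = 0) :
    coeff 1 t.t₂ = (1 - b) * (2 * a - 1) * coeff 1 (t.t₃ - t.t₁) := by
  obtain ⟨e1, e2, e3⟩ := h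
  have f1 := congrArg (coeff 1) e1
  have f2 := congrArg (coeff 1) e2
  have f3 := congrArg (coeff 1) e3
  simp only [qDeriv_eq_theta, coeff_theta, map_add, map_sub, coeff_smul, sq, coeff_one_mul', h1, h2,
    h3, smul_eq_mul] at f1 f2 f3
  rw [map_sub]
  push_cast at f1 f2 f3
  linear_combination f2 - (b - 1) * f1 - (b - 1) * f3

/-- The recursion for the coefficients at `qⁿ` is invertible for `n > 1`, and for `n = 1` it leaves
exactly the coefficient of `t₃ - t₁` free. -/
theorem HalphenIVP.unique {a b s : ℂ} {t t' : SeriesTriple} (h : HalphenIVP a b s t)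
    (h' : HalphenIVP a b s t') : t = t' := by
  have key : ∀ n, coeff n t.t₁ = coeff n t'.t₁ ∧ coeff n t.t₂ = coeff n t'.t₂ ∧
      coeff n t.t₃ = coeff n t'.t₃ := by
    intro n
    induction n using Nat.strong_induction_on with
    | _ n ih =>
      rcases Nat.eq_zero_or_pos n with rfl | hn
      · rw [h.t₁_zero, h'.t₁_zero, h.t₂_zero, h'.t₂_zero, h.t₃_zero, h'.t₃_zero]
        exact ⟨rfl, rfl, rfl⟩
      have i1 : ∀ i < n, coeff i t.t₁ = coeff i t'.t₁ := fun i hi => (ih i hi).1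
      have i2 : ∀ i < n, coeff i t.t₂ = coeff i t'.t₂ := fun i hi => (ih i hi).2.1
      have i3 : ∀ i < n, coeff i t.t₃ = coeff i t'.t₃ := fun i hi => (ih i hi).2.2
      have m12 := coeff_mul_sub_of_agree hn i1 i2
      have m21 := coeff_mul_sub_of_agree hn i2 i1
      have m13 := coeff_mul_sub_of_agree hn i1 i3
      have m31 := coeff_mul_sub_of_agree hn i3 i1
      have m23 := coeff_mul_sub_of_agree hn i2 i3
      have m32 := coeff_mul_sub_of_agree hn i3 i2
      have m11 := coeff_mul_sub_of_agree hn i1 i1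
      have m22 := coeff_mul_sub_of_agree hn i2 i2
      have m33 := coeff_mul_sub_of_agree hn i3 i3
      rw [h.t₁_zero, h.t₂_zero] at m12 m21
      rw [h.t₁_zero, h.t₃_zero] at m13 m31
      rw [h.t₂_zero, h.t₃_zero] at m23 m32
      rw [h.t₁_zero] at m11
      rw [h.t₂_zero] at m22
      rw [h.t₃_zero] at m33
      obtain ⟨e1, e2, e3⟩ := h.solves
      obtain ⟨e1', e2', e3'⟩ := h'.solves
      have f1 := congrArg (coeff n) e1
      have f2 := congrArg (coeff n) e2
      have f3 := congrArg (coeff n) e3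
      have f1' := congrArg (coeff n) e1'
      have f2' := congrArg (coeff n) e2'
      have f3' := congrArg (coeff n) e3'
      simp only [qDeriv_eq_theta, coeff_theta, map_add, map_sub, coeff_smul, sq, smul_eq_mul]
        at f1 f2 f3 f1' f2' f3'
      have hn0 : (n : ℂ) ≠ 0 := by exact_mod_cast hn.ne'
      set d1 := coeff n t.t₁ - coeff n t'.t₁ with hd1
      set d2 := coeff n t.t₂ - coeff n t'.t₂ with hd2
      set d3 := coeff n t.t₃ - coeff n t'.t₃ with hd3
      have g1 : n * d1 = (a - 1) * (-d1 + d3) := by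
        rw [hd1]
        linear_combination f1 - f1' + (a - 1) * (m12 + m13 - m23) + (b - a) * m11
      have g2 : n * d2 = (b - 1) * (-d1 - d3) := by
        rw [hd2]
        linear_combination f2 - f2' + (b - 1) * (m21 + m23 - m13)
      have g3 : n * d3 = a * (d3 - d1) := by
        rw [hd3]
        linear_combination f3 - f3' - a * (m31 + m32 - m12) + (a + b - 1) * m33
      have hd : d3 = d1 := by
        by_cases h1 : n = 1
        · subst h1
          have s1 := h.scale
          have s2 := h'.scale
          rw [map_sub] at s1 s2
          linear_combination s1 - s2
        · have : ((n : ℂ) - 1) * (d3 - d1) = 0 := by linear_combination g3 - g1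
          have hne : (n : ℂ) - 1 ≠ 0 := fun h0 => h1 (by exact_mod_cast sub_eq_zero.1 h0)
          exact sub_eq_zero.1 ((mul_eq_zero.1 this).resolve_left hne)
      have z1 : d1 = 0 := by
        rw [hd, neg_add_cancel, mul_zero] at g1
        exact (mul_eq_zero.1 g1).resolve_left hn0
      have z3 : d3 = 0 := by rw [hd, z1]
      have z2 : d2 = 0 := by
        rw [z1, z3, neg_zero, sub_zero, mul_zero] at g2
        exact (mul_eq_zero.1 g2).resolve_left hn0
      exact ⟨sub_eq_zero.1 z1, sub_eq_zero.1 z2, sub_eq_zero.1 z3⟩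
  ext n
  · exact (key n).1
  · exact (key n).2.1
  · exact (key n).2.2

/-- The first component of the solution as a series in the hypergeometric variable `z`. The factor
`(1 - b)⁻¹` is meaningful because `b ≠ 1` for the parameters in question. -/
def halphenZ₁ (a b : ℂ) : ℂ⟦X⟧ :=
  -(mirrorSpeed a b * C (1 - b)⁻¹ * (hypDlog a b + C (1 - a - b) * (geomSeries ℂ - 1)))

/-- The solution of the Halphen system as a triple of series in the hypergeometric variable `z`,
composed with `z = h(q)`. -/
def halphenSolution (a b : ℂ) (h : ℂ⟦X⟧) : SeriesTriple where
  t₁ := (halphenZ₁ a b).subst h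
  t₂ := (halphenZ₁ a b - mirrorSpeed a b).subst h
  t₃ := (halphenZ₁ a b + mirrorSpeed a b * (geomSeries ℂ - 1)).subst h

/-- The Halphen system in the variable `z`, where `q d/dq` becomes `mirrorSpeed a b` times
`z d/dz`. -/
theorem halphenZ_system {a b : ℂ} (ha : ∀ n : ℕ, a + n ≠ 0) (hb : ∀ n : ℕ, b + n ≠ 0)
    (hb1 : 1 - b ≠ 0) {T₁ T₂ T₃ : ℂ⟦X⟧} (h1 : T₁ = halphenZ₁ a b)
    (h2 : T₂ = halphenZ₁ a b - mirrorSpeed a b)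
    (h3 : T₃ = halphenZ₁ a b + mirrorSpeed a b * (geomSeries ℂ - 1)) :
    theta T₁ * mirrorSpeed a b =
      C (a - 1) * (T₁ * T₂ + T₁ * T₃ - T₂ * T₃) + C (b + (1 - a) - 1) * T₁ ^ 2 ∧
    theta T₂ * mirrorSpeed a b =
      C (b - 1) * (T₂ * T₁ + T₂ * T₃ - T₁ * T₃) + C (a + (1 - a) - 1) * T₂ ^ 2 ∧
    theta T₃ * mirrorSpeed a b =
      C (1 - a - 1) * (T₃ * T₁ + T₃ * T₂ - T₁ * T₂) + C (a + b - 1) * T₃ ^ 2 := by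
  have hω := theta_mirrorSpeed ha hb
  have hΦ := theta_hypDlog a b
  have hy := theta_geomSeries (K := ℂ)
  have hβ : (C (1 - b)⁻¹ : ℂ⟦X⟧) * (1 - C b) = 1 := by
    rw [← map_one C, ← map_sub, ← map_mul, inv_mul_cancel₀ hb1]
  have hZ : theta (halphenZ₁ a b) = -(theta (mirrorSpeed a b) * C (1 - b)⁻¹ *
      (hypDlog a b + C (1 - a - b) * (geomSeries ℂ - 1)) + mirrorSpeed a b * C (1 - b)⁻¹ *
      (theta (hypDlog a b) + C (1 - a - b) * theta (geomSeries ℂ))) := by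
    have : halphenZ₁ a b = 0 - mirrorSpeed a b * C (1 - b)⁻¹ *
        (hypDlog a b + C (1 - a - b) * (geomSeries ℂ - 1)) := by unfold halphenZ₁; ring
    have h0 : theta (0 : ℂ⟦X⟧) = 0 := by simpa using theta_C (0 : ℂ)
    rw [this, theta_sub, h0, theta_mul, theta_mul, theta_add, theta_mul (C (1 - a - b)), theta_sub,
      theta_C, theta_C, theta_one]
    ring
  rw [h1, h2, h3, theta_sub, theta_add, theta_mul, theta_sub, theta_one, hZ, hω, hΦ, hy]
  unfold halphenZ₁
  simp only [map_add, map_sub, map_mul, map_one]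
  generalize mirrorSpeed a b = ω at *
  generalize hypDlog a b = Φ at *
  generalize geomSeries ℂ = y at *
  generalize (C (1 - b)⁻¹ : ℂ⟦X⟧) = β at *
  generalize (C a : ℂ⟦X⟧) = A at *
  generalize (C b : ℂ⟦X⟧) = B at *
  set N := Φ + (1 - A - B) * (y - 1) with hN
  refine ⟨?_, ?_, ?_⟩
  · linear_combination (ω ^ 2 * β * N ^ 2 - ω ^ 2 * (1 - A) * (y - 1)) * hβ
  · linear_combination (ω ^ 2 * (2 * N + β * N ^ 2 - (1 - A) * (y - 1))) * hβ
  · linear_combination (ω ^ 2 * (β * N ^ 2 - 2 * N * (y - 1) - (1 - A) * (y - 1))) * hβ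

theorem halphenSolution_solves {a b s : ℂ} (ha : ∀ n : ℕ, a + n ≠ 0) (hb : ∀ n : ℕ, b + n ≠ 0)
    (hb1 : 1 - b ≠ 0) {h : ℂ⟦X⟧} (hh : IsMirrorMap s a b h) :
    SolvesHalphen a b (1 - a) (halphenSolution a b h) := by
  have hS := HasSubst.of_constantCoeff_zero' hh.zero
  obtain ⟨e1, e2, e3⟩ := halphenZ_system ha hb hb1 rfl rfl rfl
  have conv : ∀ T : ℂ⟦X⟧, qDeriv (T.subst h) = (theta T * mirrorSpeed a b).subst h := fun T => by
    rw [qDeriv_eq_theta, theta_subst hh.zero hh.theta_eq, subst_mul hS]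
  have hC : ∀ x : ℂ, (C x : ℂ⟦X⟧).subst h = C x := fun x => subst_C _
  refine ⟨?_, ?_, ?_⟩ <;> simp only [halphenSolution] <;> rw [conv]
  · rw [e1]
    simp only [subst_add hS, subst_mul hS, subst_sub hS, subst_pow hS, hC, smul_eq_C_mul]
  · rw [e2]
    simp only [subst_add hS, subst_mul hS, subst_sub hS, subst_pow hS, hC, smul_eq_C_mul]
  · rw [e3]
    simp only [subst_add hS, subst_mul hS, subst_sub hS, subst_pow hS, hC, smul_eq_C_mul]

theorem coeff_zero_halphenZ₁ (a b : ℂ) : coeff 0 (halphenZ₁ a b) = 0 := by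
  have h0 : constantCoeff (hypDlog a b) = 0 := by
    rw [← coeff_zero_eq_constantCoeff_apply]; exact coeff_zero_hypDlog a b
  simp only [coeff_zero_eq_constantCoeff_apply, halphenZ₁, map_neg, map_mul, map_add,
    map_sub (constantCoeff (R := ℂ)), constantCoeff_geomSeries, h0, map_one, sub_self, mul_zero,
    add_zero, neg_zero]

theorem halphenSolution_t₃_sub_t₁ (a b : ℂ) {s : ℂ} {h : ℂ⟦X⟧} (hh : IsMirrorMap s a b h) :
    (halphenSolution a b h).t₃ - (halphenSolution a b h).t₁ =
      h * (mirrorSpeed a b * geomSeries ℂ).subst h := by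
  have hS := HasSubst.of_constantCoeff_zero' hh.zero
  simp only [halphenSolution]
  rw [← subst_sub hS, add_sub_cancel_left, ← X_mul_geomSeries]
  rw [show mirrorSpeed a b * (X * geomSeries ℂ) = X * (mirrorSpeed a b * geomSeries ℂ) by ring,
    subst_mul hS X, subst_X hS]

theorem halphenSolution_t₃_sub_t₂ (a b : ℂ) {s : ℂ} {h : ℂ⟦X⟧} (hh : IsMirrorMap s a b h) :
    (halphenSolution a b h).t₃ - (halphenSolution a b h).t₂ =
      (mirrorSpeed a b * geomSeries ℂ).subst h := by
  have hS := HasSubst.of_constantCoeff_zero' hh.zero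
  simp only [halphenSolution]
  rw [← subst_sub hS]
  congr 1
  ring

theorem halphenIVP_halphenSolution {a b s : ℂ} (hs : s ≠ 0) (ha : ∀ n : ℕ, a + n ≠ 0)
    (hb : ∀ n : ℕ, b + n ≠ 0) (hb1 : 1 - b ≠ 0) {h : ℂ⟦X⟧} (hh : IsMirrorMap s a b h) :
    HalphenIVP a b s (halphenSolution a b h) where
  solves := halphenSolution_solves ha hb hb1 hh
  t₁_zero := by
    simp only [halphenSolution]
    rw [coeff_zero_subst hh.zero, coeff_zero_halphenZ₁]
  t₂_zero := by
    simp only [halphenSolution]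
    rw [coeff_zero_subst hh.zero, map_sub, coeff_zero_halphenZ₁, coeff_zero_mirrorSpeed, zero_sub]
  t₃_zero := by
    simp only [halphenSolution]
    rw [coeff_zero_subst hh.zero, map_add, coeff_zero_halphenZ₁, coeff_zero_mul', map_sub,
      coeff_zero_geomSeries, coeff_zero_one, sub_self, mul_zero, add_zero]
  scale := by
    have h0 : coeff 0 h = 0 := by rw [coeff_zero_eq_constantCoeff_apply]; exact hh.zero
    rw [halphenSolution_t₃_sub_t₁ a b hh, coeff_one_mul', h0, zero_mul, zero_add,
      coeff_zero_subst hh.zero, coeff_zero_mul', coeff_zero_mirrorSpeed, coeff_zero_geomSeries,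
      hh.coeff_one hs, mul_one, mul_one]

/-- The coefficients of the Hauptmodul `1 / z(q)`. -/
theorem coeff_hauptmodul_halphenSolution {a b s : ℂ} (hs : s ≠ 0) {h : ℂ⟦X⟧}
    (hh : IsMirrorMap s a b h) (n : ℤ) :
    (hauptmodul (halphenSolution a b h)).coeff n =
      s⁻¹ * if n + 1 < 0 then 0 else coeff (n + 1).natAbs (mirrorUnit a b h) := by
  set N := (mirrorSpeed a b * geomSeries ℂ).subst h with hN
  set V := mirrorUnit a b h with hV
  have hN0 : N ≠ 0 := fun h0 => by
    have : coeff 0 N = 1 := by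
      rw [hN, coeff_zero_subst hh.zero, coeff_zero_mul', coeff_zero_mirrorSpeed,
        coeff_zero_geomSeries, mul_one]
    rw [h0, map_zero] at this
    exact zero_ne_one this
  have hh0 : h ≠ 0 := fun h0 => by
    have := hh.coeff_one hs
    rw [h0, map_zero] at this
    exact hs this.symm
  have hinj : Function.Injective (HahnSeries.ofPowerSeries ℤ ℂ) :=
    HahnSeries.ofPowerSeries_injective
  have hD : HahnSeries.ofPowerSeries ℤ ℂ (h * N) ≠ 0 := by
    rw [Ne, map_eq_zero_iff _ hinj]
    exact mul_ne_zero hh0 hN0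
  have hJ : hauptmodul (halphenSolution a b h) =
      HahnSeries.ofPowerSeries ℤ ℂ N / HahnSeries.ofPowerSeries ℤ ℂ (h * N) := by
    unfold hauptmodul
    rw [halphenSolution_t₃_sub_t₁ a b hh, halphenSolution_t₃_sub_t₂ a b hh]
  have key : hauptmodul (halphenSolution a b h) * HahnSeries.ofPowerSeries ℤ ℂ (C s * X) =
      HahnSeries.ofPowerSeries ℤ ℂ V := by
    rw [hJ, div_mul_eq_mul_div, div_eq_iff hD, ← map_mul, ← map_mul, ← hh.mul_mirrorUnit hs]
    congr 1
    ring
  have hc := congrArg (fun f : LaurentSeries ℂ => f.coeff (n + 1)) key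
  have e1 : HahnSeries.ofPowerSeries ℤ ℂ (C s * X) = HahnSeries.single 1 s := by
    rw [map_mul, HahnSeries.ofPowerSeries_C, HahnSeries.ofPowerSeries_X, HahnSeries.C_apply,
      HahnSeries.single_mul_single, zero_add, mul_one]
  rw [e1, HahnSeries.coeff_mul_single_add] at hc
  have e2 : (HahnSeries.ofPowerSeries ℤ ℂ V).coeff (n + 1) =
      if n + 1 < 0 then 0 else coeff (n + 1).natAbs V := PowerSeries.coeff_coe V (n + 1)
  rw [e2] at hc
  rw [← hc]
  field_simp

end Halphen

/-! ### The Frobenius congruence for hypergeometric logarithms -/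

section HypergeometricFrobenius

open PowerSeries

variable {p : ℕ} [hp : Fact p.Prime]

/-- Only the coefficients of `f` at indices congruent to `v` modulo `p` contribute. -/
theorem coeff_mul_expand {K : Type*} [CommRing K] (f g : K⟦X⟧) {v : ℕ} (hv : v < p) (N : ℕ) :
    coeff (v + p * N) (f * expand p hp.out.ne_zero g) =
      ∑ j ∈ range (N + 1), coeff (v + p * j) f * coeff (N - j) g := by
  have hp0 := hp.out.pos
  rw [mul_comm f, coeff_mul, Finset.Nat.sum_antidiagonal_eq_sum_range_succ
    (fun i j => coeff i (expand p hp.out.ne_zero g) * coeff j f)]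
  rw [← Finset.sum_range_reflect (fun j => coeff (v + p * j) f * coeff (N - j) g)]
  have hinj : Set.InjOn (fun j => p * j) (range (N + 1) : Set ℕ) :=
    fun a _ b _ h => Nat.eq_of_mul_eq_mul_left hp0 h
  have hsub : (range (N + 1)).image (fun j => p * j) ⊆ range (v + p * N).succ := by
    intro i hi
    obtain ⟨j, hj, rfl⟩ := mem_image.1 hi
    rw [mem_range] at *
    have := Nat.mul_le_mul_left p (Nat.lt_succ_iff.1 hj)
    omega
  rw [← Finset.sum_subset hsub, Finset.sum_image hinj]
  · refine Finset.sum_congr rfl fun j hj => ?_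
    rw [mem_range] at hj
    have hj' : N + 1 - 1 - j = N - j := by omega
    have h2 : p * N = p * j + p * (N - j) := by rw [← mul_add]; congr 1; omega
    have h3 : N - (N - j) = j := by omega
    rw [hj', coeff_expand_mul, h3, mul_comm]
    congr 2
    congr 1
    omega
  · intro i hi hni
    rw [coeff_expand, if_neg, zero_mul]
    rintro ⟨j, rfl⟩
    rw [mem_range] at hi
    apply hni
    refine mem_image.2 ⟨j, mem_range.2 ?_, rfl⟩
    have h1 : p * j < p * (N + 1) := by rw [mul_add, mul_one]; omega
    exact Nat.lt_of_mul_lt_mul_left h1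

/-- Dwork's congruence `p G₀(X) / F₀(X) ≡ G₁(Xᵖ) / F₁(Xᵖ)` modulo `p`, for the two solutions of
the hypergeometric equation and for its image under Dwork's map. -/
theorem isFrobeniusSequence_hypLog {x y : ℕ → ℤ_[p]} {k l : ℕ → ℕ} (hx : IsDworkOrbit x k)
    (hy : IsDworkOrbit y l) :
    IsFrobeniusSequence (fun i => hypLog (x i : ℚ_[p]) (y i : ℚ_[p])) where
  zero i := constantCoeff_hypLog _ _
  congr i := by
    have hA := hx.isDworkSystem.mul hy.isDworkSystem
    have hH := hx.isDworkLog.mul hy.isDworkLog hx.isDworkSystem.norm_le hy.isDworkSystem.norm_le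
    have hF : ∀ i, IsPadicIntegral (hypF (x i : ℚ_[p]) (y i : ℚ_[p])) := fun i n => by
      rw [hypF, coeff_mk]; exact hA.norm_le i n
    set F₀ := hypF (x i : ℚ_[p]) (y i : ℚ_[p]) with hF₀
    set F₁ := hypF (x (i + 1) : ℚ_[p]) (y (i + 1) : ℚ_[p]) with hF₁
    set G₀ := hypG (x i : ℚ_[p]) (y i : ℚ_[p]) with hG₀
    set G₁ := hypG (x (i + 1) : ℚ_[p]) (y (i + 1) : ℚ_[p]) with hG₁
    have hp0 := hp.out.ne_zero
    have hs : IsSmall ((p : ℚ_[p]⟦X⟧) * G₀ * expand p hp0 F₁ - F₀ * expand p hp0 G₁) := by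
      intro n
      have hv := Nat.mod_lt n hp.out.pos
      have hc := hA.log_congruence hH i (n % p) (n / p) hv
      rw [← Nat.mod_add_div n p, map_sub, coeff_mul_expand _ _ hv, coeff_mul_expand _ _ hv,
        ← Finset.sum_sub_distrib]
      refine le_of_eq_of_le ?_ hc
      congr 1
      refine Finset.sum_congr rfl fun j _ => ?_
      rw [natCast_mul_eq_C, coeff_C_mul, hF₀, hF₁, hG₀, hG₁]
      simp only [hypF, hypG, coeff_mk]
      ring
    set L₀ := hypLog (x i : ℚ_[p]) (y i : ℚ_[p])
    set L₁ := hypLog (x (i + 1) : ℚ_[p]) (y (i + 1) : ℚ_[p])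
    have i0 : F₀ * F₀⁻¹ = 1 := hypF_mul_inv _ _
    have i1 : F₁ * F₁⁻¹ = 1 := hypF_mul_inv _ _
    have q0 : IsPadicIntegral F₀⁻¹ := (hF i).inv (coeff_zero_hypF _ _) i0
    have q1 : IsPadicIntegral (expand p hp0 F₁⁻¹) :=
      ((hF (i + 1)).inv (coeff_zero_hypF _ _) i1).expand p hp0
    have e0 : L₀ * F₀ = G₀ := hypLog_mul_hypF _ _
    have e1 : L₁ * F₁ = G₁ := hypLog_mul_hypF _ _
    have i1' : expand p hp0 F₁ * expand p hp0 F₁⁻¹ = 1 := by rw [← map_mul, i1, map_one]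
    have e1' : expand p hp0 L₁ * expand p hp0 F₁ = expand p hp0 G₁ := by rw [← map_mul, e1]
    have main : (p : ℚ_[p]⟦X⟧) * L₀ - expand p hp0 L₁ =
        ((p : ℚ_[p]⟦X⟧) * G₀ * expand p hp0 F₁ - F₀ * expand p hp0 G₁) *
          (F₀⁻¹ * expand p hp0 F₁⁻¹) := by
      linear_combination (p : ℚ_[p]⟦X⟧) * expand p hp0 F₁ * F₀⁻¹ * expand p hp0 F₁⁻¹ * e0 -
        F₀ * F₀⁻¹ * expand p hp0 F₁⁻¹ * e1' - ((p : ℚ_[p]⟦X⟧) * L₀ - expand p hp0 L₁) *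
          (expand p hp0 F₁ * expand p hp0 F₁⁻¹ * i0 + i1')
    have := hs.mul (q0.mul q1)
    rw [← main] at this
    exact this

end HypergeometricFrobenius

/-! ### Rational orbits of Dwork's map -/

section Residues

variable {p : ℕ} [hp : Fact p.Prime]

/-- The numerator of the `i`-th image of `r / D` under Dwork's map: the representative of `r / pⁱ`
modulo `D` between `0` and `D - 1`. -/
def dworkResidue (p D r i : ℕ) : ℕ := ((r : ZMod D) * ((p : ZMod D)⁻¹) ^ i).val

/-- The fraction `r / D` as a `p`-adic integer, for `D` prime to `p`. -/
def padicFrac (p : ℕ) [Fact p.Prime] (D r : ℕ) : ℤ_[p] := r * (D : ℤ_[p]).inv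

theorem coe_padicFrac {D : ℕ} (hD : p.Coprime D) (r : ℕ) :
    ((padicFrac p D r : ℤ_[p]) : ℚ_[p]) = r / D := by
  have h1 : ‖(D : ℤ_[p])‖ = 1 := PadicInt.norm_natCast_eq_one_iff.2 hD
  have h2 := congrArg (fun y : ℤ_[p] => (y : ℚ_[p])) (PadicInt.mul_inv h1)
  push_cast at h2
  have h0 : (D : ℚ_[p]) ≠ 0 := fun h0 => by rw [h0, zero_mul] at h2; exact zero_ne_one h2
  rw [padicFrac, eq_div_iff h0]
  push_cast
  linear_combination (r : ℚ_[p]) * h2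

variable {D : ℕ}

omit hp in
theorem natCast_dworkResidue [NeZero D] (r i : ℕ) :
    ((dworkResidue p D r i : ℕ) : ZMod D) = (r : ZMod D) * ((p : ZMod D)⁻¹) ^ i := by
  rw [dworkResidue, ZMod.natCast_zmod_val]

omit hp in
theorem dworkResidue_lt [NeZero D] (r i : ℕ) : dworkResidue p D r i < D := ZMod.val_lt _

omit hp in
theorem dworkResidue_zero {r : ℕ} (hr : r < D) : dworkResidue p D r 0 = r := by
  rw [dworkResidue, pow_zero, mul_one, ZMod.val_cast_of_lt hr]

omit hp in
theorem mul_dworkResidue_succ [NeZero D] (hD : p.Coprime D) (r i : ℕ) :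
    p * dworkResidue p D r (i + 1) ≡ dworkResidue p D r i [MOD D] := by
  rw [← ZMod.natCast_eq_natCast_iff, Nat.cast_mul, natCast_dworkResidue, natCast_dworkResidue,
    pow_succ]
  linear_combination (r : ZMod D) * (p : ZMod D)⁻¹ ^ i * ZMod.coe_mul_inv_eq_one p hD

omit hp in
theorem dworkResidue_pos [NeZero D] (hD : p.Coprime D) {r : ℕ} (hr0 : 0 < r) (hr : r < D) (i : ℕ) :
    0 < dworkResidue p D r i := by
  induction i with
  | zero => rwa [dworkResidue_zero hr]
  | succ i ih =>
    refine Nat.pos_of_ne_zero fun h0 => ?_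
    have := mul_dworkResidue_succ hD r i
    rw [h0, mul_zero] at this
    have h2 := Nat.eq_of_dvd_of_lt_two_mul ih.ne' ((Nat.modEq_zero_iff_dvd).1 this.symm)
      (by have := dworkResidue_lt (p := p) (D := D) r i; omega)
    exact (dworkResidue_lt (p := p) (D := D) r i).ne h2

omit hp in
/-- The orbits are purely periodic. -/
theorem dworkResidue_totient (hD : p.Coprime D) (r : ℕ) :
    dworkResidue p D r (Nat.totient D) = dworkResidue p D r 0 := by
  have h := ZMod.pow_totient (ZMod.unitOfCoprime p hD)
  have h2 : (p : ZMod D) ^ Nat.totient D = 1 := by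
    have := congrArg Units.val h
    rwa [Units.val_pow_eq_pow_val, ZMod.coe_unitOfCoprime, Units.val_one] at this
  have h3 : ((p : ZMod D)⁻¹) ^ Nat.totient D = 1 := by
    have := congrArg (· ^ Nat.totient D) (ZMod.coe_mul_inv_eq_one p hD)
    simpa [mul_pow, h2] using this
  rw [dworkResidue, dworkResidue, h3, pow_zero]

omit hp in
theorem eq_dworkResidue_one (hD : p.Coprime D) {r r' : ℕ} (hr' : r' < D)
    (h : p * r' ≡ r [MOD D]) : dworkResidue p D r 1 = r' := by
  have h1 := (ZMod.natCast_eq_natCast_iff _ _ _).2 h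
  rw [Nat.cast_mul] at h1
  have h2 : ((r : ZMod D) * ((p : ZMod D)⁻¹) ^ 1) = r' := by
    rw [← h1, pow_one]
    linear_combination (r' : ZMod D) * ZMod.coe_mul_inv_eq_one p hD
  rw [dworkResidue, h2, ZMod.val_cast_of_lt hr']

theorem isDworkOrbit_padicFrac [NeZero D] (hD : p.Coprime D) {r : ℕ} (hr0 : 0 < r) (hr : r < D) :
    IsDworkOrbit (fun i => padicFrac p D (dworkResidue p D r i))
      (fun i => p * dworkResidue p D r (i + 1) / D) where
  prime i := by
    have hl := dworkResidue_lt (p := p) (D := D) r i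
    have hl' := dworkResidue_lt (p := p) (D := D) r (i + 1)
    have hm : p * dworkResidue p D r (i + 1) % D = dworkResidue p D r i :=
      Eq.trans (mul_dworkResidue_succ hD r i) (Nat.mod_eq_of_lt hl)
    refine ⟨?_, ?_⟩
    · rw [Nat.div_lt_iff_lt_mul (Nat.pos_of_ne_zero (NeZero.ne D))]
      exact Nat.mul_lt_mul_of_pos_left hl' hp.out.pos
    · have hdm := Nat.mod_add_div (p * dworkResidue p D r (i + 1)) D
      rw [hm] at hdm
      have hdm' := congrArg (Nat.cast : ℕ → ℤ_[p]) hdm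
      push_cast at hdm'
      have h1 : ‖(D : ℤ_[p])‖ = 1 := PadicInt.norm_natCast_eq_one_iff.2 hD
      have h2 := PadicInt.mul_inv h1
      simp only [padicFrac]
      linear_combination -(D : ℤ_[p]).inv * hdm' +
        ((p * dworkResidue p D r (i + 1) / D : ℕ) : ℤ_[p]) * h2
  ne i n := by
    rw [coe_padicFrac hD]
    have hD0 : (D : ℚ_[p]) ≠ 0 := by exact_mod_cast NeZero.ne D
    intro h0
    rw [div_add' _ _ _ hD0, div_eq_zero_iff, or_iff_left hD0] at h0
    have hpos := dworkResidue_pos hD hr0 hr i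
    have : dworkResidue p D r i + n * D = 0 := by exact_mod_cast h0
    omega

end Residues

/-! ### Integrality of the inverse of the canonical coordinate -/

section Integrality

open PowerSeries

theorem natCast_div_add_ne_zero {K : Type*} [Field K] [CharZero K] {D r : ℕ} (hr0 : 0 < r)
    (hr : r < D) (n : ℕ) : (r : K) / D + n ≠ 0 := by
  have hD0 : (D : K) ≠ 0 := by exact_mod_cast (hr0.trans hr).ne'
  intro h0
  rw [div_add' _ _ _ hD0, div_eq_zero_iff, or_iff_left hD0] at h0
  have : r + n * D = 0 := by exact_mod_cast h0
  omega

variable {p : ℕ} [hp : Fact p.Prime]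

/-- The pair `exp (G / F)` and `q / z(q)` for a scale that is a `p`-adic unit. -/
theorem IsMirrorMap.isInverseScale {s a b : ℚ_[p]} {h : ℚ_[p]⟦X⟧} (hh : IsMirrorMap s a b h)
    (hs : ‖s‖ = 1) : IsInverseScale (expOf (hypLog a b)) (mirrorUnit a b h) where
  zero := coeff_zero_expOf (constantCoeff_hypLog a b)
  exists_eq := by
    have hs0 : s ≠ 0 := fun h0 => by rw [h0, norm_zero] at hs; exact zero_ne_one hs
    have hV : mirrorUnit a b h * (mirrorUnit a b h)⁻¹ = 1 := PowerSeries.mul_inv_cancel _ (by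
      rw [← coeff_zero_eq_constantCoeff_apply, hh.coeff_zero_mirrorUnit]; exact one_ne_zero)
    refine ⟨s, (mirrorUnit a b h)⁻¹, hs, hV, ?_⟩
    have : C s * X * (mirrorUnit a b h)⁻¹ = h := by
      rw [← hh.mul_mirrorUnit hs0, mul_assoc, hV, mul_one]
    rw [this, mirrorUnit]

variable {D ra rb : ℕ}

/-- The hypergeometric logarithms along the orbits of `ra / D` and `rb / D` under Dwork's map. -/
def dworkHypLog (p : ℕ) [Fact p.Prime] (D ra rb i : ℕ) : ℚ_[p]⟦X⟧ :=
  hypLog ((dworkResidue p D ra i : ℚ_[p]) / D) ((dworkResidue p D rb i : ℚ_[p]) / D)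

theorem dworkHypLog_zero (ha : ra < D) (hb : rb < D) :
    dworkHypLog p D ra rb 0 = hypLog ((ra : ℚ_[p]) / D) ((rb : ℚ_[p]) / D) := by
  rw [dworkHypLog, dworkResidue_zero ha, dworkResidue_zero hb]

theorem isFrobeniusSequence_dworkHypLog (hD : p.Coprime D) (ha0 : 0 < ra) (ha : ra < D)
    (hb0 : 0 < rb) (hb : rb < D) : IsFrobeniusSequence (dworkHypLog p D ra rb) := by
  have : NeZero D := ⟨(ha0.trans ha).ne'⟩
  have h := isFrobeniusSequence_hypLog (isDworkOrbit_padicFrac hD ha0 ha)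
    (isDworkOrbit_padicFrac hD hb0 hb)
  simp only [coe_padicFrac hD] at h
  exact h

/-- The hypergeometric logarithm is unchanged by Dwork's map if the latter permutes the parameters,
or replaces them by their complements to `1`. -/
theorem dworkHypLog_one_eq (ha0 : 0 < ra) (ha : ra < D) (hb0 : 0 < rb)
    (hb : rb < D)
    (h : (dworkResidue p D ra 1 = ra ∧ dworkResidue p D rb 1 = rb) ∨
      (dworkResidue p D ra 1 = rb ∧ dworkResidue p D rb 1 = ra) ∨
      (dworkResidue p D ra 1 + ra = D ∧ dworkResidue p D rb 1 + rb = D) ∨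
      (dworkResidue p D ra 1 + rb = D ∧ dworkResidue p D rb 1 + ra = D)) :
    dworkHypLog p D ra rb 1 = dworkHypLog p D ra rb 0 := by
  have hD0 : (D : ℚ_[p]) ≠ 0 := by exact_mod_cast (ha0.trans ha).ne'
  have hc : ∀ r r' : ℕ, r' + r = D → (r' : ℚ_[p]) / D = 1 - (r : ℚ_[p]) / D := fun r r' h => by
    rw [eq_sub_iff_add_eq, ← add_div, div_eq_one_iff_eq hD0]
    exact_mod_cast h
  have hn : ∀ r : ℕ, 0 < r → r < D → ∀ n : ℕ, 1 - (r : ℚ_[p]) / D + n ≠ 0 := fun r h0 h1 n => by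
    rw [← hc r (D - r) (by omega)]
    exact natCast_div_add_ne_zero (by omega) (by omega) n
  have key := hypLog_one_sub (natCast_div_add_ne_zero (K := ℚ_[p]) ha0 ha)
    (natCast_div_add_ne_zero hb0 hb) (hn ra ha0 ha) (hn rb hb0 hb)
  rw [dworkHypLog_zero ha hb, dworkHypLog]
  rcases h with ⟨h1, h2⟩ | ⟨h1, h2⟩ | ⟨h1, h2⟩ | ⟨h1, h2⟩
  · rw [h1, h2]
  · rw [h1, h2, hypLog_comm]
  · rw [hc _ _ h1, hc _ _ h2, key]
  · rw [hc _ _ h1, hc _ _ h2, hypLog_comm, key]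

theorem dvd_of_norm_intCast_le {z : ℤ} (hz : ‖(z : ℚ_[p])‖ ≤ (p : ℝ)⁻¹) : (p : ℤ) ∣ z := by
  have := (Padic.norm_int_le_pow_iff_dvd (p := p) z 1).1 (by simpa using hz)
  simpa using this

/-- If `exp (G / F)` is integral, then Dwork's map preserves the squared exponent differences
modulo `p`, at `1` and at infinity. The common factor `D²` clears the denominators. -/
theorem dvd_sq_sub_sq_of_isPadicIntegral (hp2 : p ≠ 2) (hD : p.Coprime D) (ha0 : 0 < ra)
    (ha : ra < D) (hb0 : 0 < rb) (hb : rb < D)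
    (hQ : IsPadicIntegral (expOf (dworkHypLog p D ra rb 0))) :
    (p : ℤ) ∣ ((D : ℤ) - ra - rb) ^ 2 -
        ((D : ℤ) - dworkResidue p D ra 1 - dworkResidue p D rb 1) ^ 2 ∧
      (p : ℤ) ∣ ((ra : ℤ) - rb) ^ 2 - ((dworkResidue p D ra 1 : ℤ) - dworkResidue p D rb 1) ^ 2 := by
  have : NeZero D := ⟨(ha0.trans ha).ne'⟩
  obtain ⟨n1, n2⟩ := (isFrobeniusSequence_dworkHypLog hD ha0 ha hb0 hb).norm_coeff_sub_le hp2 hQ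
  have hD0 : (D : ℚ_[p]) ≠ 0 := by exact_mod_cast NeZero.ne D
  have ha1 := dworkResidue_pos hD ha0 ha 1
  have hb1 := dworkResidue_pos hD hb0 hb 1
  have ha1' := dworkResidue_lt (p := p) (D := D) ra 1
  have hb1' := dworkResidue_lt (p := p) (D := D) rb 1
  rw [dworkHypLog_zero ha hb, dworkHypLog] at n1 n2
  generalize dworkResidue p D ra 1 = ra' at *
  generalize dworkResidue p D rb 1 = rb' at *
  have e1 := one_sub_sq_eq (natCast_div_add_ne_zero (K := ℚ_[p]) ha0 ha)
    (natCast_div_add_ne_zero hb0 hb)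
  have e1' := one_sub_sq_eq (natCast_div_add_ne_zero (K := ℚ_[p]) ha1 ha1')
    (natCast_div_add_ne_zero hb1 hb1')
  have e2 := sub_sq_eq (natCast_div_add_ne_zero (K := ℚ_[p]) ha0 ha)
    (natCast_div_add_ne_zero hb0 hb)
  have e2' := sub_sq_eq (natCast_div_add_ne_zero (K := ℚ_[p]) ha1 ha1')
    (natCast_div_add_ne_zero hb1 hb1')
  have i0 : ∀ r r' : ℕ, 0 < r → r < D → 0 < r' → r' < D → ∃ z : ℤ_[p],
      coeff 1 (hypLog ((r : ℚ_[p]) / D) ((r' : ℚ_[p]) / D)) = z := fun r r' h1 h2 h3 h4 => by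
    refine ⟨padicFrac p D r + padicFrac p D r' - 2 * padicFrac p D r * padicFrac p D r', ?_⟩
    rw [coeff_one_hypLog (natCast_div_add_ne_zero h1 h2) (natCast_div_add_ne_zero h3 h4)]
    have c2 : ((2 : ℤ_[p]) : ℚ_[p]) = 2 := by norm_cast
    push_cast [coe_padicFrac hD, c2]
    rfl
  obtain ⟨z, hz⟩ := i0 ra rb ha0 ha hb0 hb
  obtain ⟨z', hz'⟩ := i0 ra' rb' ha1 ha1' hb1 hb1'
  rw [hz, hz'] at n1
  rw [hz] at e1 e2
  rw [hz'] at e1' e2'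
  generalize coeff 2 (hypLog ((ra : ℚ_[p]) / D) ((rb : ℚ_[p]) / D)) = g at *
  generalize coeff 2 (hypLog ((ra' : ℚ_[p]) / D) ((rb' : ℚ_[p]) / D)) = g' at *
  have small_mul : ∀ (w : ℤ_[p]) {y : ℚ_[p]}, ‖y‖ ≤ (p : ℝ)⁻¹ → ‖(w : ℚ_[p]) * y‖ ≤ (p : ℝ)⁻¹ :=
    fun w y hy => by
      rw [norm_mul]
      calc _ ≤ 1 * (p : ℝ)⁻¹ := mul_le_mul (PadicInt.norm_le_one w) hy (norm_nonneg _) zero_le_one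
        _ = _ := one_mul _
  have c2 : ((2 : ℤ_[p]) : ℚ_[p]) = 2 := by norm_cast
  have c16 : ((16 : ℤ_[p]) : ℚ_[p]) = 16 := by norm_cast
  have s1 := padic_norm_sub_le (small_mul (D ^ 2 * (5 * z + 5 * z' + 2)) n1)
    (small_mul (D ^ 2 * 16) n2)
  have s2 := padic_norm_add_le s1 (small_mul (D ^ 2 * 2) n1)
  have hx : ∀ r : ℕ, (r : ℚ_[p]) / D * D = r := fun r => div_mul_cancel₀ _ hD0
  have ex := hx ra
  have ex' := hx ra'
  have ey := hx rb
  have ey' := hx rb'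
  generalize (ra : ℚ_[p]) / D = x at *
  generalize (ra' : ℚ_[p]) / D = x' at *
  generalize (rb : ℚ_[p]) / D = y at *
  generalize (rb' : ℚ_[p]) / D = y' at *
  constructor
  · apply dvd_of_norm_intCast_le
    push_cast
    rw [← ex, ← ex', ← ey, ← ey']
    convert s1 using 2
    push_cast [c2, c16]
    have c5 : ((5 : ℤ_[p]) : ℚ_[p]) = 5 := by norm_cast
    rw [c5]
    linear_combination (D : ℚ_[p]) ^ 2 * (e1 - e1')
  · apply dvd_of_norm_intCast_le
    push_cast
    rw [← ex, ← ex', ← ey, ← ey']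
    convert s2 using 2
    push_cast [c2, c16]
    have c5 : ((5 : ℤ_[p]) : ℚ_[p]) = 5 := by norm_cast
    rw [c5]
    linear_combination (D : ℚ_[p]) ^ 2 * (e1 - e1' + e2 - e2')

/-- The Hauptmodul has rational coefficients up to a scale. -/
theorem HalphenIVP.exists_rational {s : ℕ} (hs : s ≠ 0) (ha0 : 0 < ra)
    (ha : ra < D) (hb0 : 0 < rb) (hb : rb < D) {t : SeriesTriple}
    (ht : HalphenIVP ((ra : ℂ) / D) ((rb : ℂ) / D) s t) :
    ∃ h : ℚ⟦X⟧, IsMirrorMap (s : ℚ) ((ra : ℚ) / D) ((rb : ℚ) / D) h ∧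
      ∀ n : ℤ, (hauptmodul t).coeff n = (s : ℂ)⁻¹ * if n + 1 < 0 then 0 else
        ((coeff (n + 1).natAbs (mirrorUnit ((ra : ℚ) / D) ((rb : ℚ) / D) h) : ℚ) : ℂ) := by
  have hsQ : (s : ℚ) ≠ 0 := by exact_mod_cast hs
  have hsC : (s : ℂ) ≠ 0 := by exact_mod_cast hs
  obtain ⟨h, hh⟩ := exists_isMirrorMap hsQ ((ra : ℚ) / D) ((rb : ℚ) / D)
  refine ⟨h, hh, fun n => ?_⟩
  have hm := hh.map (algebraMap ℚ ℂ)
  have hV := hh.map_mirrorUnit (algebraMap ℚ ℂ)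
  simp only [map_div₀, map_natCast] at hm hV
  have hb1 : 1 - (rb : ℂ) / D ≠ 0 := by
    have hD0 : (D : ℂ) ≠ 0 := by exact_mod_cast (ha0.trans ha).ne'
    rw [Ne, sub_eq_zero, eq_comm, div_eq_one_iff_eq hD0]
    exact_mod_cast hb.ne
  have hsol := halphenIVP_halphenSolution hsC (natCast_div_add_ne_zero ha0 ha)
    (natCast_div_add_ne_zero hb0 hb) hb1 hm
  rw [ht.unique hsol, coeff_hauptmodul_halphenSolution hsC hm, ← hV]
  congr 1

theorem HalphenIVP.existsUnique {s : ℕ} (hs : s ≠ 0) (ha0 : 0 < ra) (ha : ra < D)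
    (hb0 : 0 < rb) (hb : rb < D) : ∃! t, HalphenIVP ((ra : ℂ) / D) ((rb : ℂ) / D) s t := by
  have hsC : (s : ℂ) ≠ 0 := by exact_mod_cast hs
  have hD0 : (D : ℂ) ≠ 0 := by exact_mod_cast (ha0.trans ha).ne'
  have hb1 : 1 - (rb : ℂ) / D ≠ 0 := by
    rw [Ne, sub_eq_zero, eq_comm, div_eq_one_iff_eq hD0]
    exact_mod_cast hb.ne
  obtain ⟨h, hh⟩ := exists_isMirrorMap hsC ((ra : ℂ) / D) ((rb : ℂ) / D)
  have hsol := halphenIVP_halphenSolution hsC (natCast_div_add_ne_zero ha0 ha)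
    (natCast_div_add_ne_zero hb0 hb) hb1 hh
  exact ⟨_, hsol, fun t ht => ht.unique hsol⟩

/-- The coefficients of the rational series `mirrorUnit`, seen in `ℚ_[p]`. -/
theorem map_mirrorUnit_padic {s : ℕ} {h : ℚ⟦X⟧}
    (hh : IsMirrorMap (s : ℚ) ((ra : ℚ) / D) ((rb : ℚ) / D) h) :
    ∃ h' : ℚ_[p]⟦X⟧, IsMirrorMap (s : ℚ_[p]) ((ra : ℚ_[p]) / D) ((rb : ℚ_[p]) / D) h' ∧
      ∀ n, coeff n (mirrorUnit ((ra : ℚ_[p]) / D) ((rb : ℚ_[p]) / D) h') =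
        ((coeff n (mirrorUnit ((ra : ℚ) / D) ((rb : ℚ) / D) h) : ℚ) : ℚ_[p]) := by
  have hm := hh.map (algebraMap ℚ ℚ_[p])
  have hV := hh.map_mirrorUnit (algebraMap ℚ ℚ_[p])
  simp only [map_div₀, map_natCast] at hm hV
  refine ⟨_, hm, fun n => ?_⟩
  rw [← hV, coeff_map]
  rfl

/-- If the hypergeometric logarithm is invariant under Dwork's map, the Hauptmodul is
`p`-integral. -/
theorem HalphenIVP.isPIntegral {s : ℕ} (hs : p.Coprime s) (hs0 : s ≠ 0) (hD : p.Coprime D)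
    (ha0 : 0 < ra) (ha : ra < D) (hb0 : 0 < rb) (hb : rb < D) {t : SeriesTriple}
    (ht : HalphenIVP ((ra : ℂ) / D) ((rb : ℂ) / D) s t)
    (h : dworkHypLog p D ra rb 1 = dworkHypLog p D ra rb 0) : IsPIntegral p (hauptmodul t) := by
  obtain ⟨f, hf, hJ⟩ := ht.exists_rational hs0 ha0 ha hb0 hb
  obtain ⟨f', hf', hV⟩ := map_mirrorUnit_padic (p := p) hf
  have hsC : (s : ℂ) ≠ 0 := by exact_mod_cast hs0
  have hsn : ‖(s : ℚ_[p])‖ = 1 := by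
    have := PadicInt.norm_natCast_eq_one_iff.2 hs
    exact_mod_cast this
  have hQ := (isFrobeniusSequence_dworkHypLog hD ha0 ha hb0 hb).isPadicIntegral_of_eq h
  rw [dworkHypLog_zero ha hb] at hQ
  have hVi := (hf'.isInverseScale hsn).isPadicIntegral_iff.1 hQ
  refine ⟨s, hsC, fun n => ?_⟩
  rw [hJ, mul_inv_cancel_left₀ hsC]
  split_ifs with hn
  · exact ⟨0, by simp [hp.out.ne_one], by simp⟩
  · refine ⟨_, ?_, rfl⟩
    have h1 := hVi (n + 1).natAbs
    rw [hV] at h1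
    have h2 := PadicInt.isUnit_den _ h1
    have h3 := PadicInt.norm_natCast_eq_one_iff.1 (PadicInt.isUnit_iff.1 h2)
    exact fun hd => hp.out.one_lt.ne' (Nat.Coprime.eq_one_of_dvd h3 hd)

/-- If the Hauptmodul is `p`-integral up to a scale, the canonical coordinate is integral. -/
theorem HalphenIVP.isPadicIntegral_expOf {s : ℕ} (hs : p.Coprime s) (hs0 : s ≠ 0)
    (hD : p.Coprime D) (ha0 : 0 < ra) (ha : ra < D) (hb0 : 0 < rb) (hb : rb < D)
    {t : SeriesTriple} (ht : HalphenIVP ((ra : ℂ) / D) ((rb : ℂ) / D) s t)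
    (h : IsPIntegral p (hauptmodul t)) : IsPadicIntegral (expOf (dworkHypLog p D ra rb 0)) := by
  obtain ⟨f, hf, hJ⟩ := ht.exists_rational hs0 ha0 ha hb0 hb
  obtain ⟨f', hf', hV⟩ := map_mirrorUnit_padic (p := p) hf
  have hsC : (s : ℂ) ≠ 0 := by exact_mod_cast hs0
  have hsn : ‖(s : ℚ_[p])‖ = 1 := by
    have := PadicInt.norm_natCast_eq_one_iff.2 hs
    exact_mod_cast this
  obtain ⟨k, hk, hr⟩ := h
  -- the leading coefficient of `J` shows that the constant is rational up to the scale `s`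
  have hr' : ∀ n : ℕ, ∃ r : ℚ, ¬ p ∣ r.den ∧ k * (s : ℂ)⁻¹ *
      ((coeff n (mirrorUnit ((ra : ℚ) / D) ((rb : ℚ) / D) f) : ℚ) : ℂ) = r := fun n => by
    obtain ⟨r, h1, h2⟩ := hr ((n : ℤ) - 1)
    refine ⟨r, h1, ?_⟩
    rw [← h2, hJ, sub_add_cancel, if_neg (by omega), Int.natAbs_natCast, mul_assoc]
  obtain ⟨r₀, _, h0⟩ := hr' 0
  rw [hf.coeff_zero_mirrorUnit, Rat.cast_one, mul_one] at h0
  have hr0 : r₀ ≠ 0 := fun hz => by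
    rw [hz, Rat.cast_zero] at h0
    exact mul_ne_zero hk (inv_ne_zero hsC) h0
  have hB : ∀ n, ‖coeff n (mirrorUnit ((ra : ℚ_[p]) / D) ((rb : ℚ_[p]) / D) f')‖ ≤
      ‖(r₀ : ℚ_[p])‖⁻¹ := fun n => by
    obtain ⟨r, h1, h2⟩ := hr' n
    rw [h0] at h2
    have h3 : r₀ * coeff n (mirrorUnit ((ra : ℚ) / D) ((rb : ℚ) / D) f) = r := by exact_mod_cast h2
    have h4 := Padic.norm_rat_le_one h1
    rw [← h3, Rat.cast_mul, norm_mul, ← hV] at h4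
    have hpos : 0 < ‖(r₀ : ℚ_[p])‖ := norm_pos_iff.2 (by exact_mod_cast hr0)
    rwa [← one_div, le_div_iff₀' hpos]
  have hper : dworkHypLog p D ra rb (Nat.totient D) = dworkHypLog p D ra rb 0 := by
    rw [dworkHypLog, dworkHypLog, dworkResidue_totient hD, dworkResidue_totient hD]
  have hS := hf'.isInverseScale hsn
  rw [← dworkHypLog_zero ha hb] at hS
  have hVi := (isFrobeniusSequence_dworkHypLog hD ha0 ha hb0 hb).isPadicIntegral_of_bounded
    (Nat.totient_pos.2 (ha0.trans ha)).ne' hper hS hB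
  exact hS.isPadicIntegral_iff.2 hVi

end Integrality

/-! ### Congruences -/

/-- An integer small against the prime `p` whose square is `1` modulo `p`, up to a factor prime to
`p`, is `1` or `-1`. -/
theorem eq_one_or_neg_one_of_dvd {p : ℕ} (hp : p.Prime) {c d X : ℤ} (hc : ¬ (p : ℤ) ∣ c)
    (hd : |X| < d) (hdp : d < p) (h : (p : ℤ) ∣ c * (1 - X ^ 2)) : X = 1 ∨ X = -1 := by
  have hp' := Nat.prime_iff_prime_int.1 hp
  have hX := abs_lt.1 hd
  have h1 := (hp'.dvd_or_dvd h).resolve_left hc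
  rw [show 1 - X ^ 2 = (1 - X) * (1 + X) by ring] at h1
  rcases hp'.dvd_or_dvd h1 with h2 | h2
  · have := Int.eq_zero_of_abs_lt_dvd h2 (abs_lt.2 (by constructor <;> linarith [hX.1, hX.2]))
    left; linarith
  · have := Int.eq_zero_of_abs_lt_dvd h2 (abs_lt.2 (by constructor <;> linarith [hX.1, hX.2]))
    right; linarith

/-- The simultaneous congruences modulo `2 m n` that define Dwork's map on the two numerators, when
it multiplies the exponent differences by the signs `X` and `Y`, in terms of congruences modulo
`2 m` and `2 n`. -/
theorem congruence_iff {P m n X Y : ℤ} (hm : 0 < m) (hn : 0 < n) (hP : Odd P)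
    (hX : X = 1 ∨ X = -1) (hY : Y = 1 ∨ Y = -1) :
    (2 * m * n ∣ P * (m * n - n * X + m * Y) - (m * n - n + m) ∧
      2 * m * n ∣ P * (m * n - n * X - m * Y) - (m * n - n - m)) ↔
    ((P ≡ X [ZMOD 2 * m] ∧ P ≡ Y [ZMOD 2 * n]) ∨
      (P ≡ m + X [ZMOD 2 * m] ∧ P ≡ n + Y [ZMOD 2 * n])) := by
  have hX2 : X * X = 1 := by rcases hX with rfl | rfl <;> norm_num
  have hY2 : Y * Y = 1 := by rcases hY with rfl | rfl <;> norm_num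
  obtain ⟨q, hq⟩ := hP
  constructor
  · rintro ⟨⟨α, hα⟩, ⟨β, hβ⟩⟩
    -- `P X - 1 = m w` and `P Y - 1 = n z` with `w ≡ z` modulo `2`
    have hw : P * X - 1 = m * (2 * q - α - β) := by
      apply mul_left_cancel₀ (by positivity : (2 * n : ℤ) ≠ 0)
      linear_combination 2 * m * n * hq - hα - hβ
    have hz : P * Y - 1 = n * (α - β) := by
      apply mul_left_cancel₀ (by positivity : (2 * m : ℤ) ≠ 0)
      linear_combination hα - hβ
    rcases Int.even_or_odd (α - β) with ⟨δ, hδ⟩ | ⟨δ, hδ⟩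
    · left
      refine ⟨(Int.modEq_iff_dvd.2 ⟨X * (q - δ - β), ?_⟩).symm,
        (Int.modEq_iff_dvd.2 ⟨Y * δ, ?_⟩).symm⟩
      · linear_combination X * hw - P * hX2 - m * X * hδ
      · linear_combination Y * hz - P * hY2 + n * Y * hδ
    · right
      rcases hX with rfl | rfl <;> rcases hY with rfl | rfl
      · refine ⟨(Int.modEq_iff_dvd.2 ⟨q - δ - β - 1, ?_⟩).symm,
          (Int.modEq_iff_dvd.2 ⟨δ, ?_⟩).symm⟩
        · linear_combination hw - m * hδ
        · linear_combination hz + n * hδ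
      · refine ⟨(Int.modEq_iff_dvd.2 ⟨q - δ - β - 1, ?_⟩).symm,
          (Int.modEq_iff_dvd.2 ⟨-δ - 1, ?_⟩).symm⟩
        · linear_combination hw - m * hδ
        · linear_combination -hz - n * hδ
      · refine ⟨(Int.modEq_iff_dvd.2 ⟨-(q - δ - β), ?_⟩).symm,
          (Int.modEq_iff_dvd.2 ⟨δ, ?_⟩).symm⟩
        · linear_combination -hw + m * hδ
        · linear_combination hz + n * hδ
      · refine ⟨(Int.modEq_iff_dvd.2 ⟨-(q - δ - β), ?_⟩).symm,
          (Int.modEq_iff_dvd.2 ⟨-δ - 1, ?_⟩).symm⟩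
        · linear_combination -hw + m * hδ
        · linear_combination -hz - n * hδ
  · rintro (⟨h1, h2⟩ | ⟨h1, h2⟩)
    · obtain ⟨α, hα⟩ := Int.modEq_iff_dvd.1 h1.symm
      obtain ⟨β, hβ⟩ := Int.modEq_iff_dvd.1 h2.symm
      refine ⟨⟨q - α * X + β * Y, ?_⟩, ⟨q - α * X - β * Y, ?_⟩⟩
      · linear_combination m * n * hq - n * X * hα - n * hX2 + m * Y * hβ + m * hY2
      · linear_combination m * n * hq - n * X * hα - n * hX2 - m * Y * hβ - m * hY2
    · obtain ⟨α, hα⟩ := Int.modEq_iff_dvd.1 h1.symm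
      obtain ⟨β, hβ⟩ := Int.modEq_iff_dvd.1 h2.symm
      rcases hX with rfl | rfl <;> rcases hY with rfl | rfl
      · refine ⟨⟨q - α + β, ?_⟩, ⟨q - α - β - 1, ?_⟩⟩
        · linear_combination m * n * hq - n * hα + m * hβ
        · linear_combination m * n * hq - n * hα - m * hβ
      · refine ⟨⟨q - α - β - 1, ?_⟩, ⟨q - α + β, ?_⟩⟩
        · linear_combination m * n * hq - n * hα - m * hβ
        · linear_combination m * n * hq - n * hα + m * hβ
      · refine ⟨⟨q + α + β + 1, ?_⟩, ⟨q + α - β, ?_⟩⟩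
        · linear_combination m * n * hq + n * hα + m * hβ
        · linear_combination m * n * hq + n * hα - m * hβ
      · refine ⟨⟨q + α - β, ?_⟩, ⟨q + α + β + 1, ?_⟩⟩
        · linear_combination m * n * hq + n * hα - m * hβ
        · linear_combination m * n * hq + n * hα + m * hβ

/-! ### Triangle groups with two finite orders -/

/-- With `D = 2 m n`, the parameters are `a = (m n - n + m) / D` and `b = (m n - n - m) / D`. -/
theorem isHalphenSolution_iff {m n ra rb D : ℕ} (hm : 2 ≤ m) (hn : 2 ≤ n) (hra : ra + n = m * n + m)
    (hrb : rb + n + m = m * n) (hD : D = 2 * m * n) (t : SeriesTriple) :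
    IsHalphenSolution m n t ↔
      HalphenIVP ((ra : ℂ) / D) ((rb : ℂ) / D) ((2 * m ^ 2 * n ^ 2 : ℕ) : ℂ) t := by
  have hm0 : (m : ℂ) ≠ 0 := by exact_mod_cast (by omega : m ≠ 0)
  have hn0 : (n : ℂ) ≠ 0 := by exact_mod_cast (by omega : n ≠ 0)
  have hra' : (ra : ℂ) = m * n + m - n := eq_sub_of_add_eq (by exact_mod_cast hra)
  have hrb' : (rb : ℂ) = m * n - n - m := by
    rw [eq_sub_iff_add_eq, eq_sub_iff_add_eq, add_right_comm]; exact_mod_cast hrb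
  have ea : halphenA (1 / m) (1 / n) = (ra : ℂ) / D := by
    rw [halphenA, hra', hD]; push_cast; field_simp; ring
  have eb : halphenB (1 / m) (1 / n) = (rb : ℂ) / D := by
    rw [halphenB, hrb', hD]; push_cast; field_simp
  have ec : halphenC (1 / m) (1 / n) = 1 - (ra : ℂ) / D := by
    rw [← ea, halphenA, halphenC]; ring
  constructor
  · intro h
    refine ⟨?_, h.t₁_zero, h.t₂_zero, h.t₃_zero, ?_⟩
    · have := h.solves
      rwa [ea, eb, ec] at this
    · rw [h.scale]; push_cast; rfl
  · intro h
    refine ⟨?_, h.t₁_zero, h.t₃_zero, h.t₂_zero, ?_, ?_⟩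
    · rw [ea, eb, ec]; exact h.solves
    · rw [h.solves.coeff_one_t₂ h.t₁_zero h.t₂_zero h.t₃_zero, h.scale, hra', hrb', hD]
      push_cast
      field_simp
      ring
    · rw [h.scale]; push_cast; rfl

/-- The signs `X` and `Y` say how Dwork's map acts on the exponent differences `1 / m` and `1 / n`. -/
theorem HalphenIVP.isPIntegral_iff_finite {m n p ra rb D : ℕ} (hm : 2 ≤ m) (hmn : m ≤ n)
    (hp : p.Prime) (hpD : D < p) (hra : ra + n = m * n + m)
    (hrb : rb + n + m = m * n) (hD : D = 2 * m * n) (hrb0 : 0 < rb) {t : SeriesTriple}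
    (ht : HalphenIVP ((ra : ℂ) / D) ((rb : ℂ) / D) ((2 * m ^ 2 * n ^ 2 : ℕ) : ℂ) t) :
    IsPIntegral p (hauptmodul t) ↔
      ∃ X Y : ℤ, (X = 1 ∨ X = -1) ∧ (Y = 1 ∨ Y = -1) ∧
        (((p : ℤ) ≡ X [ZMOD 2 * (m : ℤ)] ∧ (p : ℤ) ≡ Y [ZMOD 2 * (n : ℤ)]) ∨
          ((p : ℤ) ≡ (m : ℤ) + X [ZMOD 2 * (m : ℤ)] ∧
            (p : ℤ) ≡ (n : ℤ) + Y [ZMOD 2 * (n : ℤ)])) := by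
  have : Fact p.Prime := ⟨hp⟩
  have hn : 2 ≤ n := hm.trans hmn
  have hnD : 2 * n ≤ D := by rw [hD]; nlinarith
  have hmD : 2 * m ≤ D := by rw [hD]; nlinarith
  have hra0 : 0 < ra := by nlinarith
  have hraD : ra < D := by rw [hD]; nlinarith
  have hrbD : rb < D := by omega
  have hp2 : p ≠ 2 := by omega
  have hpodd : Odd (p : ℤ) := by exact_mod_cast hp.odd_of_ne_two hp2
  have cop : ∀ k, 0 < k → k < p → p.Coprime k := fun k h1 h2 =>
    (Nat.Prime.coprime_iff_not_dvd hp).2 fun h => absurd (Nat.le_of_dvd h1 h) (by omega)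
  have hcD := cop D (by omega) hpD
  have hc2 := cop 2 (by omega) (by omega)
  have hcm := cop m (by omega) (by omega)
  have hcn := cop n (by omega) (by omega)
  have hcs : p.Coprime (2 * m ^ 2 * n ^ 2) :=
    ((hc2.mul_right (hcm.pow_right 2)).mul_right (hcn.pow_right 2))
  have hs0 : 2 * m ^ 2 * n ^ 2 ≠ 0 := by positivity
  have hraZ : (ra : ℤ) = m * n - n + m := by zify at hra; linarith
  have hrbZ : (rb : ℤ) = m * n - n - m := by zify at hrb; linarith
  have hDZ : (D : ℤ) = 2 * m * n := by rw [hD]; push_cast; ring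
  have hmZ : (0 : ℤ) < m := by omega
  have hnZ : (0 : ℤ) < n := by omega
  have : NeZero D := ⟨by omega⟩
  constructor
  · intro hJ
    obtain ⟨d1, d2⟩ := dvd_sq_sub_sq_of_isPadicIntegral hp2 hcD hra0 hraD hrb0 hrbD
      (ht.isPadicIntegral_expOf hcs hs0 hcD hra0 hraD hrb0 hrbD hJ)
    have ea := mul_dworkResidue_succ hcD ra 0
    have eb := mul_dworkResidue_succ hcD rb 0
    rw [dworkResidue_zero hraD, zero_add] at ea
    rw [dworkResidue_zero hrbD, zero_add] at eb
    have pa := dworkResidue_pos hcD hra0 hraD 1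
    have pb := dworkResidue_pos hcD hrb0 hrbD 1
    have la := dworkResidue_lt (p := p) (D := D) ra 1
    have lb := dworkResidue_lt (p := p) (D := D) rb 1
    generalize dworkResidue p D ra 1 = ra' at *
    generalize dworkResidue p D rb 1 = rb' at *
    obtain ⟨α, hα⟩ := Nat.modEq_iff_dvd.1 ea.symm
    obtain ⟨β, hβ⟩ := Nat.modEq_iff_dvd.1 eb.symm
    push_cast at hα hβ
    -- the exponent differences of the image are again multiples of `2 n` and of `2 m`
    obtain ⟨X, hX⟩ : (2 * n : ℤ) ∣ (D : ℤ) - ra' - rb' := by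
      have h1 : IsCoprime (2 * n : ℤ) p := by
        have := Nat.isCoprime_iff_coprime.2 (hc2.mul_right hcn).symm
        exact_mod_cast this
      refine h1.dvd_of_dvd_mul_left ⟨1 + p * m - m - m * α - m * β, ?_⟩
      rw [hDZ] at hα hβ ⊢
      linear_combination -hα - hβ - hraZ - hrbZ
    obtain ⟨Y, hY⟩ : (2 * m : ℤ) ∣ (ra' : ℤ) - rb' := by
      have h1 : IsCoprime (2 * m : ℤ) p := by
        have := Nat.isCoprime_iff_coprime.2 (hc2.mul_right hcm).symm
        exact_mod_cast this
      refine h1.dvd_of_dvd_mul_left ⟨1 + n * α - n * β, ?_⟩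
      rw [hDZ] at hα hβ
      linear_combination hα - hβ + hraZ - hrbZ
    have ndvd : ∀ k : ℕ, 0 < k → 2 * k < p → ¬ (p : ℤ) ∣ (2 * k) ^ 2 := fun k h1 h2 h3 => by
      have h4 : p ∣ 2 * k := hp.dvd_of_dvd_pow (n := 2) (by exact_mod_cast h3)
      exact absurd (Nat.le_of_dvd (by omega) h4) (by omega)
    have hX1 : X = 1 ∨ X = -1 := by
      refine eq_one_or_neg_one_of_dvd hp (ndvd n (by omega) (by omega)) (d := m) ?_ (by omega) ?_
      · have h1 : |2 * (n : ℤ) * X| < 2 * n * m := by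
          rw [← hX, abs_lt]
          constructor <;> linarith
        rw [abs_mul, abs_of_pos (by positivity)] at h1
        exact lt_of_mul_lt_mul_left h1 (by positivity)
      · rw [hX, hDZ, hraZ, hrbZ] at d1
        convert d1 using 1
        ring
    have hY1 : Y = 1 ∨ Y = -1 := by
      refine eq_one_or_neg_one_of_dvd hp (ndvd m (by omega) (by omega)) (d := n) ?_ (by omega) ?_
      · have h1 : |2 * (m : ℤ) * Y| < 2 * m * n := by
          rw [← hY, abs_lt]
          constructor <;> linarith
        rw [abs_mul, abs_of_pos (by positivity)] at h1
        exact lt_of_mul_lt_mul_left h1 (by positivity)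
      · rw [hY, hraZ, hrbZ] at d2
        convert d2 using 1
        ring
    have era : (ra' : ℤ) = m * n - n * X + m * Y := by linarith
    have erb : (rb' : ℤ) = m * n - n * X - m * Y := by linarith
    refine ⟨X, Y, hX1, hY1, (congruence_iff hmZ hnZ hpodd hX1 hY1).1 ⟨⟨α, ?_⟩, ⟨β, ?_⟩⟩⟩
    · rw [← era, ← hraZ, ← hDZ, hα]
    · rw [← erb, ← hrbZ, ← hDZ, hβ]
  · rintro ⟨X, Y, hX, hY, h⟩
    have key := (congruence_iff hmZ hnZ hpodd hX hY).2 h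
    rw [← hraZ, ← hrbZ, ← hDZ] at key
    refine ht.isPIntegral hcs hs0 hcD hra0 hraD hrb0 hrbD
      (dworkHypLog_one_eq hra0 hraD hrb0 hrbD ?_)
    have res : ∀ (r r' : ℕ) (z : ℤ), r' < D → (r' : ℤ) = z → (D : ℤ) ∣ p * z - r →
        dworkResidue p D r 1 = r' := fun r r' z h1 h2 h3 =>
      eq_dworkResidue_one hcD h1 ((Nat.modEq_iff_dvd.2 (by push_cast; rwa [h2])).symm)
    rcases hX with rfl | rfl <;> rcases hY with rfl | rfl
    · left
      exact ⟨res _ ra _ hraD (by linarith) key.1, res _ rb _ hrbD (by linarith) key.2⟩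
    · right; left
      exact ⟨res _ rb _ hrbD (by linarith) key.1, res _ ra _ hraD (by linarith) key.2⟩
    · right; right; right
      rw [res _ (D - rb) _ (by omega) (by push_cast [hrbD.le]; linarith) key.1,
        res _ (D - ra) _ (by omega) (by push_cast [hraD.le]; linarith) key.2]
      omega
    · right; right; left
      rw [res _ (D - ra) _ (by omega) (by push_cast [hraD.le]; linarith) key.1,
        res _ (D - rb) _ (by omega) (by push_cast [hrbD.le]; linarith) key.2]
      omega

/-! ### Triangle groups with two infinite orders -/

/-- For two infinite orders, `a = b = (m - 1) / (2 m)`. -/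
theorem isHalphenSolutionTop_iff {m r : ℕ} (hr : 0 < r) (hm : r + 1 = m) (t : SeriesTriple) :
    IsHalphenSolutionTop m t ↔ HalphenIVP ((r : ℂ) / (2 * m : ℕ)) ((r : ℂ) / (2 * m : ℕ))
      ((2 * m ^ 2 : ℕ) : ℂ) t := by
  have hm0 : (m : ℂ) ≠ 0 := by exact_mod_cast (by omega : m ≠ 0)
  have hm1 : (m : ℂ) + 1 ≠ 0 := by exact_mod_cast (by omega : m + 1 ≠ 0)
  have hr' : (r : ℂ) = m - 1 := eq_sub_of_add_eq (by exact_mod_cast hm)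
  have ea : halphenA (1 / m) 0 = (r : ℂ) / (2 * m : ℕ) := by
    rw [halphenA, hr']; push_cast; field_simp; ring
  have eb : halphenB (1 / m) 0 = (r : ℂ) / (2 * m : ℕ) := by
    rw [halphenB, hr']; push_cast; field_simp; ring
  have ec : halphenC (1 / m) 0 = 1 - (r : ℂ) / (2 * m : ℕ) := by
    rw [← ea, halphenA, halphenC]; ring
  constructor
  · intro h
    have hs := h.solves
    rw [ea, eb, ec] at hs
    refine ⟨hs, h.t₁_zero, h.t₂_zero, h.t₃_zero, ?_⟩
    have h1 := hs.coeff_one_t₂ h.t₁_zero h.t₂_zero h.t₃_zero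
    rw [h.t₂_one, hr'] at h1
    push_cast at h1 ⊢
    field_simp at h1
    apply mul_left_cancel₀ hm1
    linear_combination h1
  · intro h
    refine ⟨?_, h.t₁_zero, h.t₃_zero, h.t₂_zero, ?_⟩
    · rw [ea, eb, ec]; exact h.solves
    · rw [h.solves.coeff_one_t₂ h.t₁_zero h.t₂_zero h.t₃_zero, h.scale, hr']
      push_cast
      field_simp
      ring

/-- The exponent difference at infinity vanishes, so that only the sign at `1` remains. -/
theorem HalphenIVP.isPIntegral_iff_infinite {m p r D : ℕ} (hr : 0 < r) (hm : r + 1 = m)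
    (hp : p.Prime) (hD : D = 2 * m) (hpD : D < p) {t : SeriesTriple}
    (ht : HalphenIVP ((r : ℂ) / D) ((r : ℂ) / D) ((2 * m ^ 2 : ℕ) : ℂ) t) :
    IsPIntegral p (hauptmodul t) ↔
      ((p : ℤ) ≡ 1 [ZMOD 2 * (m : ℤ)] ∨ (p : ℤ) ≡ -1 [ZMOD 2 * (m : ℤ)]) := by
  have : Fact p.Prime := ⟨hp⟩
  have hrD : r < D := by omega
  have hp2 : p ≠ 2 := by omega
  obtain ⟨q, hq⟩ : Odd (p : ℤ) := by exact_mod_cast hp.odd_of_ne_two hp2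
  have cop : ∀ k, 0 < k → k < p → p.Coprime k := fun k h1 h2 =>
    (Nat.Prime.coprime_iff_not_dvd hp).2 fun h => absurd (Nat.le_of_dvd h1 h) (by omega)
  have hcD := cop D (by omega) hpD
  have hcs : p.Coprime (2 * m ^ 2) :=
    (cop 2 (by omega) (by omega)).mul_right ((cop m (by omega) (by omega)).pow_right 2)
  have hm0 : 0 < m := by omega
  have hs0 : 2 * m ^ 2 ≠ 0 := by positivity
  have hrZ : (r : ℤ) = m - 1 := by omega
  have hDZ : (D : ℤ) = 2 * m := by omega
  have : NeZero D := ⟨by omega⟩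
  constructor
  · intro hJ
    obtain ⟨d1, -⟩ := dvd_sq_sub_sq_of_isPadicIntegral hp2 hcD hr hrD hr hrD
      (ht.isPadicIntegral_expOf hcs hs0 hcD hr hrD hr hrD hJ)
    have ea := mul_dworkResidue_succ hcD r 0
    rw [dworkResidue_zero hrD, zero_add] at ea
    have pa := dworkResidue_pos hcD hr hrD 1
    have la := dworkResidue_lt (p := p) (D := D) r 1
    generalize dworkResidue p D r 1 = r' at *
    obtain ⟨α, hα⟩ := Nat.modEq_iff_dvd.1 ea.symm
    push_cast at hα
    rw [hDZ, hrZ] at hα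
    have hX : (m : ℤ) - r' = 1 ∨ (m : ℤ) - r' = -1 := by
      refine eq_one_or_neg_one_of_dvd hp (c := 4) (d := m) ?_ (by rw [abs_lt]; omega) (by omega) ?_
      · intro h
        have h4 : p ∣ 2 := hp.dvd_of_dvd_pow (n := 2) (by exact_mod_cast h)
        exact absurd (Nat.le_of_dvd (by omega) h4) (by omega)
      · rw [hDZ, hrZ] at d1
        convert d1 using 1
        ring
    rcases hX with hX | hX
    · left
      refine (Int.modEq_iff_dvd.2 ⟨q - α, ?_⟩).symm
      linear_combination m * hq - hα - p * hX
    · right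
      refine (Int.modEq_iff_dvd.2 ⟨α - q, ?_⟩).symm
      linear_combination hα - m * hq + p * hX
  · intro h
    refine ht.isPIntegral hcs hs0 hcD hr hrD hr hrD (dworkHypLog_one_eq hr hrD hr hrD ?_)
    rcases h with h | h
    · obtain ⟨α, hα⟩ := Int.modEq_iff_dvd.1 h.symm
      have : dworkResidue p D r 1 = r := eq_dworkResidue_one hcD hrD
        ((Nat.modEq_iff_dvd.2 ⟨q - α, by
          push_cast; rw [hDZ, hrZ]; linear_combination m * hq - hα⟩).symm)
      exact Or.inl ⟨this, this⟩
    · obtain ⟨α, hα⟩ := Int.modEq_iff_dvd.1 h.symm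
      have : dworkResidue p D r 1 = m + 1 := eq_dworkResidue_one hcD (by omega)
        ((Nat.modEq_iff_dvd.2 ⟨q + α, by
          push_cast; rw [hDZ, hrZ]; linear_combination m * hq + hα⟩).symm)
      exact Or.inr (Or.inr (Or.inl (by omega)))

end

theorem theorem1 :
    (∀ m₁ m₂ p : ℕ, 2 ≤ m₁ → m₁ ≤ m₂ → 1 / (m₁ : ℝ) + 1 / (m₂ : ℝ) < 1 →
      p.Prime → 2 * m₁ * m₂ < p →
      (∃! t : SeriesTriple, IsHalphenSolution m₁ m₂ t) ∧
      ∀ t : SeriesTriple, IsHalphenSolution m₁ m₂ t →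
        (IsPIntegral p (hauptmodul t) ↔
          ∃ ε ε' : ℤ, (ε = 1 ∨ ε = -1) ∧ (ε' = 1 ∨ ε' = -1) ∧
            (((p : ℤ) ≡ ε [ZMOD 2 * (m₁ : ℤ)] ∧ (p : ℤ) ≡ ε' * ε [ZMOD 2 * (m₂ : ℤ)]) ∨
             ((p : ℤ) ≡ (m₁ : ℤ) + ε [ZMOD 2 * (m₁ : ℤ)] ∧
              (p : ℤ) ≡ (m₂ : ℤ) + ε' * ε [ZMOD 2 * (m₂ : ℤ)])))) ∧
    (∀ m p : ℕ, 2 ≤ m → p.Prime → 2 * m < p →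
      (∃! t : SeriesTriple, IsHalphenSolutionTop m t) ∧
      ∀ t : SeriesTriple, IsHalphenSolutionTop m t →
        (IsPIntegral p (hauptmodul t) ↔
          ((p : ℤ) ≡ 1 [ZMOD 2 * (m : ℤ)] ∨ (p : ℤ) ≡ -1 [ZMOD 2 * (m : ℤ)]))) := by
  refine ⟨fun m n p hm hmn hlt hp hpD => ?_, fun m p hm hp hpD => ?_⟩
  · have hn : 2 ≤ n := hm.trans hmn
    have hsum : n + m < m * n := by
      have hmR : (0 : ℝ) < m := by exact_mod_cast (by omega : 0 < m)
      have hnR : (0 : ℝ) < n := by exact_mod_cast (by omega : 0 < n)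
      rw [div_add_div _ _ hmR.ne' hnR.ne', div_lt_one (mul_pos hmR hnR)] at hlt
      have : (n : ℝ) + m < m * n := by linarith
      exact_mod_cast this
    obtain ⟨rb, hrb⟩ : ∃ rb, rb + n + m = m * n := ⟨m * n - n - m, by omega⟩
    obtain ⟨ra, hra⟩ : ∃ ra, ra + n = m * n + m := ⟨rb + 2 * m, by omega⟩
    have hs0 : 2 * m ^ 2 * n ^ 2 ≠ 0 := by positivity
    have hiff := isHalphenSolution_iff hm hn hra hrb rfl
    constructor
    · simp only [hiff]
      have hD : m * n + m < 2 * m * n := by nlinarith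
      exact HalphenIVP.existsUnique hs0 (by omega) (by omega) (by omega) (by omega)
    · intro t ht
      rw [((hiff t).1 ht).isPIntegral_iff_finite hm hmn hp hpD hra hrb rfl (by omega)]
      -- `(ε, ε') ↦ (ε, ε' ε)` is an involution on pairs of signs
      have inv : ∀ X Y : ℤ, (X = 1 ∨ X = -1) → (Y = 1 ∨ Y = -1) →
          (Y * X = 1 ∨ Y * X = -1) ∧ Y * X * X = Y := fun X Y hX hY => by
        rcases hX with rfl | rfl <;> rcases hY with rfl | rfl <;> norm_num
      constructor
      · rintro ⟨X, Y, hX, hY, h⟩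
        refine ⟨X, Y * X, hX, (inv X Y hX hY).1, ?_⟩
        rwa [(inv X Y hX hY).2]
      · rintro ⟨X, Y, hX, hY, h⟩
        exact ⟨X, Y * X, hX, (inv X Y hX hY).1, h⟩
  · obtain ⟨r, hr⟩ : ∃ r, r + 1 = m := ⟨m - 1, by omega⟩
    have hr0 : 0 < r := by omega
    have hm0 : 0 < m := by omega
    have hs0 : 2 * m ^ 2 ≠ 0 := by positivity
    have hiff := isHalphenSolutionTop_iff hr0 hr
    constructor
    · simp only [hiff]
      exact HalphenIVP.existsUnique hs0 hr0 (by omega) hr0 (by omega)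
    · intro t ht
      exact ((hiff t).1 ht).isPIntegral_iff_infinite hr0 hr hp rfl hpD
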